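/- Let $\Sigma_I,\Sigma_B,\Sigma_O$ be finite alphabets. A DFA $\mathcal A$ over a product alphabet $\Sigma\times\Sigma'$ (every state has at most one successor under each letter) describes the length-preserving relation $$\{(a_1\cdots a_n,\;a'_1\cdots a'_n)\in\Sigma^*\times\Sigma'^* : (a_1,a'_1)\cdots(a_n,a'_n)\in L(\mathcal A)\}.$$ For relations $R\subseteq\Sigma_I^*\times\Sigma_O^*$, $R_1\subseteq\Sigma_I^*\times\Sigma_B^*$ and $R_2\subseteq\Sigma_B^*\times\Sigma_O^*$, the pair $(R_1,R_2)$ meets the TD condition if $\mathrm{Img}(R_1)\subseteq\mathrm{Dom}(R_2)$ and $R_1\circ R_2=R$; it meets the PD condition if $\mathrm{Img}(R_1)\subseteq\mathrm{Dom}(R_2)$, $\mathrm{Dom}(R_1\circ R_2)=\mathrm{Dom}(R)$ and $R_1\circ R_2\subseteq R$. Here $R_1\circ R_2=\{(x,z):\exists y,\ (x,y)\in R_1\text{ and }(y,z)\in R_2\}$. The total (respectively, partial) decomposition problem with a hint $R_1$ for automatic relations is the following decision problem. Given finite alphabets $\Sigma_I,\Sigma_B,\Sigma_O$, a DFA $\mathcal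 A_R$ over $\Sigma_I\times\Sigma_O$ that describes a relation $R$, and a DFA $\mathcal A_{R_1}$ over $\Sigma_I\times\Sigma_B$ that describes a relation $R_1$, decide whether there is a DFA over $\Sigma_B\times\Sigma_O$ that describes a relation $R_2$ such that $(R_1,R_2)$ meets the TD (respectively, PD) condition. An instance is presented by a binary word that lists the sizes of the alphabets and, for each of the two DFAs, the number of states, the initial state, the accepting states and the table of transitions, with all numbers in unary; the length of the word is polynomially related to the total number of letters, states and transitions. **Theorem.** Both problems, the total and the partial decomposition problem with a hint $R_1$ for automatic relations, are in EXPSPACE: each is decided by a deterministic Turing machine that uses space at most $2^{p(n)}$ on inputs of length $n$, for some polynomial $p$. -/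

import Mathlib

/-! ### The total and partial decomposition conditions -/

/-- The TD condition for `(R₁, R₂)` with respect to `R`: every image of `R₁` lies in the domain of
`R₂`, and the composition of `R₁` and `R₂` is exactly `R`. -/
def TDCondition {I B O : Type} (R : SetRel I O) (R₁ : SetRel I B) (R₂ : SetRel B O) : Prop :=
  R₁.cod ⊆ R₂.dom ∧ R₁.comp R₂ = R

/-- The PD condition for `(R₁, R₂)` with respect to `R`: every image of `R₁` lies in the domain of
`R₂`, and the composition has the same domain as `R` and is contained in `R`. -/
def PDCondition {I B O : Type} (R : SetRel I O) (R₁ : SetRel I B) (R₂ : SetRel B O) : Prop :=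
  R₁.cod ⊆ R₂.dom ∧ (R₁.comp R₂).dom = R.dom ∧ R₁.comp R₂ ⊆ R

/-! ### Deterministic automata and automatic relations -/

/-- A DFA over the alphabet `α` with state set `{0, …, numStates - 1}`. Each state has at most one
successor under each letter (`none`: there is no successor). -/
structure FinDFA (α : Type) where
  numStates : ℕ
  start : Fin numStates
  accept : Fin numStates → Bool
  step : Fin numStates → α → Option (Fin numStates)

/-- The language of a DFA: the words that have a run from the initial state to an accepting state.
The fold yields `none` as soon as a transition is missing. -/
def FinDFA.language {α : Type} (A : FinDFA α) : Language α :=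
  {w | ∃ q, w.foldlM A.step A.start = some q ∧ A.accept q = true}

/-- The length-preserving relation on words that is described by a DFA over a product alphabet. -/
def FinDFA.rel {α β : Type} (A : FinDFA (α × β)) : SetRel (List α) (List β) :=
  {p | p.1.length = p.2.length ∧ p.1.zip p.2 ∈ A.language}

/-! ### Instances with a hint for the first component -/

/-- An instance of the decomposition problems for automatic relations with a hint `R₁`: the sizes
of the three finite alphabets (the letters of an alphabet of size `m` are the elements of `Fin m`),
a DFA for the relation `R`, and a DFA for the hint `R₁`. -/
structure HintInstance where
  sizeI : ℕ
  sizeB : ℕ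
  sizeO : ℕ
  dfaR : FinDFA (Fin sizeI × Fin sizeO)
  dfaR₁ : FinDFA (Fin sizeI × Fin sizeB)

/-- The answer to the total decomposition problem is positive. -/
def HintInstance.HasTD (x : HintInstance) : Prop :=
  ∃ A₂ : FinDFA (Fin x.sizeB × Fin x.sizeO), TDCondition x.dfaR.rel x.dfaR₁.rel A₂.rel

/-- The answer to the partial decomposition problem is positive. -/
def HintInstance.HasPD (x : HintInstance) : Prop :=
  ∃ A₂ : FinDFA (Fin x.sizeB × Fin x.sizeO), PDCondition x.dfaR.rel x.dfaR₁.rel A₂.rel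

/-! ### Instances as words -/

/-- A sequence of natural numbers as a binary word: the number `m` is written as `m` times the
symbol `true`, followed by one `false`. -/
def unaryWord (l : List ℕ) : List Bool :=
  l.flatMap fun m => List.replicate m true ++ [false]

/-- A DFA over `Fin k × Fin l` as a sequence of numbers: the number of states, the initial state,
the acceptance bits of the states, and the table of the transitions, where an entry is `0` if there
is no successor and `p + 1` if the successor is `p`. -/
def FinDFA.code {k l : ℕ} (A : FinDFA (Fin k × Fin l)) : List ℕ :=
  [A.numStates, (A.start : ℕ)] ++
    ((List.finRange A.numStates).map fun q => (A.accept q).toNat) ++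
    (List.finRange A.numStates).flatMap fun q =>
      (List.finRange k).flatMap fun a =>
        (List.finRange l).map fun b => (A.step q (a, b)).elim 0 fun p => (p : ℕ) + 1

/-- The word that presents an instance. Its length is bounded by a polynomial in the numbers of
letters, states and transitions of the instance, and conversely. -/
def HintInstance.encode (x : HintInstance) : List Bool :=
  unaryWord ([x.sizeI, x.sizeB, x.sizeO] ++ x.dfaR.code ++ x.dfaR₁.code)

theorem unaryWord_injective : Function.Injective unaryWord := by
  have key : ∀ (m n : ℕ) (u v : List Bool),
      List.replicate m true ++ false :: u = List.replicate n true ++ false :: v →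
        m = n ∧ u = v := by
    intro m
    induction m with
    | zero =>
      intro n u v h
      cases n with
      | zero => simpa using h
      | succ n => simp [List.replicate_succ] at h
    | succ m ih =>
      intro n u v h
      cases n with
      | zero => simp [List.replicate_succ] at h
      | succ n =>
        have h' := ih n u v (by simpa [List.replicate_succ] using h)
        exact ⟨by rw [h'.1], h'.2⟩
  intro l
  induction l with
  | nil =>
    intro l' h
    cases l' with
    | nil => rfl
    | cons n l' => simp [unaryWord] at h
  | cons m l ih =>
    intro l' h
    cases l' with
    | nil => simp [unaryWord] at h
    | cons n l' =>
      have h' := key m n (unaryWord l) (unaryWord l') (by simpa [unaryWord] using h)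
      rw [h'.1, ih h'.2]

theorem FinDFA.code_append_inj {k l : ℕ} {A A' : FinDFA (Fin k × Fin l)} {u v : List ℕ}
    (h : A.code ++ u = A'.code ++ v) : A = A' ∧ u = v := by
  obtain ⟨n, s, f, d⟩ := A
  obtain ⟨n', s', f', d'⟩ := A'
  have hn : n = n' := by
    simp only [FinDFA.code, List.cons_append, List.cons.injEq] at h
    exact h.1
  subst hn
  have hlen : (FinDFA.code ⟨n, s, f, d⟩ : List ℕ).length =
      (FinDFA.code ⟨n, s', f', d'⟩ : List ℕ).length := by
    simp [FinDFA.code, List.length_flatMap]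
  obtain ⟨h1, h2⟩ := List.append_inj h hlen
  refine ⟨?_, h2⟩
  have h3 := List.append_inj h1 (by simp)
  have h4 := List.append_inj h3.1 (by simp)
  have hs : s = s' := by
    have := h4.1
    simp only [List.cons.injEq] at this
    exact Fin.ext this.2.1
  have hf : f = f' := by
    funext q
    have h5 : (f q).toNat = (f' q).toNat := List.map_inj_left.1 h4.2 q (List.mem_finRange q)
    revert h5
    generalize f q = x
    generalize f' q = y
    cases x <;> cases y <;> simp
  have flat : ∀ {α : Type} (L : List α) (g g' : α → List ℕ),
      (∀ a, (g a).length = (g' a).length) → L.flatMap g = L.flatMap g' →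
        ∀ a ∈ L, g a = g' a := by
    intro α L g g' hg
    induction L with
    | nil => simp
    | cons b L ih =>
      intro e
      rw [List.flatMap_cons, List.flatMap_cons] at e
      have e' := List.append_inj e (hg b)
      intro a ha
      rcases List.mem_cons.1 ha with rfl | ha
      · exact e'.1
      · exact ih e'.2 a ha
  have hd : d = d' := by
    funext q p
    obtain ⟨a, b⟩ := p
    have h5 := flat _ _ _ (by intro a; simp [List.length_flatMap]) h3.2 q (List.mem_finRange q)
    have h6 := flat _ _ _ (by intro a; simp) h5 a (List.mem_finRange a)
    have h7 : ((d q (a, b)).elim 0 fun p => (p : ℕ) + 1) =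
        (d' q (a, b)).elim 0 fun p => (p : ℕ) + 1 :=
      List.map_inj_left.1 h6 b (List.mem_finRange b)
    revert h7
    generalize d q (a, b) = x
    generalize d' q (a, b) = y
    cases x <;> cases y <;> simp [Fin.ext_iff]
  subst hs hf hd
  rfl

/-- Different instances are presented by different words. -/
theorem HintInstance.encode_injective : Function.Injective HintInstance.encode := by
  rintro ⟨i, b, o, A, A₁⟩ ⟨i', b', o', A', A₁'⟩ h
  have h := unaryWord_injective h
  simp only [List.cons_append, List.nil_append, List.cons.injEq] at h
  obtain ⟨rfl, rfl, rfl, h⟩ := h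
  obtain ⟨rfl, h⟩ := FinDFA.code_append_inj h
  obtain ⟨rfl, -⟩ := FinDFA.code_append_inj (u := []) (v := []) (by simpa using h)
  rfl

/-- The total decomposition problem with a hint `R₁`, as a language: the set of the words that
present an instance with a positive answer. -/
def TDPHint : Language Bool :=
  {w | ∃ x : HintInstance, x.encode = w ∧ x.HasTD}

/-- The partial decomposition problem with a hint `R₁`, as a language. -/
def PDPHint : Language Bool :=
  {w | ∃ x : HintInstance, x.encode = w ∧ x.HasPD}

/-! ### The class EXPSPACE -/

/-- A deterministic Turing machine that decides `L` in space `s`. The machine is one of Mathlib's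
finite multi-stack machines; a pair of stacks is the same as a tape that is cut at its head. The
alphabet of the input stack is identified with the alphabet of `L`. The machine halts on every
input; it accepts if its control is then in an accepting state. The space in use is the total
number of symbols on all stacks, the input included. -/
structure SpaceDecider {Γ : Type} (L : Language Γ) (s : ℕ → ℕ) where
  tm : Turing.FinTM2
  finiteAlphabets : ∀ k, Finite (tm.Γ k)
  inputAlphabet : Γ ≃ tm.Γ tm.k₀
  accept : Set tm.σ
  halts_correct : ∀ w : List Γ,
    ∃ c ∈ StateTransition.eval tm.step (Turing.initList tm (w.map inputAlphabet)),
      c.var ∈ accept ↔ w ∈ L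
  space_le : ∀ (w : List Γ) (c : tm.Cfg),
    StateTransition.Reaches tm.step (Turing.initList tm (w.map inputAlphabet)) c →
      letI : Fintype tm.K := tm.kFin
      ∑ k, (c.stk k).length ≤ s w.length

/-- `L` belongs to EXPSPACE: it is decided by a deterministic Turing machine in space
`2 ^ p(n)` on inputs of length `n`, for some polynomial `p`. -/
def InEXPSPACE {Γ : Type} (L : Language Γ) : Prop :=
  ∃ p : Polynomial ℕ, Nonempty (SpaceDecider L fun n => 2 ^ p.eval n)

/-! Among the length-preserving relations `R₂` with `R₁ ∘ R₂ ⊆ R` there is a largest one: it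
contains `(y, z)` if every `x` with `(x, y) ∈ R₁` also satisfies `(x, z) ∈ R` (`largestRel`). A
subset construction provides a DFA for it (`exists_rel_eq_largestRel`). The remaining requirements,
`Img R₁ ⊆ Dom R₂` together with `R ⊆ R₁ ∘ R₂` or `Dom R ⊆ Dom (R₁ ∘ R₂)`, are monotone in `R₂`.
Hence a decomposition exists if and only if the largest candidate meets them
(`exists_tdCondition_iff`, `exists_pdCondition_iff`).

Each requirement says that every word of an outer automaton, the one for `R` or the one for `R₁`,
can be completed to a triple `(x, y, z)` with `(x, y) ∈ R₁` and `(y, z)` in the candidate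
(`Refinable`). A nondeterministic automaton guesses the missing letters and carries along a state
for `R₁` and a set of state pairs, so it has exponentially many states. A word that cannot be
completed is a path to a bad node in its determinization (`refinable_iff`). That graph has doubly
exponentially many nodes, each a bit vector of exponential length. Savitch's halving recursion
searches it with exponential depth and frames of exponential length, hence in exponential space
(`SpaceDecidable.halvingReach`).

For the machine side, time does not matter, so algorithms are while-programs on numbers, and the
space is the logarithm of the largest number (`nonempty_spaceDecider_of_run`). Functions computable
with numbers polynomial in a size parameter (`SpaceComputable`) are closed under composition,
pairing and bounded iteration, which yields arithmetic, bounded quantifiers and the halving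
recursion. An input word gets a doubly exponential size; the powers of that size still have singly
exponential logarithms (`SpaceDecidable.inEXPSPACE`). -/

/-! ### Register programs -/

/-- While-programs over registers `0, 1, 2, …` that hold natural numbers. -/
inductive Cmd where
  | inc (x : ℕ)
  | dec (x : ℕ)
  | skip
  | seq (c d : Cmd)
  | loop (x : ℕ) (c : Cmd)

/-- All registers of the program are less than `n`. -/
def Cmd.RegsLT (n : ℕ) : Cmd → Prop
  | .inc x => x < n
  | .dec x => x < n
  | .skip => True
  | .seq c d => c.RegsLT n ∧ d.RegsLT n
  | .loop x c => x < n ∧ c.RegsLT n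

theorem Cmd.RegsLT.mono {m n : ℕ} (h : m ≤ n) : ∀ {c : Cmd}, c.RegsLT m → c.RegsLT n
  | .inc _, hc => lt_of_lt_of_le hc h
  | .dec _, hc => lt_of_lt_of_le hc h
  | .skip, _ => trivial
  | .seq _ _, hc => ⟨hc.1.mono h, hc.2.mono h⟩
  | .loop _ _, hc => ⟨lt_of_lt_of_le hc.1 h, hc.2.mono h⟩

theorem Cmd.exists_regsLT (c : Cmd) : ∃ n, c.RegsLT n := by
  induction c with
  | inc x => exact ⟨x + 1, Nat.lt_succ_self x⟩
  | dec x => exact ⟨x + 1, Nat.lt_succ_self x⟩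
  | skip => exact ⟨0, trivial⟩
  | seq c d hc hd =>
    obtain ⟨m, hm⟩ := hc
    obtain ⟨n, hn⟩ := hd
    exact ⟨max m n, hm.mono (le_max_left _ _), hn.mono (le_max_right _ _)⟩
  | loop x c hc =>
    obtain ⟨m, hm⟩ := hc
    exact ⟨max m (x + 1), lt_of_lt_of_le (Nat.lt_succ_self x) (le_max_right _ _),
      hm.mono (le_max_left _ _)⟩

/-- `Run B c s t`: the program `c` started in the store `s` stops in the store `t`, and no register
is increased beyond `B`. -/
inductive Run (B : ℕ) : Cmd → (ℕ → ℕ) → (ℕ → ℕ) → Prop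
  | inc {x s} (h : s x + 1 ≤ B) : Run B (.inc x) s (Function.update s x (s x + 1))
  | dec {x s} : Run B (.dec x) s (Function.update s x (s x - 1))
  | skip {s} : Run B .skip s s
  | seq {c d s t u} : Run B c s t → Run B d t u → Run B (.seq c d) s u
  | exit {x c s} (h : s x = 0) : Run B (.loop x c) s s
  | cont {x c s t u} (h : s x ≠ 0) : Run B c s t → Run B (.loop x c) t u → Run B (.loop x c) s u

theorem Run.le {B : ℕ} {c : Cmd} {s t : ℕ → ℕ} (h : Run B c s t) (hs : ∀ i, s i ≤ B) :
    ∀ i, t i ≤ B := by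
  induction h with
  | @inc x s h =>
    intro i
    by_cases e : i = x
    · subst e; simpa using h
    · simpa [e] using hs i
  | @dec x s =>
    intro i
    by_cases e : i = x
    · subst e; simpa using (hs i).trans (Nat.le_succ B)
    · simpa [e] using hs i
  | skip => exact hs
  | seq _ _ h₁ h₂ => exact h₂ (h₁ hs)
  | exit _ => exact hs
  | cont _ _ _ h₁ h₂ => exact h₂ (h₁ hs)

/-! ### Bijective base-two numerals -/

/-- The number presented by a bijective base-two numeral, least significant digit first; `true` is
the digit one and `false` is the digit two. -/
def numeralValue : List Bool → ℕ
  | [] => 0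
  | true :: l => 2 * numeralValue l + 1
  | false :: l => 2 * numeralValue l + 2

/-- The successor of a numeral. -/
def numeralSucc : List Bool → List Bool
  | [] => [true]
  | true :: l => false :: l
  | false :: l => true :: numeralSucc l

/-- The predecessor of a numeral. -/
def numeralPred : List Bool → List Bool
  | [] => []
  | false :: l => true :: l
  | [true] => []
  | true :: b :: l => false :: numeralPred (b :: l)

/-- The numeral of a number. -/
def numeral : ℕ → List Bool
  | 0 => []
  | n + 1 => numeralSucc (numeral n)

theorem numeralSucc_ne_nil (l : List Bool) : numeralSucc l ≠ [] := by
  rcases l with - | ⟨- | -, l⟩ <;> simp [numeralSucc]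

theorem numeralPred_numeralSucc (l : List Bool) : numeralPred (numeralSucc l) = l := by
  induction l with
  | nil => rfl
  | cons b l ih =>
    cases b
    · obtain ⟨c, l', h⟩ := List.exists_cons_of_ne_nil (numeralSucc_ne_nil l)
      rw [h] at ih
      simp [numeralSucc, h, numeralPred, ih]
    · rfl

theorem numeral_pred (n : ℕ) : numeral (n - 1) = numeralPred (numeral n) := by
  cases n with
  | zero => rfl
  | succ n => simp [numeral, numeralPred_numeralSucc]

theorem numeralValue_succ (l : List Bool) : numeralValue (numeralSucc l) = numeralValue l + 1 := by
  induction l with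
  | nil => rfl
  | cons b l ih => cases b <;> simp [numeralSucc, numeralValue, ih]; ring

theorem numeralValue_numeral (n : ℕ) : numeralValue (numeral n) = n := by
  induction n with
  | zero => rfl
  | succ n ih => rw [numeral, numeralValue_succ, ih]

theorem numeralValue_injective : Function.Injective numeralValue := by
  intro l
  induction l with
  | nil =>
    intro l' h
    rcases l' with - | ⟨- | -, l'⟩ <;> simp [numeralValue] at h ⊢
  | cons b l ih =>
    intro l' h
    rcases l' with - | ⟨c, l'⟩
    · cases b <;> simp [numeralValue] at h
    · have : b = c ∧ numeralValue l = numeralValue l' := by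
        cases b <;> cases c <;> simp [numeralValue] at h ⊢ <;> omega
      rw [this.1, ih this.2]

/-- Bijective numeration has no leading zeros, so every binary word is a numeral. The input stack
therefore already holds the content of a register, without any conversion. -/
theorem numeral_numeralValue (l : List Bool) : numeral (numeralValue l) = l :=
  numeralValue_injective (numeralValue_numeral _)

theorem two_pow_length_le (l : List Bool) : 2 ^ l.length ≤ numeralValue l + 1 := by
  induction l with
  | nil => simp [numeralValue]
  | cons b l ih => cases b <;> simp only [numeralValue, List.length_cons, pow_succ] <;> omega

theorem numeralValue_lt (l : List Bool) : numeralValue l + 1 < 2 ^ (l.length + 1) := by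
  induction l with
  | nil => simp [numeralValue]
  | cons b l ih =>
    rw [List.length_cons, pow_succ]
    cases b <;> simp only [numeralValue] <;> omega

/-- Numerals of length `l` present exactly the numbers from `2 ^ l - 1` to `2 ^ (l + 1) - 2`. This
turns bounds on numbers into bounds on space. -/
theorem log_numeralValue (l : List Bool) : Nat.log 2 (numeralValue l + 1) = l.length :=
  Nat.log_eq_of_pow_le_of_lt_pow (two_pow_length_le l) (numeralValue_lt l)

theorem length_numeral (n : ℕ) : (numeral n).length = Nat.log 2 (n + 1) := by
  rw [← log_numeralValue, numeralValue_numeral]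

/-! ### Execution of register programs by multi-stack machines -/

open Turing

/-- Reachability along configurations that satisfy `P`. -/
def ReachesIn {C : Type} (f : C → Option C) (P : C → Prop) : C → C → Prop :=
  Relation.ReflTransGen fun a b => b ∈ f a ∧ P b

theorem ReachesIn.reaches {C : Type} {f : C → Option C} {P : C → Prop} {a b : C}
    (h : ReachesIn f P a b) : StateTransition.Reaches f a b :=
  Relation.ReflTransGen.mono (fun _ _ h => h.1) _ _ h

/-- If a computation halts and stays in `P`, all configurations that it reaches satisfy `P`. -/
theorem ReachesIn.of_halts {C : Type} {f : C → Option C} {P : C → Prop} {a b c : C}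
    (h : ReachesIn f P a b) (hb : f b = none) (ha : P a) (hc : StateTransition.Reaches f a c) :
    P c := by
  -- Since `f` is a function, the computation from `a` is unique, and it ends at `b`; so `c` lies on
  -- the path to `b`.
  induction h using Relation.ReflTransGen.head_induction_on with
  | refl =>
    rcases Relation.ReflTransGen.cases_head hc with rfl | ⟨d, hd, -⟩
    · exact ha
    · rw [hb] at hd; cases hd
  | head h₁ h₂ ih =>
    rcases Relation.ReflTransGen.cases_head hc with rfl | ⟨d, hd, hdc⟩
    · exact ha
    · cases Option.mem_unique hd h₁.1
      exact ih h₁.2 hdc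

/-- Labels for the instructions of a program. -/
@[reducible] def Cmd.Label : Cmd → Type
  | .inc _ => Bool
  | .dec _ => Bool
  | .skip => Unit
  | .seq c d => c.Label ⊕ d.Label
  | .loop _ c => Option c.Label

@[reducible] def Cmd.fintypeLabel : (c : Cmd) → Fintype c.Label
  | .inc _ => inferInstanceAs (Fintype Bool)
  | .dec _ => inferInstanceAs (Fintype Bool)
  | .skip => inferInstanceAs (Fintype Unit)
  | .seq c d => @instFintypeSum _ _ c.fintypeLabel d.fintypeLabel
  | .loop _ c => @instFintypeOption _ c.fintypeLabel

/-- The label where the execution of a program begins. -/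
def Cmd.entry : (c : Cmd) → c.Label
  | .inc _ => false
  | .dec _ => false
  | .skip => ()
  | .seq c _ => .inl c.entry
  | .loop _ _ => none

/-- The stack of a register; `none` is an auxiliary stack. -/
def regStack (n x : ℕ) : Option (Fin n) :=
  if h : x < n then some ⟨x, h⟩ else none

section Compile

variable {n : ℕ} {Λ : Type}

abbrev RegStmt (n : ℕ) (Λ : Type) : Type :=
  TM2.Stmt (fun _ : Option (Fin n) => Bool) Λ (Option Bool)

/-- Pop a stack into the control and branch on whether it was empty. -/
def popCase (k : Option (Fin n)) (qNone qTrue qFalse : RegStmt n Λ) : RegStmt n Λ :=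
  .pop k (fun _ o => o)
    (.branch (fun v => v.isSome) (.branch (fun v => v == some true) qTrue qFalse) qNone)

/-- Move the auxiliary stack back to stack `k`. -/
def restoreStmt (k : Option (Fin n)) (self exit : Λ) : RegStmt n Λ :=
  popCase none (.goto fun _ => exit) (.push k (fun _ => true) (.goto fun _ => self))
    (.push k (fun _ => false) (.goto fun _ => self))

/-- The machine instructions for the labels of a program. -/
def Cmd.code (n : ℕ) : (c : Cmd) → (exit : Λ) → (c.Label → Λ) → c.Label → RegStmt n Λ
  | .inc x, exit, e, l =>
    match l with
    -- The carry: a digit two becomes a one, parked on the auxiliary stack, and the carry moves on.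
    -- A digit one or the end of the numeral absorbs it. The label `true` then moves the parked
    -- digits back.
    | false => popCase (regStack n x) (.push (regStack n x) (fun _ => true) (.goto fun _ => e true))
        (.push (regStack n x) (fun _ => false) (.goto fun _ => e true))
        (.push none (fun _ => true) (.goto fun _ => e false))
    | true => restoreStmt (regStack n x) (e true) exit
  | .dec x, exit, e, l =>
    match l with
    -- The borrow: a digit one becomes a two and the borrow moves on, unless it was the last digit,
    -- which disappears. The `peek` separates these cases.
    | false => popCase (regStack n x) (.goto fun _ => e true)
        (.peek (regStack n x) (fun _ o => o) (.branch (fun v => v.isSome)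
          (.push none (fun _ => false) (.goto fun _ => e false)) (.goto fun _ => e true)))
        (.push (regStack n x) (fun _ => true) (.goto fun _ => e true))
    | true => restoreStmt (regStack n x) (e true) exit
  | .skip, exit, _, _ => .goto fun _ => exit
  | .seq c d, exit, e, l =>
    match l with
    | .inl l => c.code n (e (.inr d.entry)) (fun l => e (.inl l)) l
    | .inr l => d.code n exit (fun l => e (.inr l)) l
  | .loop x c, exit, e, l =>
    match l with
    | none => .peek (regStack n x) (fun _ o => o) (.branch (fun v => v.isSome)
        (.goto fun _ => e (some c.entry)) (.goto fun _ => exit))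
    | some l => c.code n (e none) (fun l => e (some l)) l

/-- The stacks that present a store. -/
def storeStacks (n : ℕ) (s : ℕ → ℕ) : Option (Fin n) → List Bool :=
  fun k => k.elim [] fun i => numeral (s i)

theorem storeStacks_regStack {s : ℕ → ℕ} {x : ℕ} (h : x < n) :
    storeStacks n s (regStack n x) = numeral (s x) := by
  simp [storeStacks, regStack, h]

theorem storeStacks_update {s : ℕ → ℕ} {x v : ℕ} (h : x < n) :
    storeStacks n (Function.update s x v) =
      Function.update (storeStacks n s) (regStack n x) (numeral v) := by
  funext k
  cases k with
  | none => simp [storeStacks, regStack, h]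
  | some i =>
    by_cases e : i = ⟨x, h⟩
    · subst e; simp [storeStacks, regStack, h]
    · have : (i : ℕ) ≠ x := fun h' => e (Fin.ext h')
      simp [storeStacks, regStack, h, e, this]

abbrev RegCfg (n : ℕ) (Λ : Type) : Type :=
  TM2.Cfg (fun _ : Option (Fin n) => Bool) Λ (Option Bool)

/-- All stacks have length at most `L`. -/
def StacksLE (L : ℕ) (c : RegCfg n Λ) : Prop :=
  ∀ k, (c.stk k).length ≤ L

/-- Replace the contents of stack `k` and of the auxiliary stack. -/
def setStacks (S : Option (Fin n) → List Bool) (k : Option (Fin n)) (l a : List Bool) :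
    Option (Fin n) → List Bool :=
  Function.update (Function.update S k l) none a

variable {S : Option (Fin n) → List Bool} {k : Option (Fin n)} {L : ℕ}

theorem setStacks_stacksLE {lab : Option Λ} {v : Option Bool} {l a : List Bool}
    (hS : ∀ k, (S k).length ≤ L) (hl : l.length ≤ L) (ha : a.length ≤ L) :
    StacksLE L (⟨lab, v, setStacks S k l a⟩ : RegCfg n Λ) := by
  intro j
  simp only [setStacks, Function.update_apply]
  split_ifs <;> simp_all

theorem setStacks_self (hk : k ≠ none) (l a : List Bool) : setStacks S k l a k = l := by
  simp [setStacks, hk]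

theorem setStacks_none (l a : List Bool) : setStacks S k l a none = a := by
  simp [setStacks]

theorem update_setStacks_self (hk : k ≠ none) (l l' a : List Bool) :
    Function.update (setStacks S k l a) k l' = setStacks S k l' a := by
  simp only [setStacks]
  rw [Function.update_comm hk.symm, Function.update_idem, Function.update_comm hk]

theorem update_setStacks_none (l a a' : List Bool) :
    Function.update (setStacks S k l a) none a' = setStacks S k l a' := by
  simp only [setStacks, Function.update_idem]

variable {M : Λ → RegStmt n Λ}

theorem reachesIn_head {a b c : RegCfg n Λ} (hb : StacksLE L b) (h : TM2.step M a = some b)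
    (hc : ReachesIn (TM2.step M) (StacksLE L) b c) : ReachesIn (TM2.step M) (StacksLE L) a c :=
  Relation.ReflTransGen.head ⟨h, hb⟩ hc

/-! ### Correctness of the single instructions -/

theorem reachesIn_restore (hk : k ≠ none) {self exit : Λ} (hM : M self = restoreStmt k self exit)
    (hS : ∀ k, (S k).length ≤ L) : ∀ (a l : List Bool) (v : Option Bool), l.length + a.length ≤ L →
      ∃ v', ReachesIn (TM2.step M) (StacksLE L) ⟨some self, v, setStacks S k l a⟩
        ⟨some exit, v', setStacks S k (a.reverse ++ l) []⟩ := by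
  intro a
  induction a with
  | nil =>
    intro l v h
    refine ⟨none, reachesIn_head (b := ⟨some exit, none, setStacks S k l []⟩)
      (setStacks_stacksLE hS (by simpa using h) (by simp)) ?_ .refl⟩
    simp [hM, restoreStmt, popCase, setStacks_none, update_setStacks_none]
  | cons b a ih =>
    intro l v h
    simp only [List.length_cons] at h
    obtain ⟨v', h'⟩ := ih (b :: l) (some b) (by simp only [List.length_cons]; omega)
    refine ⟨v', reachesIn_head (b := ⟨some self, some b, setStacks S k (b :: l) a⟩)
      (setStacks_stacksLE hS (by simp only [List.length_cons]; omega) (by omega)) ?_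
      (by simpa using h')⟩
    cases b <;>
    simp [hM, restoreStmt, popCase, setStacks_none, update_setStacks_none, setStacks_self hk,
      update_setStacks_self hk]

theorem length_le_numeralSucc (l : List Bool) : l.length ≤ (numeralSucc l).length := by
  induction l with
  | nil => simp
  | cons b l ih => cases b <;> simp [numeralSucc, ih]

/-- Induction along the carry. The list `a` holds the digits already passed, most recent first. The
length of the final numeral bounds all stacks on the way, because `numeralSucc` never shortens a
numeral. -/
theorem reachesIn_inc {x : ℕ} (hx : x < n) {exit : Λ} {e : (Cmd.inc x).Label → Λ}
    (hM : ∀ l, M (e l) = Cmd.code n (.inc x) exit e l) (hS : ∀ k, (S k).length ≤ L) :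
    ∀ (l a : List Bool) (v : Option Bool), (numeralSucc l).length + a.length ≤ L →
      ∃ v', ReachesIn (TM2.step M) (StacksLE L) ⟨some (e false), v, setStacks S (regStack n x) l a⟩
        ⟨some exit, v', setStacks S (regStack n x) (a.reverse ++ numeralSucc l) []⟩ := by
  have hk : regStack n x ≠ none := by simp [regStack, hx]
  have hr := hM true
  have h0 := hM false
  intro l
  induction l with
  | nil =>
    intro a v h
    simp only [numeralSucc] at h ⊢
    obtain ⟨v', h'⟩ := reachesIn_restore hk hr hS a [true] none h
    refine ⟨v', reachesIn_head (setStacks_stacksLE hS ?_ ?_) ?_ h'⟩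
    · simp only [List.length_cons] at h ⊢; omega
    · omega
    · simp [h0, Cmd.code, popCase, setStacks_self hk, update_setStacks_self hk]
  | cons b l ih =>
    intro a v h
    cases b
    · simp only [numeralSucc, List.length_cons] at h ⊢
      obtain ⟨v', h'⟩ := ih (true :: a) (some false) (by simp only [List.length_cons]; omega)
      refine ⟨v', reachesIn_head (setStacks_stacksLE hS ?_ ?_) ?_ (by simpa using h')⟩
      · have := length_le_numeralSucc l; omega
      · simp only [List.length_cons]; omega
      · simp [h0, Cmd.code, popCase, setStacks_self hk, update_setStacks_self hk, setStacks_none,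
          update_setStacks_none]
    · simp only [numeralSucc] at h ⊢
      obtain ⟨v', h'⟩ := reachesIn_restore hk hr hS a (false :: l) (some true) h
      refine ⟨v', reachesIn_head (setStacks_stacksLE hS ?_ ?_) ?_ h'⟩
      · omega
      · omega
      · simp [h0, Cmd.code, popCase, setStacks_self hk, update_setStacks_self hk]

theorem reachesIn_dec {x : ℕ} (hx : x < n) {exit : Λ} {e : (Cmd.dec x).Label → Λ}
    (hM : ∀ l, M (e l) = Cmd.code n (.dec x) exit e l) (hS : ∀ k, (S k).length ≤ L) :
    ∀ (l a : List Bool) (v : Option Bool), l.length + a.length ≤ L →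
      ∃ v', ReachesIn (TM2.step M) (StacksLE L) ⟨some (e false), v, setStacks S (regStack n x) l a⟩
        ⟨some exit, v', setStacks S (regStack n x) (a.reverse ++ numeralPred l) []⟩ := by
  have hk : regStack n x ≠ none := by simp [regStack, hx]
  have hr := hM true
  have h0 := hM false
  intro l
  induction l with
  | nil =>
    intro a v h
    simp only [numeralPred] at h ⊢
    obtain ⟨v', h'⟩ := reachesIn_restore hk hr hS a [] none h
    refine ⟨v', reachesIn_head (setStacks_stacksLE hS ?_ ?_) ?_ h'⟩
    · simp
    · omega
    · simp [h0, Cmd.code, popCase, setStacks_self hk, update_setStacks_self hk]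
  | cons b l ih =>
    intro a v h
    cases b
    · simp only [numeralPred, List.length_cons] at h ⊢
      obtain ⟨v', h'⟩ := reachesIn_restore hk hr hS a (true :: l) (some false)
        (by simpa using h)
      refine ⟨v', reachesIn_head (setStacks_stacksLE hS ?_ ?_) ?_ h'⟩
      · simp only [List.length_cons]; omega
      · omega
      · simp [h0, Cmd.code, popCase, setStacks_self hk, update_setStacks_self hk]
    · rcases l with - | ⟨b, l⟩
      · simp only [numeralPred, List.length_cons] at h ⊢
        obtain ⟨v', h'⟩ := reachesIn_restore hk hr hS a [] none
          (by simp only [List.length_nil] at h ⊢; omega)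
        refine ⟨v', reachesIn_head (setStacks_stacksLE hS ?_ ?_) ?_ h'⟩
        · simp
        · omega
        · simp [h0, Cmd.code, popCase, setStacks_self hk, update_setStacks_self hk]
      · simp only [List.length_cons] at h
        obtain ⟨v', h'⟩ := ih (false :: a) (some b) (by simp only [List.length_cons]; omega)
        refine ⟨v', reachesIn_head (setStacks_stacksLE hS ?_ ?_) ?_
          (by simpa [numeralPred] using h')⟩
        · simp only [List.length_cons]; omega
        · simp only [List.length_cons]; omega
        · simp [h0, Cmd.code, popCase, setStacks_self hk, update_setStacks_self hk,
            setStacks_none, update_setStacks_none]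

theorem storeStacks_eq_setStacks {s : ℕ → ℕ} {x : ℕ} (h : x < n) :
    storeStacks n s = setStacks (storeStacks n s) (regStack n x) (numeral (s x)) [] := by
  funext k
  simp only [setStacks, Function.update_apply]
  split_ifs with h1 h2
  · subst h1; rfl
  · subst h2; exact storeStacks_regStack h
  · rfl

theorem setStacks_storeStacks {s : ℕ → ℕ} {x v : ℕ} (h : x < n) :
    setStacks (storeStacks n s) (regStack n x) (numeral v) [] =
      storeStacks n (Function.update s x v) := by
  rw [storeStacks_update h]
  funext k
  simp only [setStacks, Function.update_apply]
  split_ifs with h1 h2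
  · subst h1; simp [regStack, h] at h2
  · subst h1; rfl
  · rfl
  · rfl

theorem length_numeral_le {v B : ℕ} (h : v ≤ B) : (numeral v).length ≤ Nat.log 2 (B + 1) := by
  rw [length_numeral]
  exact Nat.log_mono_right (by omega)

theorem storeStacks_length_le {s : ℕ → ℕ} {B : ℕ} (hs : ∀ i, s i ≤ B) (k : Option (Fin n)) :
    (storeStacks n s k).length ≤ Nat.log 2 (B + 1) := by
  cases k with
  | none => simp [storeStacks]
  | some i => exact length_numeral_le (hs i)

/-- Induction on the run. The exit label and the embedding `e` of labels are arbitrary because the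
code of a subprogram sits inside a larger machine. At instruction boundaries the stacks are numerals
of numbers at most `B`, hence no longer than `Nat.log 2 (B + 1)`, and the auxiliary stack is empty.
-/
theorem Run.reachesIn {B : ℕ} {c : Cmd} {s t : ℕ → ℕ} (h : Run B c s t) :
    ∀ (_ : c.RegsLT n) (_ : ∀ i, s i ≤ B) (exit : Λ) (e : c.Label → Λ)
      (_ : ∀ l, M (e l) = c.code n exit e l) (v : Option Bool), ∃ v',
      ReachesIn (TM2.step M) (StacksLE (Nat.log 2 (B + 1))) ⟨some (e c.entry), v, storeStacks n s⟩
        ⟨some exit, v', storeStacks n t⟩ := by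
  induction h with
  | @inc x s h =>
    intro hc hs exit e hM v
    have := reachesIn_inc hc hM (storeStacks_length_le hs) (numeral (s x)) [] v
      (by simpa [numeral] using length_numeral_le h)
    rw [← storeStacks_eq_setStacks hc] at this
    simp only [List.reverse_nil, List.nil_append] at this
    have e : numeralSucc (numeral (s x)) = numeral (s x + 1) := rfl
    rw [e, setStacks_storeStacks hc] at this
    exact this
  | @dec x s =>
    intro hc hs exit e hM v
    have := reachesIn_dec hc hM (storeStacks_length_le hs) (numeral (s x)) [] v
      (by simpa using length_numeral_le (hs x))
    rw [← storeStacks_eq_setStacks hc] at this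
    simp only [List.reverse_nil, List.nil_append] at this
    rw [← numeral_pred, setStacks_storeStacks hc] at this
    exact this
  | @skip s =>
    intro _ hs exit e hM v
    refine ⟨v, reachesIn_head (fun k => storeStacks_length_le hs k) ?_ .refl⟩
    simp [hM, Cmd.code]
  | @seq c d s t u h₁ h₂ ih₁ ih₂ =>
    intro hc hs exit e hM v
    obtain ⟨v₁, h₁'⟩ := ih₁ hc.1 hs (e (.inr d.entry)) (fun l => e (.inl l)) (fun l => hM (.inl l)) v
    obtain ⟨v₂, h₂'⟩ := ih₂ hc.2 (h₁.le hs) exit (fun l => e (.inr l)) (fun l => hM (.inr l)) v₁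
    exact ⟨v₂, h₁'.trans h₂'⟩
  | @exit x c s h =>
    intro hc hs exit e hM v
    refine ⟨none, reachesIn_head (fun k => storeStacks_length_le hs k) ?_ .refl⟩
    simp [hM, Cmd.entry, Cmd.code, storeStacks_regStack hc.1, h, numeral]
  | @cont x c s t u h h₁ h₂ ih₁ ih₂ =>
    intro hc hs exit e hM v
    obtain ⟨b, l, hl⟩ := List.exists_cons_of_ne_nil (l := numeral (s x)) (by
      obtain ⟨m, hm⟩ := Nat.exists_eq_succ_of_ne_zero h
      rw [hm]; exact numeralSucc_ne_nil _)
    obtain ⟨v₁, h₁'⟩ := ih₁ hc.2 hs (e none) (fun l => e (some l)) (fun l => hM (some l)) (some b)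
    obtain ⟨v₂, h₂'⟩ := ih₂ hc (h₁.le hs) exit e hM v₁
    refine ⟨v₂, reachesIn_head (fun k => storeStacks_length_le hs k) ?_ (h₁'.trans h₂')⟩
    simp [hM, Cmd.entry, Cmd.code, storeStacks_regStack hc.1, hl]

end Compile

/-- The instructions of a register program with result register `x`: when the program has ended, the
control is set to `none` if the result is zero. -/
def Cmd.instructions (c : Cmd) (n x : ℕ) : Option c.Label → RegStmt (n + 1) (Option c.Label)
  | some l => c.code (n + 1) none some l
  | none => .pop (regStack (n + 1) x) (fun _ o => o) .halt

theorem Run.reachesIn_instructions {B n x : ℕ} {c : Cmd} {s t : ℕ → ℕ} (h : Run B c s t)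
    (hc : c.RegsLT (n + 1)) (hx : x < n + 1) (hs : ∀ i, s i ≤ B) :
    ∃ d : RegCfg (n + 1) (Option c.Label),
      ReachesIn (TM2.step (c.instructions n x)) (StacksLE (Nat.log 2 (B + 1)))
        ⟨some (some c.entry), none, storeStacks (n + 1) s⟩ d ∧
      TM2.step (c.instructions n x) d = none ∧ (d.var ≠ none ↔ t x ≠ 0) := by
  obtain ⟨v, hv⟩ := h.reachesIn (M := c.instructions n x) hc hs none some (fun l => rfl) none
  refine ⟨⟨none, (numeral (t x)).head?, Function.update (storeStacks (n + 1) t)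
    (regStack (n + 1) x) (numeral (t x)).tail⟩, hv.tail ⟨?_, ?_⟩, rfl, ?_⟩
  · simp [Cmd.instructions, storeStacks_regStack hx]
  · intro k
    by_cases hk : k = regStack (n + 1) x
    · subst hk
      have := length_numeral_le (h.le hs x)
      simp only [Function.update_self, List.length_tail]
      omega
    · simp only [Function.update_of_ne hk]
      exact storeStacks_length_le (h.le hs) k
  · rcases h0 : t x with - | m
    · simp [numeral]
    · obtain ⟨b, l, hl⟩ := List.exists_cons_of_ne_nil (numeralSucc_ne_nil (numeral m))
      simp [numeral, hl]

/-- The machine of a register program: the input is the numeral in register `0`. -/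
def Cmd.machine (c : Cmd) (n x : ℕ) : FinTM2 :=
  letI := c.fintypeLabel
  { K := Option (Fin (n + 1))
    k₀ := some 0
    k₁ := some 0
    Γ := fun _ => Bool
    Λ := Option c.Label
    main := some c.entry
    σ := Option Bool
    initialState := none
    m := c.instructions n x }

/-- The store with the value of a word in register `0`. -/
def inputStore (w : List Bool) : ℕ → ℕ :=
  fun i => if i = 0 then numeralValue w else 0

theorem inputStore_le {w : List Bool} {B : ℕ} (h : numeralValue w ≤ B) (i : ℕ) :
    inputStore w i ≤ B := by
  simp only [inputStore]
  split_ifs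
  · exact h
  · exact Nat.zero_le _

theorem initList_machine (c : Cmd) (n x : ℕ) (w : List Bool) :
    initList (c.machine n x) w =
      (⟨some (some c.entry), none, storeStacks (n + 1) (inputStore w)⟩ :
        RegCfg (n + 1) (Option c.Label)) := by
  unfold initList
  congr 1
  funext k
  rcases k with - | k
  · rfl
  · by_cases h : k = 0
    · subst h
      exact (numeral_numeralValue w).symm
    · have h2 : some k ≠ (c.machine n x).k₀ := fun e => h (Option.some.inj e)
      refine (dif_neg h2).trans ?_
      simp [storeStacks, inputStore, h, numeral]
      rfl

/-- A language is decided by a register program that computes its characteristic function, in space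
proportional to the logarithm of the largest number in a register. -/
theorem nonempty_spaceDecider_of_run {L : Language Bool} {s : ℕ → ℕ} (c : Cmd) (n x : ℕ)
    (hc : c.RegsLT (n + 1)) (hx : x < n + 1) (B : List Bool → ℕ)
    (hB : ∀ w, numeralValue w ≤ B w)
    (hs : ∀ w, (n + 2) * Nat.log 2 (B w + 1) ≤ s w.length)
    (h : ∀ w, ∃ t, Run (B w) c (inputStore w) t ∧ (t x ≠ 0 ↔ w ∈ L)) :
    Nonempty (SpaceDecider L s) := by
  refine ⟨{ tm := c.machine n x
            finiteAlphabets := fun _ => inferInstanceAs (Finite Bool)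
            inputAlphabet := Equiv.refl Bool
            accept := {v : Option Bool | v ≠ none}
            halts_correct := ?_
            space_le := ?_ }⟩
  · intro w
    obtain ⟨t, ht, hw⟩ := h w
    obtain ⟨d, h1, h2, h3⟩ := ht.reachesIn_instructions hc hx (inputStore_le (hB w))
    refine ⟨d, StateTransition.mem_eval.2 ⟨?_, h2⟩, h3.trans hw⟩
    have h4 := (initList_machine c n x (w.map (Equiv.refl Bool))).trans
      (show _ = (⟨some (some c.entry), none, storeStacks (n + 1) (inputStore w)⟩ :
        RegCfg (n + 1) (Option c.Label)) by simp)
    exact (congrArg (fun a => StateTransition.Reaches (c.machine n x).step a d) h4).mpr h1.reaches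
  · intro w d hd
    obtain ⟨t, ht, hw⟩ := h w
    obtain ⟨d', h1, h2, h3⟩ := ht.reachesIn_instructions hc hx (inputStore_le (hB w))
    have h4 := (initList_machine c n x (w.map (Equiv.refl Bool))).trans
      (show _ = (⟨some (some c.entry), none, storeStacks (n + 1) (inputStore w)⟩ :
        RegCfg (n + 1) (Option c.Label)) by simp)
    have h5 := h1.of_halts h2 (fun k => storeStacks_length_le (inputStore_le (hB w)) k)
      ((congrArg (fun a => StateTransition.Reaches (c.machine n x).step a d) h4).mp hd)
    -- The factor `n + 2` counts the `n + 1` register stacks and the auxiliary stack.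
    refine le_trans ?_ (hs w)
    refine le_trans (Finset.sum_le_card_nsmul _ _ (Nat.log 2 (B w + 1)) fun k _ => h5 k) ?_
    rw [smul_eq_mul]
    refine Nat.mul_le_mul_right _ (le_of_eq ?_)
    show Fintype.card (Option (Fin (n + 1))) = n + 2
    simp

/-! ### Elementary register programs -/

theorem Run.cast {B : ℕ} {c : Cmd} {s t t' : ℕ → ℕ} (h : Run B c s t) (e : t = t') :
    Run B c s t' := e ▸ h

/-- Set register `x` to zero. -/
def Cmd.clear (x : ℕ) : Cmd := .loop x (.dec x)

theorem Cmd.run_clear (B x : ℕ) (s : ℕ → ℕ) : Run B (.clear x) s (Function.update s x 0) := by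
  generalize h : s x = n
  induction n generalizing s with
  | zero => exact (Run.exit h).cast (by rw [← h, Function.update_eq_self])
  | succ n ih =>
    exact (Run.cont (by omega) Run.dec (ih _ (by simp [h]))).cast (by simp)

/-- Add register `x` to the registers `y` and `z`, and set it to zero. -/
def Cmd.addTo (x y z : ℕ) : Cmd := .loop x (.seq (.dec x) (.seq (.inc y) (.inc z)))

theorem Cmd.run_addTo {B x y z : ℕ} (hy : y ≠ x) (hz : z ≠ x) (hyz : y ≠ z) (s : ℕ → ℕ)
    (h₁ : s y + s x ≤ B) (h₂ : s z + s x ≤ B) : ∃ t, Run B (.addTo x y z) s t ∧ t x = 0 ∧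
      t y = s y + s x ∧ t z = s z + s x ∧ ∀ i, i ≠ x → i ≠ y → i ≠ z → t i = s i := by
  generalize h : s x = n
  induction n generalizing s with
  | zero => exact ⟨s, .exit h, h, rfl, rfl, fun _ _ _ _ => rfl⟩
  | succ n ih =>
    set s₁ := Function.update s x (s x - 1) with hs₁
    set s₂ := Function.update s₁ y (s₁ y + 1) with hs₂
    set s₃ := Function.update s₂ z (s₂ z + 1) with hs₃
    have e₁ : s₁ y = s y := by simp [hs₁, hy]
    have e₂ : s₂ z = s z := by simp [hs₂, hs₁, hyz.symm, hz]
    have ex : s₃ x = n := by simp [hs₃, hs₂, hs₁, hz.symm, hy.symm, h]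
    have ey : s₃ y = s y + 1 := by simp [hs₃, hs₂, hyz, e₁]
    have ez : s₃ z = s z + 1 := by simp [hs₃, e₂]
    obtain ⟨t, ht, h3, h4, h5, h6⟩ := ih s₃ (by omega) (by omega) ex
    refine ⟨t, .cont (by omega) (.seq .dec (.seq (.inc ?_) (.inc ?_))) ht, h3, by omega, by omega,
      fun i hx hy hz => ?_⟩
    · rw [← hs₁]; omega
    · rw [← hs₁, ← hs₂]; omega
    · rw [h6 i hx hy hz]; simp [hs₃, hs₂, hs₁, hx, hy, hz]

/-- Copy register `x` to register `y`, with the auxiliary registers `z`, `w`. -/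
def Cmd.copy (x y z w : ℕ) : Cmd :=
  -- `addTo` destroys its source: `x` is emptied into `y` and `z`, then refilled from `z`. The
  -- register `w` only receives the superfluous second copy.
  .seq (.clear y) (.seq (.clear z) (.seq (.addTo x y z) (.seq (.clear w) (.addTo z x w))))

theorem Cmd.run_copy {B x y z w : ℕ} (hy : y ≠ x) (hz : z ≠ x) (hyz : y ≠ z) (hw : w ≠ x)
    (hwy : w ≠ y) (hwz : w ≠ z) (s : ℕ → ℕ) (h : ∀ i, s i ≤ B) :
    ∃ t, Run B (.copy x y z w) s t ∧ t y = s x ∧ ∀ i, i ≠ y → i ≠ z → i ≠ w → t i = s i := by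
  obtain ⟨t, ht, h1, h2, h3, h4⟩ := Cmd.run_addTo (B := B) hy hz hyz
    (Function.update (Function.update s y 0) z 0)
    (by simp [hy.symm, hz.symm, hyz, h x]) (by simp [hy.symm, hz.symm, h x])
  obtain ⟨u, hu, h5, h6, h7, h8⟩ := Cmd.run_addTo (B := B) hz.symm hwz hw.symm
    (Function.update t w 0)
    (by simp [hw.symm, hwz.symm, h1, h3, hy.symm, hz.symm, h x])
    (by simp [hwz.symm, h3, hy.symm, hz.symm, h x])
  refine ⟨u, .seq (Cmd.run_clear _ _ _) (.seq (Cmd.run_clear _ _ _) (.seq ht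
    (.seq (Cmd.run_clear _ _ _) hu))), ?_, ?_⟩
  · rw [h8 y hyz hy hwy.symm]
    simp [hwy.symm, h2, hyz, hy.symm, hz.symm]
  · intro i hiy hiz hiw
    by_cases hix : i = x
    · subst hix
      simp [h6, hw.symm, h1, hwz.symm, h3, hy.symm, hz.symm]
    · rw [h8 i hiz hix hiw]
      simp [hiw, h4 i hix hiy hiz, hiy, hiz]

/-- Copy a block of registers. -/
theorem Cmd.exists_copyBlock (d T : ℕ) (ρ : ℕ → ℕ) (m : ℕ) (h₁ : ∀ i < m, ρ i < d ∨ d + m ≤ ρ i)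
    (hT : d + m ≤ T) (h₂ : ∀ i < m, ρ i < T) : ∃ P : Cmd, ∀ (s : ℕ → ℕ) (B : ℕ), (∀ i, s i ≤ B) →
      ∃ t, Run B P s t ∧ (∀ i < m, t (d + i) = s (ρ i)) ∧
        ∀ j, (j < d ∨ d + m ≤ j) → j < T → t j = s j := by
  suffices ∀ k ≤ m, ∃ P : Cmd, ∀ (s : ℕ → ℕ) (B : ℕ), (∀ i, s i ≤ B) →
      ∃ t, Run B P s t ∧ (∀ i < k, t (d + i) = s (ρ i)) ∧
        ∀ j, (j < d ∨ d + k ≤ j) → j < T → t j = s j from this m le_rfl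
  intro k
  induction k with
  | zero => exact fun _ => ⟨.skip, fun s B _ => ⟨s, .skip, by simp, fun _ _ _ => rfl⟩⟩
  | succ k ih =>
    intro hk
    obtain ⟨P, hP⟩ := ih (by omega)
    refine ⟨.seq P (.copy (ρ k) (d + k) T (T + 1)), fun s B hs => ?_⟩
    obtain ⟨t, ht, h3, h4⟩ := hP s B hs
    have hρ := h₁ k (by omega)
    have hρT := h₂ k (by omega)
    obtain ⟨u, hu, h5, h6⟩ := Cmd.run_copy (B := B) (x := ρ k) (y := d + k) (z := T) (w := T + 1)
      (by omega) (by omega) (by omega) (by omega) (by omega) (by omega) t (ht.le hs)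
    refine ⟨u, .seq ht hu, fun i hi => ?_, fun j hj hjT => ?_⟩
    · by_cases e : i = k
      · subst e
        rw [h5, h4 _ (by omega) (by omega)]
      · rw [h6 _ (by omega) (by omega) (by omega), h3 i (by omega)]
    · rw [h6 _ (by omega) (by omega) (by omega), h4 j (by omega) hjT]

/-! ### Functions that are computable in bounded space -/

/-- Data that are held in a fixed number of registers. The size is the parameter in which the space
of a computation is measured. -/
class RegData (α : Type) where
  dim : ℕ
  get : α → ℕ → ℕ
  size : α → ℕ

instance : RegData ℕ where
  dim := 1
  get a _ := a
  size a := a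

instance {α β : Type} [RegData α] [RegData β] : RegData (α × β) where
  dim := RegData.dim α + RegData.dim β
  get x i := if i < RegData.dim α then RegData.get x.1 i else RegData.get x.2 (i - RegData.dim α)
  size x := max (RegData.size x.1) (RegData.size x.2)

open RegData

/-- The function `g` is bounded by a polynomial in the size of its argument. -/
def PolyBounded {α : Type} [RegData α] (g : α → ℕ) : Prop :=
  ∃ c, ∀ a, g a ≤ (size a + 2) ^ c

/-- The function `f` is computed by a register program in which all numbers are bounded by a
polynomial in the size of the argument. The program works above any given register `r`. -/
def SpaceComputable {α β : Type} [RegData α] [RegData β] (f : α → β) : Prop :=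
  ∃ c : ℕ, (∀ a, size (f a) ≤ (size a + 2) ^ c) ∧
    ∀ (r : ℕ) (ρ : ℕ → ℕ), (∀ i < dim α, ρ i < r) → ∃ P : Cmd, ∀ (a : α) (s : ℕ → ℕ) (B : ℕ),
      (∀ i < dim α, s (ρ i) = get a i) → (∀ i, s i ≤ B) → (size a + 2) ^ c ≤ B →
        ∃ t, Run B P s t ∧ (∀ i < dim β, t (r + i) = get (f a) i) ∧ ∀ i < r, t i = s i

section

variable {α β γ : Type} [RegData α] [RegData β] [RegData γ]

/-! ### Calculus of polynomial bounds -/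

theorem pow_size_mono (a : α) {c d : ℕ} (h : c ≤ d) : (size a + 2) ^ c ≤ (size a + 2) ^ d :=
  Nat.pow_le_pow_right (by omega) h

/-- Bounds compose: `y + 2` is at most `4 * (x + 2) ^ c`, and `4 ≤ (x + 2) ^ 2` costs two more in
the exponent. -/
theorem add_two_pow_le {x y c d : ℕ} (h : y ≤ (x + 2) ^ c) :
    (y + 2) ^ d ≤ (x + 2) ^ ((c + 2) * d) := by
  rw [pow_mul]
  refine Nat.pow_le_pow_left ?_ d
  have h1 : 1 ≤ (x + 2) ^ c := Nat.one_le_pow _ _ (by omega)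
  calc y + 2 ≤ (x + 2) ^ c * 4 := by omega
    _ ≤ (x + 2) ^ c * (x + 2) ^ 2 := Nat.mul_le_mul_left _ (Nat.pow_le_pow_left (by omega : 2 ≤ x + 2) 2)
    _ = _ := by rw [pow_add]

theorem PolyBounded.mono {f g : α → ℕ} (hg : PolyBounded g) (h : ∀ a, f a ≤ g a) :
    PolyBounded f :=
  let ⟨c, hc⟩ := hg
  ⟨c, fun a => (h a).trans (hc a)⟩

/-- The base `size a + 2` is at least two, so `n ≤ 2 ^ n` absorbs a constant into the exponent. -/
theorem PolyBounded.const (n : ℕ) : PolyBounded fun _ : α => n :=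
  ⟨n, fun a => Nat.lt_two_pow_self.le.trans (Nat.pow_le_pow_left (by omega) n)⟩

theorem PolyBounded.size : PolyBounded fun a : α => RegData.size a :=
  ⟨1, fun a => by simp⟩

theorem PolyBounded.mul {f g : α → ℕ} (hf : PolyBounded f) (hg : PolyBounded g) :
    PolyBounded fun a => f a * g a := by
  obtain ⟨c, hc⟩ := hf
  obtain ⟨d, hd⟩ := hg
  exact ⟨c + d, fun a => by rw [pow_add]; exact Nat.mul_le_mul (hc a) (hd a)⟩

theorem PolyBounded.add {f g : α → ℕ} (hf : PolyBounded f) (hg : PolyBounded g) :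
    PolyBounded fun a => f a + g a := by
  obtain ⟨c, hc⟩ := hf
  obtain ⟨d, hd⟩ := hg
  refine ⟨max c d + 1, fun a => ?_⟩
  have h1 := (hc a).trans (pow_size_mono a (le_max_left c d))
  have h2 := (hd a).trans (pow_size_mono a (le_max_right c d))
  rw [pow_succ]
  nlinarith

theorem PolyBounded.max {f g : α → ℕ} (hf : PolyBounded f) (hg : PolyBounded g) :
    PolyBounded fun a => max (f a) (g a) :=
  (hf.add hg).mono fun a => by omega

/-! ### Closure under composition, pairing and iteration -/

namespace SpaceComputable

theorem of_eq {f g : α → β} (hf : SpaceComputable f) (h : ∀ a, f a = g a) : SpaceComputable g :=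
  (funext h : f = g) ▸ hf

theorem polyBounded_size {f : α → β} (hf : SpaceComputable f) :
    PolyBounded fun a => size (f a) :=
  let ⟨c, hc, _⟩ := hf
  ⟨c, hc⟩

theorem polyBounded {f : α → ℕ} (hf : SpaceComputable f) : PolyBounded f :=
  hf.polyBounded_size

/-- The two conditions of the definition may be proved with different exponents. -/
theorem mk' {f : α → β} (h : PolyBounded fun a => size (f a)) (c : ℕ)
    (hP : ∀ (r : ℕ) (ρ : ℕ → ℕ), (∀ i < dim α, ρ i < r) → ∃ P : Cmd, ∀ (a : α) (s : ℕ → ℕ) (B : ℕ),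
      (∀ i < dim α, s (ρ i) = get a i) → (∀ i, s i ≤ B) → (size a + 2) ^ c ≤ B →
        ∃ t, Run B P s t ∧ (∀ i < dim β, t (r + i) = get (f a) i) ∧ ∀ i < r, t i = s i) :
    SpaceComputable f := by
  obtain ⟨d, hd⟩ := h
  refine ⟨max c d, fun a => (hd a).trans (pow_size_mono a (le_max_right _ _)), fun r ρ hρ => ?_⟩
  obtain ⟨P, hP⟩ := hP r ρ hρ
  exact ⟨P, fun a s B h1 h2 h3 => hP a s B h1 h2 ((pow_size_mono a (le_max_left _ _)).trans h3)⟩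

/-- A function whose outputs are among its inputs. -/
theorem reindex {f : α → β} (h : PolyBounded fun a => size (f a)) (σ : ℕ → ℕ)
    (hσ : ∀ i < dim β, σ i < dim α) (hf : ∀ a, ∀ i < dim β, get (f a) i = get a (σ i)) :
    SpaceComputable f := by
  refine mk' h 0 fun r ρ hρ => ?_
  obtain ⟨P, hP⟩ := Cmd.exists_copyBlock r (r + dim β) (fun i => ρ (σ i)) (dim β)
    (fun i hi => .inl (hρ _ (hσ i hi))) le_rfl
    (fun i hi => (hρ _ (hσ i hi)).trans_le (Nat.le_add_right _ _))
  refine ⟨P, fun a s B h1 h2 _ => ?_⟩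
  obtain ⟨t, ht, h3, h4⟩ := hP s B h2
  exact ⟨t, ht, fun i hi => by rw [h3 i hi, h1 _ (hσ i hi), hf a i hi],
    fun i hi => h4 i (.inl hi) (by omega)⟩

theorem id : SpaceComputable fun a : α => a :=
  reindex .size (fun i => i) (fun _ h => h) fun _ _ _ => rfl

theorem fst : SpaceComputable fun x : α × β => x.1 :=
  reindex (PolyBounded.size.mono fun _ => le_max_left _ _) (fun i => i)
    (fun _ h => h.trans_le (Nat.le_add_right _ _)) fun _ _ h => (if_pos h).symm

theorem snd : SpaceComputable fun x : α × β => x.2 :=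
  reindex (PolyBounded.size.mono fun _ => le_max_right _ _) (fun i => dim α + i)
    (fun _ h => Nat.add_lt_add_left h _) fun x i _ => by
      show _ = if _ then _ else _
      rw [if_neg (by omega), Nat.add_sub_cancel_left]

/-- The block at `r` is kept free for the result. The value of `f` is computed above it, the value
of `g` above that, and the latter is copied down; the blocks are disjoint, so nothing is overwritten
too early. -/
theorem comp {g : β → γ} {f : α → β} (hg : SpaceComputable g) (hf : SpaceComputable f) :
    SpaceComputable fun a => g (f a) := by
  obtain ⟨c, hc, hf⟩ := hf
  obtain ⟨d, hd, hg⟩ := hg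
  refine mk' ⟨(c + 2) * d, fun a => (hd _).trans (add_two_pow_le (hc a))⟩
    (max c ((c + 2) * d)) fun r ρ hρ => ?_
  obtain ⟨P, hP⟩ := hf (r + dim γ) ρ fun i hi => (hρ i hi).trans_le (Nat.le_add_right _ _)
  obtain ⟨Q, hQ⟩ := hg (r + dim γ + dim β) (fun i => r + dim γ + i) fun i hi => by omega
  obtain ⟨R, hR⟩ := Cmd.exists_copyBlock r (r + dim γ + dim β + dim γ)
    (fun i => r + dim γ + dim β + i) (dim γ) (fun i _ => by omega) (by omega)
    (fun i hi => by omega)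
  refine ⟨.seq P (.seq Q R), fun a s B h1 h2 h3 => ?_⟩
  obtain ⟨t, ht, h4, h5⟩ := hP a s B h1 h2 ((pow_size_mono a (le_max_left _ _)).trans h3)
  obtain ⟨u, hu, h6, h7⟩ := hQ (f a) t B h4 (ht.le h2)
    (((add_two_pow_le (hc a)).trans (pow_size_mono a (le_max_right _ _))).trans h3)
  obtain ⟨v, hv, h8, h9⟩ := hR u B (hu.le (ht.le h2))
  refine ⟨v, .seq ht (.seq hu hv), fun i hi => by rw [h8 i hi, h6 i hi], fun i hi => ?_⟩
  rw [h9 i (.inl hi) (by omega), h7 i (by omega), h5 i (by omega)]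

theorem pair {f : α → β} {g : α → γ} (hf : SpaceComputable f) (hg : SpaceComputable g) :
    SpaceComputable fun a => (f a, g a) := by
  have hb := hf.polyBounded_size.max hg.polyBounded_size
  obtain ⟨c, hc, hf⟩ := hf
  obtain ⟨d, hd, hg⟩ := hg
  refine mk' hb (max c d) fun r ρ hρ => ?_
  obtain ⟨P, hP⟩ := hf r ρ hρ
  obtain ⟨Q, hQ⟩ := hg (r + dim β) ρ fun i hi => (hρ i hi).trans_le (Nat.le_add_right _ _)
  refine ⟨.seq P Q, fun a s B h1 h2 h3 => ?_⟩
  obtain ⟨t, ht, h4, h5⟩ := hP a s B h1 h2 ((pow_size_mono a (le_max_left _ _)).trans h3)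
  obtain ⟨u, hu, h6, h7⟩ := hQ a t B (fun i hi => by rw [h5 _ (hρ i hi), h1 i hi]) (ht.le h2)
    ((pow_size_mono a (le_max_right _ _)).trans h3)
  refine ⟨u, .seq ht hu, fun i hi => ?_, fun i hi => by rw [h7 i (by omega), h5 i hi]⟩
  show _ = if _ then _ else _
  have hi' : i < dim β + dim γ := hi
  split_ifs with h
  · rw [h7 _ (by omega), h4 i h]
  · rw [← h6 (i - dim β) (by omega)]
    congr 1
    omega

theorem const (n : ℕ) : SpaceComputable fun _ : α => n := by
  refine mk' (.const n) n fun r ρ _ => ?_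
  suffices ∀ k ≤ n, ∃ P : Cmd, ∀ (s : ℕ → ℕ) (B : ℕ), n ≤ B →
      Run B P s (Function.update s r k) by
    obtain ⟨P, hP⟩ := this n le_rfl
    refine ⟨P, fun a s B _ _ h => ⟨_, hP s B ?_, fun i hi => ?_, fun i hi => ?_⟩⟩
    · exact (Nat.lt_two_pow_self.le.trans (Nat.pow_le_pow_left (by omega) n)).trans h
    · obtain rfl : i = 0 := Nat.lt_one_iff.1 hi
      simp [RegData.get]
    · simp [hi.ne]
  intro k
  induction k with
  | zero => exact fun _ => ⟨.clear r, fun s B _ => Cmd.run_clear B r s⟩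
  | succ k ih =>
    intro hk
    obtain ⟨P, hP⟩ := ih (by omega)
    refine ⟨.seq P (.inc r), fun s B h => .seq (hP s B h) ?_⟩
    have h1 : Run B (.inc r) (Function.update s r k) _ := .inc (by simp; omega)
    exact h1.cast (by simp)

theorem succ' : SpaceComputable fun n : ℕ => n + 1 := by
  refine mk' (PolyBounded.size.add (.const 1)) 1 fun r ρ hρ => ?_
  have h0 : ρ 0 < r := hρ 0 Nat.one_pos
  refine ⟨.seq (.copy (ρ 0) r (r + 1) (r + 2)) (.inc r), fun n s B h1 h2 h3 => ?_⟩
  obtain ⟨t, ht, h4, h5⟩ := Cmd.run_copy (B := B) (x := ρ 0) (y := r) (z := r + 1) (w := r + 2)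
    (by omega) (by omega) (by omega) (by omega) (by omega) (by omega) s h2
  have e : t r = n := h4.trans (h1 0 Nat.one_pos)
  have h3' : n + 2 ≤ B := by simpa [size] using h3
  refine ⟨_, .seq ht (.inc (by omega)), fun i hi => ?_, fun i hi => ?_⟩
  · obtain rfl : i = 0 := Nat.lt_one_iff.1 hi
    simp [RegData.get, e]
  · simp only [Function.update_of_ne hi.ne]
    exact h5 i (by omega) (by omega) (by omega)

theorem pred' : SpaceComputable fun n : ℕ => n - 1 := by
  refine mk' (PolyBounded.size.mono fun n => Nat.sub_le n 1) 1 fun r ρ hρ => ?_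
  have h0 : ρ 0 < r := hρ 0 Nat.one_pos
  refine ⟨.seq (.copy (ρ 0) r (r + 1) (r + 2)) (.dec r), fun n s B h1 h2 h3 => ?_⟩
  obtain ⟨t, ht, h4, h5⟩ := Cmd.run_copy (B := B) (x := ρ 0) (y := r) (z := r + 1) (w := r + 2)
    (by omega) (by omega) (by omega) (by omega) (by omega) (by omega) s h2
  have e : t r = n := h4.trans (h1 0 Nat.one_pos)
  refine ⟨_, .seq ht .dec, fun i hi => ?_, fun i hi => ?_⟩
  · obtain rfl : i = 0 := Nat.lt_one_iff.1 hi
    simp [RegData.get, e]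
  · simp only [Function.update_of_ne hi.ne]
    exact h5 i (by omega) (by omega) (by omega)

/-- Iteration of a step, if all iterates have polynomial size. -/
theorem iterate {init : α → β} {step : α → β → β} {n : α → ℕ} (hi : SpaceComputable init)
    (hs : SpaceComputable fun x : α × β => step x.1 x.2) (hn : SpaceComputable n)
    {b : α → ℕ} (hb : PolyBounded b) (h : ∀ a, ∀ k ≤ n a, size ((step a)^[k] (init a)) ≤ b a) :
    SpaceComputable fun a => (step a)^[n a] (init a) := by
  obtain ⟨c₀, hc₀⟩ := hb
  obtain ⟨c₁, -, hi⟩ := hi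
  obtain ⟨c₂, -, hs⟩ := hs
  obtain ⟨c₃, -, hn⟩ := hn
  -- The step runs on pairs `(a, x)` of size at most `(size a + 2) ^ (c₀ + 1)`, which
  -- `add_two_pow_le` converts into the exponent `(c₀ + 1 + 2) * c₂`. The current iterate lives at
  -- `r`, the counter directly above it, and the next iterate above the counter.
  refine mk' ⟨c₀, fun a => (h a _ le_rfl).trans (hc₀ a)⟩ (max (max c₁ c₃) ((c₀ + 1 + 2) * c₂))
    fun r ρ hρ => ?_
  obtain ⟨P₁, hP₁⟩ := hi r ρ hρ
  obtain ⟨P₃, hP₃⟩ := hn (r + dim β) ρ fun i hi => (hρ i hi).trans_le (Nat.le_add_right _ _)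
  obtain ⟨P₂, hP₂⟩ := hs (r + dim β + 1)
    (fun i => if i < dim α then ρ i else r + (i - dim α)) fun i hi => by
      have hi' : i < dim α + dim β := hi
      split_ifs with h
      · have := hρ i h; omega
      · omega
  obtain ⟨P₄, hP₄⟩ := Cmd.exists_copyBlock r (r + dim β + 1 + dim β)
    (fun i => r + dim β + 1 + i) (dim β) (fun i _ => by omega) (by omega) (fun i hi => by omega)
  refine ⟨.seq P₁ (.seq P₃ (.loop (r + dim β) (.seq (.dec (r + dim β)) (.seq P₂ P₄)))),
    fun a s B h1 h2 h3 => ?_⟩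
  -- Induction on the counter, for an arbitrary current iterate `x`: one round preserves the inputs,
  -- which lie below `r`, and replaces `x` by `step a x`.
  have hloop : ∀ (k : ℕ) (x : β) (u : ℕ → ℕ), (∀ j ≤ k, size ((step a)^[j] x) ≤ b a) →
      (∀ i < dim α, u (ρ i) = get a i) → (∀ i, u i ≤ B) → (∀ i < dim β, u (r + i) = get x i) →
      u (r + dim β) = k → ∃ t, Run B (.loop (r + dim β) (.seq (.dec (r + dim β)) (.seq P₂ P₄))) u t ∧
        (∀ i < dim β, t (r + i) = get ((step a)^[k] x) i) ∧ ∀ i < r, t i = u i := by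
    intro k
    induction k with
    | zero => exact fun x u _ _ _ h4 h5 => ⟨u, .exit h5, h4, fun _ _ => rfl⟩
    | succ k ih =>
      intro x u h4 h5 h6 h7 h8
      set u₁ := Function.update u (r + dim β) (u (r + dim β) - 1) with hu₁
      have hu₁e : ∀ i, i ≠ r + dim β → u₁ i = u i := fun i hi => by simp [hu₁, hi]
      have hr₁ : Run B (.dec (r + dim β)) u u₁ := .dec
      obtain ⟨v, hv, h9, h10⟩ := hP₂ (a, x) u₁ B (fun i hi => by
        have hi' : i < dim α + dim β := hi
        show _ = if i < dim α then _ else _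
        dsimp only
        split_ifs with hia
        · have := hρ i hia
          rw [hu₁e _ (by omega), h5 i hia]
        · rw [hu₁e _ (by omega), h7 _ (by omega)]) (hr₁.le h6) (by
        have hx : size x ≤ (size a + 2) ^ c₀ := (h4 0 (by omega)).trans (hc₀ a)
        have hax : size (a, x) ≤ (size a + 2) ^ (c₀ + 1) := by
          refine max_le ?_ (hx.trans (pow_size_mono a (by omega)))
          calc size a ≤ (size a + 2) ^ 1 := by simp
            _ ≤ _ := pow_size_mono a (by omega)
        exact ((add_two_pow_le hax).trans (pow_size_mono a (le_max_right _ _))).trans h3)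
      obtain ⟨w, hw, h11, h12⟩ := hP₄ v B (hv.le (hr₁.le h6))
      have hlow : ∀ i < r, w i = u i := fun i hi => by
        rw [h12 i (.inl hi) (by omega), h10 i (by omega), hu₁e i (by omega)]
      obtain ⟨t, ht, h13, h14⟩ := ih (step a x) w
        (fun j hj => by simpa using h4 (j + 1) (by omega))
        (fun i hi => by rw [hlow _ (hρ i hi), h5 i hi]) (hw.le (hv.le (hr₁.le h6)))
        (fun i hi => by rw [h11 i hi, h9 i hi])
        (by rw [h12 _ (.inr le_rfl) (by omega), h10 _ (by omega)]; simp [hu₁, h8])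
      exact ⟨t, .cont (by omega) (.seq hr₁ (.seq hv hw)) ht, by simpa using h13,
        fun i hi => by rw [h14 i hi, hlow i hi]⟩
  obtain ⟨t, ht, h4, h5⟩ := hP₁ a s B h1 h2
    ((pow_size_mono a ((le_max_left _ _).trans (le_max_left _ _))).trans h3)
  obtain ⟨u, hu, h6, h7⟩ := hP₃ a t B (fun i hi => by rw [h5 _ (hρ i hi), h1 i hi]) (ht.le h2)
    ((pow_size_mono a ((le_max_right _ _).trans (le_max_left _ _))).trans h3)
  obtain ⟨v, hv, h8, h9⟩ := hloop (n a) (init a) u (h a)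
    (fun i hi => by
      have := hρ i hi
      rw [h7 _ (by omega), h5 _ this, h1 i hi]) (hu.le (ht.le h2))
    (fun i hi => by rw [h7 _ (by omega), h4 i hi]) (h6 0 Nat.one_pos)
  exact ⟨v, .seq ht (.seq hu hv), h8, fun i hi => by rw [h9 i hi, h7 i (by omega), h5 i hi]⟩

end SpaceComputable

end

/-! ### Arithmetic -/

/-- The truth value of a proposition as a number. -/
noncomputable def truthValue (p : Prop) : ℕ :=
  open Classical in if p then 1 else 0

theorem truthValue_pos {p : Prop} (h : p) : truthValue p = 1 := by simp [truthValue, h]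

theorem truthValue_neg {p : Prop} (h : ¬p) : truthValue p = 0 := by simp [truthValue, h]

theorem truthValue_ne_zero {p : Prop} : truthValue p ≠ 0 ↔ p := by
  by_cases h : p <;> simp [truthValue, h]

/-- The predicate `p` is decided by a register program in bounded space. -/
def SpaceDecidable {α : Type} [RegData α] (p : α → Prop) : Prop :=
  SpaceComputable fun a => truthValue (p a)

section

variable {α β γ δ ε : Type} [RegData α] [RegData β] [RegData γ] [RegData δ] [RegData ε]

namespace SpaceComputable

variable {f g h : α → ℕ}

theorem fst' {f : α → β × γ} (hf : SpaceComputable f) : SpaceComputable fun a => (f a).1 :=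
  fst.comp hf

theorem snd' {f : α → β × γ} (hf : SpaceComputable f) : SpaceComputable fun a => (f a).2 :=
  snd.comp hf

theorem succ (hf : SpaceComputable f) : SpaceComputable fun a => f a + 1 := succ'.comp hf

theorem pred (hf : SpaceComputable f) : SpaceComputable fun a => f a - 1 := pred'.comp hf

theorem add (hf : SpaceComputable f) (hg : SpaceComputable g) :
    SpaceComputable fun a => f a + g a := by
  have key : ∀ m k : ℕ, (fun y => y + 1)^[k] m = m + k := fun m k => by
    induction k with
    | zero => rfl
    | succ k ih => rw [Function.iterate_succ_apply', ih, add_assoc]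
  refine (iterate (step := fun _ y => y + 1) hf snd.succ hg
    (hf.polyBounded.add hg.polyBounded) fun a k hk => ?_).of_eq fun a => key _ _
  rw [key]
  exact Nat.add_le_add_left hk _

theorem sub (hf : SpaceComputable f) (hg : SpaceComputable g) :
    SpaceComputable fun a => f a - g a := by
  have key : ∀ m k : ℕ, (fun y => y - 1)^[k] m = m - k := fun m k => by
    induction k with
    | zero => rfl
    | succ k ih => rw [Function.iterate_succ_apply', ih, Nat.sub_sub]
  refine (iterate (step := fun _ y => y - 1) hf snd.pred hg
    hf.polyBounded fun a k hk => ?_).of_eq fun a => key _ _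
  rw [key]
  exact Nat.sub_le _ _

theorem mul (hf : SpaceComputable f) (hg : SpaceComputable g) :
    SpaceComputable fun a => f a * g a := by
  have key : ∀ m k : ℕ, (fun y => y + m)^[k] 0 = m * k := fun m k => by
    induction k with
    | zero => rfl
    | succ k ih => rw [Function.iterate_succ_apply', ih, Nat.mul_succ]
  refine (iterate (step := fun a y => y + f a) (const 0) (snd.add (hf.comp fst)) hg
    (hf.polyBounded.mul hg.polyBounded) fun a k hk => ?_).of_eq fun a => key _ _
  rw [key]
  exact Nat.mul_le_mul_left _ hk

theorem pow (hf : SpaceComputable f) (hg : SpaceComputable g)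
    (hb : PolyBounded fun a => f a ^ g a) : SpaceComputable fun a => f a ^ g a := by
  have key : ∀ m k : ℕ, (fun y => y * m)^[k] 1 = m ^ k := fun m k => by
    induction k with
    | zero => rfl
    | succ k ih => rw [Function.iterate_succ_apply', ih, pow_succ]
  refine (iterate (step := fun a y => y * f a) (const 1) (snd.mul (hf.comp fst)) hg
    (hb.add (.const 1)) fun a k hk => ?_).of_eq fun a => key _ _
  rw [key]
  -- For base zero the iteration starts at `1`, which may exceed the final value `0`; the added
  -- constant in the bound covers this.
  rcases Nat.eq_zero_or_pos (f a) with h | h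
  · rw [h]
    exact (pow_le_one₀ le_rfl zero_le_one).trans (Nat.le_add_left _ _)
  · exact (Nat.pow_le_pow_right h hk).trans (Nat.le_add_right _ _)

end SpaceComputable

/-! ### Comparisons and Boolean connectives -/

namespace SpaceDecidable

open SpaceComputable

variable {f g : α → ℕ} {p q : α → Prop}

theorem of_iff (hp : SpaceDecidable p) (h : ∀ a, p a ↔ q a) : SpaceDecidable q :=
  (funext fun a => propext (h a) : p = q) ▸ hp

theorem comp {p : β → Prop} (hp : SpaceDecidable p) {f : α → β} (hf : SpaceComputable f) :
    SpaceDecidable fun a => p (f a) :=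
  SpaceComputable.comp (g := fun b => truthValue (p b)) hp hf

theorem comp₂ {p : β → γ → Prop} (hp : SpaceDecidable fun x : β × γ => p x.1 x.2) {f : α → β}
    {g : α → γ} (hf : SpaceComputable f) (hg : SpaceComputable g) :
    SpaceDecidable fun a => p (f a) (g a) :=
  hp.comp (hf.pair hg)

theorem lt (hf : SpaceComputable f) (hg : SpaceComputable g) :
    SpaceDecidable fun a => f a < g a :=
  -- With truncated subtraction, `1 - (f a + 1 - g a)` is one exactly when `f a + 1 ≤ g a`.
  ((SpaceComputable.const 1).sub (hf.succ.sub hg)).of_eq fun a => by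
    by_cases h : f a < g a
    · rw [truthValue_pos h]; omega
    · rw [truthValue_neg h]; omega

theorem not (hp : SpaceDecidable p) : SpaceDecidable fun a => ¬p a :=
  ((SpaceComputable.const 1).sub hp).of_eq fun a => by
    by_cases h : p a <;> simp [truthValue, h]

theorem and (hp : SpaceDecidable p) (hq : SpaceDecidable q) : SpaceDecidable fun a => p a ∧ q a :=
  (mul hp hq).of_eq fun a => by
    by_cases h : p a <;> by_cases h' : q a <;> simp [truthValue, h, h']

theorem or (hp : SpaceDecidable p) (hq : SpaceDecidable q) : SpaceDecidable fun a => p a ∨ q a :=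
  (hp.not.and hq.not).not.of_iff fun a => by tauto

theorem imp (hp : SpaceDecidable p) (hq : SpaceDecidable q) : SpaceDecidable fun a => p a → q a :=
  (hp.not.or hq).of_iff fun a => by tauto

theorem iff (hp : SpaceDecidable p) (hq : SpaceDecidable q) :
    SpaceDecidable fun a => (p a ↔ q a) :=
  ((hp.imp hq).and (hq.imp hp)).of_iff fun a => by tauto

theorem const (p : Prop) : SpaceDecidable fun _ : α => p :=
  SpaceComputable.const _

theorem le (hf : SpaceComputable f) (hg : SpaceComputable g) :
    SpaceDecidable fun a => f a ≤ g a :=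
  (lt hg hf).not.of_iff fun a => by omega

theorem eq (hf : SpaceComputable f) (hg : SpaceComputable g) :
    SpaceDecidable fun a => f a = g a :=
  ((le hf hg).and (le hg hf)).of_iff fun a => by omega

end SpaceDecidable

namespace SpaceComputable

variable {f g h : α → ℕ} {p : α → Prop}

/-- A conditional is a loop of at most one round: start with the value of `g` and replace it by that
of `f` as often as the truth value of `p` says. -/
theorem ite (hp : SpaceDecidable p) [∀ a, Decidable (p a)] {f g : α → β}
    (hf : SpaceComputable f) (hg : SpaceComputable g) :
    SpaceComputable fun a => if p a then f a else g a := by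
  have h1 := iterate (step := fun a _ => f a) hg (hf.comp fst) hp
    (hf.polyBounded_size.max hg.polyBounded_size) fun a k _ => by
      rcases k with - | k
      · exact le_max_right _ _
      · rw [Function.iterate_succ_apply']
        exact le_max_left _ _
  refine h1.of_eq fun a => ?_
  by_cases h : p a <;> simp [truthValue, h]

open Classical in
/-- The number of the `i < f a` with `p a i`. -/
theorem count {p : α → ℕ → Prop} (hp : SpaceDecidable fun x : α × ℕ => p x.1 x.2)
    (hf : SpaceComputable f) : SpaceComputable fun a => Nat.count (p a) (f a) := by
  have key : ∀ a k, (fun x : ℕ × ℕ => (x.1 + 1, x.2 + truthValue (p a x.1)))^[k] (0, 0) =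
      (k, Nat.count (p a) k) := fun a k => by
    induction k with
    | zero => simp
    | succ k ih => rw [Function.iterate_succ_apply', ih, Nat.count_succ]; rfl
  refine (snd' (iterate (step := fun a (x : ℕ × ℕ) => (x.1 + 1, x.2 + truthValue (p a x.1)))
    ((const 0).pair (const 0)) ?_ hf hf.polyBounded fun a k hk => ?_)).of_eq fun a => ?_
  · exact snd.fst'.succ.pair (snd.snd'.add (SpaceDecidable.comp₂ hp fst snd.fst'))
  · rw [key]
    exact max_le hk ((Nat.count_le _).trans hk)
  · rw [key]

end SpaceComputable

namespace SpaceDecidable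

open SpaceComputable

variable {f g : α → ℕ} {p : α → ℕ → Prop}

open Classical in
theorem exists_lt (hp : SpaceDecidable fun x : α × ℕ => p x.1 x.2)
    (hf : SpaceComputable f) : SpaceDecidable fun a => ∃ i < f a, p a i := by
  refine (lt (SpaceComputable.const 0) (count hp hf)).of_iff fun a => ?_
  rw [Nat.pos_iff_ne_zero, ne_eq, Nat.count_iff_forall_not]
  push Not
  rfl

theorem forall_lt (hp : SpaceDecidable fun x : α × ℕ => p x.1 x.2)
    (hf : SpaceComputable f) : SpaceDecidable fun a => ∀ i < f a, p a i :=
  (exists_lt (p := fun a i => ¬p a i) hp.not hf).not.of_iff fun a => by push Not; rfl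

end SpaceDecidable

namespace SpaceComputable

variable {f g h : α → ℕ} {p : α → Prop}

/-- The quotient counts the `i` with `(i + 1) * g a ≤ f a`, and all of these lie below `f a`.
Division by zero needs its own case, since every `i` would count. -/
theorem div (hf : SpaceComputable f) (hg : SpaceComputable g) :
    SpaceComputable fun a => f a / g a := by
  classical
  refine (ite (SpaceDecidable.eq hg (const 0)) (const 0)
    (count (p := fun a i => (i + 1) * g a ≤ f a)
      (SpaceDecidable.le (snd.succ.mul (hg.comp fst)) (hf.comp fst)) hf)).of_eq fun a => ?_
  split_ifs with h0
  · rw [h0, Nat.div_zero]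
  · have h0 := Nat.pos_of_ne_zero h0
    rw [Nat.count_eq_card_filter_range]
    convert Finset.card_range (f a / g a) using 2
    ext i
    simp only [Finset.mem_filter, Finset.mem_range, ← Nat.le_div_iff_mul_le h0, Nat.succ_le_iff,
      and_iff_right_iff_imp]
    exact fun h => h.trans_le (Nat.div_le_self _ _)

theorem mod (hf : SpaceComputable f) (hg : SpaceComputable g) :
    SpaceComputable fun a => f a % g a :=
  (hf.sub (hg.mul (hf.div hg))).of_eq fun a => by
    have := Nat.div_add_mod (f a) (g a)
    omega

end SpaceComputable

theorem SpaceDecidable.testBit {f g : α → ℕ} (hf : SpaceComputable f) (hg : SpaceComputable g) :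
    SpaceDecidable fun a => (f a).testBit (g a) = true := by
  have key : ∀ m k : ℕ, (fun y => y / 2)^[k] m = m / 2 ^ k := fun m k => by
    induction k with
    | zero => simp
    | succ k ih => rw [Function.iterate_succ_apply', ih, pow_succ, Nat.div_div_eq_div_mul]
  have h1 : SpaceComputable fun a => (fun y => y / 2)^[g a] (f a) :=
    .iterate (step := fun _ y => y / 2) hf (.div .snd (.const 2)) hg hf.polyBounded fun a k _ => by
      rw [key]; exact Nat.div_le_self _ _
  refine (SpaceDecidable.eq (h1.mod (.const 2)) (.const 1)).of_iff fun a => ?_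
  rw [key, Nat.testBit_eq_decide_div_mod_eq, decide_eq_true_iff]

end

/-! ### Reachability by repeated halving -/

/-- `v` is reached from `u` in at most `2 ^ k` steps through nodes less than `N`. -/
def HalvingReach (N : ℕ) (edge : ℕ → ℕ → Prop) : ℕ → ℕ → ℕ → Prop
  | 0, u, v => u = v ∨ edge u v
  | k + 1, u, v => ∃ w < N, HalvingReach N edge k u w ∧ HalvingReach N edge k w v

/-- The states of the evaluation of `HalvingReach`: the mode (`0` for a call, `1` and `2` for the
answers no and yes), the depth, the two nodes, and a stack of pending calls. -/
abbrev HalvingState : Type := ℕ × ℕ × ℕ × ℕ × ℕ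

/-- The stack with a new frame on top, in base `N + 2`. -/
def pushFrame (N u v w b s : ℕ) : ℕ :=
  (((s * (N + 2) + u) * (N + 2) + v) * (N + 2) + w) * (N + 2) + b

/-- One step of the evaluation of `HalvingReach`. -/
noncomputable def halvingStep (N D : ℕ) (edge : ℕ → ℕ → Prop) (x : HalvingState) : HalvingState :=
  let m := x.1
  let k := x.2.1
  let u := x.2.2.1
  let v := x.2.2.2.1
  let s := x.2.2.2.2
  -- The top frame of the stack: `w` is the midpoint on trial for the call `(u', v')`, and `b = 1`
  -- records that the half from `u'` to `w` has succeeded and the half from `w` to `v'` is pending.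
  let b := s % (N + 2)
  let w := s / (N + 2) % (N + 2)
  let v' := s / (N + 2) / (N + 2) % (N + 2)
  let u' := s / (N + 2) / (N + 2) / (N + 2) % (N + 2)
  let s' := s / (N + 2) / (N + 2) / (N + 2) / (N + 2)
  if m = 0 then
    if k = 0 then (1 + truthValue (u = v ∨ edge u v), 0, 0, 0, s)
    else (0, k - 1, u, 0, pushFrame N u v 0 0 s)
  -- An answer at depth `D` belongs to the outermost call; it is a fixed point, so surplus steps are
  -- harmless.
  else if D ≤ k then x
  else if m = 1 then
    if w + 1 < N then (0, k, u', w + 1, pushFrame N u' v' (w + 1) 0 s')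
    else (1, k + 1, 0, 0, s')
  else if b = 0 then (0, k, w, v', pushFrame N u' v' w 1 s')
  else (2, k + 1, 0, 0, s')

/-! ### Correctness, running time and range of the halving evaluation -/

section

variable {N D : ℕ} {edge : ℕ → ℕ → Prop}

theorem mul_add_div_of_lt {x d n : ℕ} (h : d < n) : (x * n + d) / n = x := by
  rw [mul_comm, Nat.mul_add_div (by omega), Nat.div_eq_of_lt h, add_zero]

theorem halvingStep_base (u v s : ℕ) : halvingStep N D edge (0, 0, u, v, s) =
    (1 + truthValue (HalvingReach N edge 0 u v), 0, 0, 0, s) := rfl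

theorem halvingStep_call (k u v s : ℕ) : halvingStep N D edge (0, k + 1, u, v, s) =
    (0, k, u, 0, pushFrame N u v 0 0 s) := by
  simp [halvingStep]

theorem halvingStep_done (m u v s : ℕ) : halvingStep N D edge (m + 1, D, u, v, s) =
    (m + 1, D, u, v, s) := by
  simp [halvingStep]

theorem halvingStep_no {k u v w b a a' s : ℕ} (hk : k < D) (hu : u < N) (hv : v < N) (hw : w < N)
    (hb : b < 2) : halvingStep N D edge (1, k, a, a', pushFrame N u v w b s) =
      if w + 1 < N then (0, k, u, w + 1, pushFrame N u v (w + 1) 0 s) else (1, k + 1, 0, 0, s) := by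
  have e1 : u < N + 2 := by omega
  have e2 : v < N + 2 := by omega
  have e3 : w < N + 2 := by omega
  have e4 : b < N + 2 := by omega
  simp [halvingStep, pushFrame, mul_add_div_of_lt, Nat.mod_eq_of_lt, e1, e2, e3, e4,
    not_le.2 hk]

theorem halvingStep_yes {k u v w b a a' s : ℕ} (hk : k < D) (hu : u < N) (hv : v < N) (hw : w < N)
    (hb : b < 2) : halvingStep N D edge (2, k, a, a', pushFrame N u v w b s) =
      if b = 0 then (0, k, w, v, pushFrame N u v w 1 s) else (2, k + 1, 0, 0, s) := by
  have e1 : u < N + 2 := by omega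
  have e2 : v < N + 2 := by omega
  have e3 : w < N + 2 := by omega
  have e4 : b < N + 2 := by omega
  simp [halvingStep, pushFrame, mul_add_div_of_lt, Nat.mod_eq_of_lt, e1, e2, e3, e4,
    not_le.2 hk]

/-- The iterates of `f` lead from `x` to `y` in at most `n` steps. -/
def IteratesWithin {X : Type} (f : X → X) (n : ℕ) (x y : X) : Prop :=
  ∃ t ≤ n, f^[t] x = y

theorem IteratesWithin.trans {X : Type} {f : X → X} {m n : ℕ} {x y z : X}
    (h : IteratesWithin f m x y) (h' : IteratesWithin f n y z) : IteratesWithin f (m + n) x z := by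
  obtain ⟨t, ht, rfl⟩ := h
  obtain ⟨t', ht', rfl⟩ := h'
  exact ⟨t' + t, by omega, Function.iterate_add_apply _ _ _ _⟩

theorem IteratesWithin.mono {X : Type} {f : X → X} {m n : ℕ} {x y : X}
    (h : IteratesWithin f m x y) (hmn : m ≤ n) : IteratesWithin f n x y :=
  let ⟨t, ht, e⟩ := h
  ⟨t, ht.trans hmn, e⟩

theorem IteratesWithin.single {X : Type} {f : X → X} {x y : X} (h : f x = y) :
    IteratesWithin f 1 x y :=
  ⟨1, le_rfl, h⟩

/-- If a call of depth `k` takes at most `T` steps, then one of depth `k + 1` opens with one step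
and tries at most `N` midpoints, each with at most two calls and two reactions to their answers: `1
+ N * (2 * T + 2) ≤ 5 * N * T`. The stack `s` below the call comes back unchanged. A time bound is
needed because the evaluation is later run for a computed number of steps. -/
theorem iteratesWithin_halvingStep : ∀ k ≤ D, ∀ u v s, u < N → v < N →
    IteratesWithin (halvingStep N D edge) ((5 * N) ^ k) (0, k, u, v, s)
      (1 + truthValue (HalvingReach N edge k u v), k, 0, 0, s) := by
  intro k
  induction k with
  | zero =>
    intro _ u v s _ _
    rw [pow_zero]
    exact .single (halvingStep_base u v s)
  | succ k ih =>
    intro hk u v s hu hv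
    have hT : 1 ≤ (5 * N) ^ k := Nat.one_le_pow _ _ (by omega)
    rw [pow_succ]
    generalize (5 * N) ^ k = T at ih hT ⊢
    -- Here `j` is the number of midpoints that remain after `w`; the answer speaks only of
    -- midpoints from `w` on.
    have loop : ∀ j w, w + j + 1 = N →
        IteratesWithin (halvingStep N D edge) ((j + 1) * (2 * T + 2))
          (0, k, u, w, pushFrame N u v w 0 s)
          (1 + truthValue (∃ w' < N, w ≤ w' ∧ HalvingReach N edge k u w' ∧
            HalvingReach N edge k w' v), k + 1, 0, 0, s) := by
      intro j
      induction j with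
      | zero =>
        intro w hw
        have hwN : w < N := by omega
        have hiff : (∃ w' < N, w ≤ w' ∧ HalvingReach N edge k u w' ∧
            HalvingReach N edge k w' v) ↔
            HalvingReach N edge k u w ∧ HalvingReach N edge k w v := by
          constructor
          · rintro ⟨w', h1, h2, h3⟩
            obtain rfl : w' = w := by omega
            exact h3
          · exact fun h => ⟨w, hwN, le_rfl, h⟩
        rw [hiff]
        have h1 := ih (by omega) u w (pushFrame N u v w 0 s) hu hwN
        by_cases hG : HalvingReach N edge k u w
        · rw [truthValue_pos hG] at h1
          have h2 := h1.trans (.single (halvingStep_yes (by omega) hu hv hwN (by omega)))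
          rw [if_pos rfl] at h2
          have h3 := h2.trans (ih (by omega) w v (pushFrame N u v w 1 s) hwN hv)
          by_cases hG' : HalvingReach N edge k w v
          · rw [truthValue_pos hG'] at h3
            have h4 := h3.trans (.single (halvingStep_yes (by omega) hu hv hwN (by omega)))
            rw [if_neg one_ne_zero] at h4
            rw [truthValue_pos ⟨hG, hG'⟩]
            exact h4.mono (by omega)
          · rw [truthValue_neg hG'] at h3
            have h4 := h3.trans (.single (halvingStep_no (by omega) hu hv hwN (by omega)))
            rw [if_neg (by omega)] at h4
            rw [truthValue_neg (fun h => hG' h.2)]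
            exact h4.mono (by omega)
        · rw [truthValue_neg hG] at h1
          have h2 := h1.trans (.single (halvingStep_no (by omega) hu hv hwN (by omega)))
          rw [if_neg (by omega)] at h2
          rw [truthValue_neg (fun h => hG h.1)]
          exact h2.mono (by omega)
      | succ j ihj =>
        intro w hw
        have hwN : w < N := by omega
        have hiff : (∃ w' < N, w ≤ w' ∧ HalvingReach N edge k u w' ∧
            HalvingReach N edge k w' v) ↔
            (HalvingReach N edge k u w ∧ HalvingReach N edge k w v) ∨
            (∃ w' < N, w + 1 ≤ w' ∧ HalvingReach N edge k u w' ∧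
              HalvingReach N edge k w' v) := by
          constructor
          · rintro ⟨w', h1, h2, h3⟩
            by_cases e : w' = w
            · subst e; exact .inl h3
            · exact .inr ⟨w', h1, by omega, h3⟩
          · rintro (h | ⟨w', h1, h2, h3⟩)
            · exact ⟨w, hwN, le_rfl, h⟩
            · exact ⟨w', h1, by omega, h3⟩
        rw [hiff]
        have hnext := ihj (w + 1) (by omega)
        have hN : (j + 1 + 1) * (2 * T + 2) = (2 * T + 2) + (j + 1) * (2 * T + 2) := by ring
        have h1 := ih (by omega) u w (pushFrame N u v w 0 s) hu hwN
        by_cases hG : HalvingReach N edge k u w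
        · rw [truthValue_pos hG] at h1
          have h2 := h1.trans (.single (halvingStep_yes (by omega) hu hv hwN (by omega)))
          rw [if_pos rfl] at h2
          have h3 := h2.trans (ih (by omega) w v (pushFrame N u v w 1 s) hwN hv)
          by_cases hG' : HalvingReach N edge k w v
          · rw [truthValue_pos hG'] at h3
            have h4 := h3.trans (.single (halvingStep_yes (by omega) hu hv hwN (by omega)))
            rw [if_neg one_ne_zero] at h4
            rw [truthValue_pos (.inl ⟨hG, hG'⟩)]
            exact h4.mono (by rw [hN]; omega)
          · rw [truthValue_neg hG'] at h3
            have h4 := h3.trans (.single (halvingStep_no (by omega) hu hv hwN (by omega)))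
            rw [if_pos (by omega)] at h4
            rw [or_iff_right (fun h => hG' h.2)]
            exact (h4.trans hnext).mono (by rw [hN]; omega)
        · rw [truthValue_neg hG] at h1
          have h2 := h1.trans (.single (halvingStep_no (by omega) hu hv hwN (by omega)))
          rw [if_pos (by omega)] at h2
          rw [or_iff_right (fun h => hG h.1)]
          exact (h2.trans hnext).mono (by rw [hN]; omega)
    have h1 := (IteratesWithin.single (halvingStep_call (edge := edge) (N := N) (D := D) k u v s)).trans
      (loop (N - 1) 0 (by omega))
    have hiff : (∃ w' < N, 0 ≤ w' ∧ HalvingReach N edge k u w' ∧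
        HalvingReach N edge k w' v) ↔ HalvingReach N edge (k + 1) u v := by
      simp [HalvingReach]
    rw [hiff, Nat.sub_add_cancel (by omega)] at h1
    refine h1.mono ?_
    have hN : 1 ≤ N := by omega
    nlinarith [Nat.mul_le_mul hN hT, Nat.mul_le_mul_left N hT]

/-- The range of the states of the evaluation of `HalvingReach`. -/
def HalvingState.InRange (N D : ℕ) (x : HalvingState) : Prop :=
  x.1 ≤ 2 ∧ x.2.1 ≤ D ∧ x.2.2.1 < N + 2 ∧ x.2.2.2.1 < N + 2 ∧
    -- At depth `k` there are at most `D - k` pending frames, each of four digits in base `N + 2`.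
    x.2.2.2.2 < (N + 2) ^ (4 * (D - x.2.1))

theorem mul_add_lt_of_lt {s d n m : ℕ} (hs : s < m) (hd : d < n) : s * n + d < m * n := by
  calc s * n + d < s * n + n := by omega
    _ = (s + 1) * n := by ring
    _ ≤ m * n := Nat.mul_le_mul_right _ hs

theorem pushFrame_lt {u v w b s e : ℕ} (hu : u < N + 2) (hv : v < N + 2) (hw : w < N + 2)
    (hb : b < N + 2) (hs : s < (N + 2) ^ (4 * e)) :
    pushFrame N u v w b s < (N + 2) ^ (4 * (e + 1)) := by
  have : (N + 2) ^ (4 * (e + 1)) =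
      (N + 2) ^ (4 * e) * (N + 2) * (N + 2) * (N + 2) * (N + 2) := by ring
  rw [this]
  exact mul_add_lt_of_lt (mul_add_lt_of_lt (mul_add_lt_of_lt (mul_add_lt_of_lt hs hu) hv) hw) hb

theorem HalvingState.InRange.step {x : HalvingState} (h : x.InRange N D) :
    (halvingStep N D edge x).InRange N D := by
  obtain ⟨m, k, u, v, s⟩ := x
  obtain ⟨h1, h2, h3, h4, h5⟩ := h
  dsimp only at h1 h2 h3 h4 h5
  have hpos : 0 < N + 2 := by omega
  have hpop : k < D → s / (N + 2) / (N + 2) / (N + 2) / (N + 2) <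
      (N + 2) ^ (4 * (D - (k + 1))) := fun hk => by
    obtain ⟨e, he⟩ : ∃ e, D - k = e + 1 := ⟨D - k - 1, by omega⟩
    have he' : D - (k + 1) = e := by omega
    rw [he] at h5
    rw [he']
    have : (N + 2) ^ (4 * (e + 1)) =
      (N + 2) ^ (4 * e) * (N + 2) * (N + 2) * (N + 2) * (N + 2) := by ring
    rw [this] at h5
    exact Nat.div_lt_of_lt_mul (Nat.div_lt_of_lt_mul (Nat.div_lt_of_lt_mul
      (Nat.div_lt_of_lt_mul (by linarith))))
  have hpush : k < D → ∀ u v w b, u < N + 2 → v < N + 2 → w < N + 2 → b < N + 2 →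
      pushFrame N u v w b (s / (N + 2) / (N + 2) / (N + 2) / (N + 2)) <
        (N + 2) ^ (4 * (D - k)) := fun hk u v w b i1 i2 i3 i4 => by
    have := pushFrame_lt i1 i2 i3 i4 (hpop hk)
    rwa [show D - (k + 1) + 1 = D - k by omega] at this
  have hmod : ∀ y, y % (N + 2) < N + 2 := fun y => Nat.mod_lt _ hpos
  simp only [halvingStep]
  split_ifs with c1 c2 c3 c4 c5 c6
  · refine ⟨?_, Nat.zero_le _, hpos, hpos, ?_⟩
    · dsimp only
      have : truthValue (u = v ∨ edge u v) ≤ 1 := by unfold truthValue; split_ifs <;> simp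
      omega
    · rwa [c2] at h5
  · refine ⟨by omega, by dsimp only; omega, h3, hpos, ?_⟩
    have := pushFrame_lt h3 h4 hpos hpos h5
    dsimp only
    rwa [show D - k + 1 = D - (k - 1) by omega] at this
  · exact ⟨h1, h2, h3, h4, h5⟩
  · exact ⟨by omega, h2, hmod _, by dsimp only; omega,
      hpush (by omega) _ _ _ _ (hmod _) (hmod _) (by omega) hpos⟩
  · exact ⟨by omega, by dsimp only; omega, hpos, hpos, hpop (by omega)⟩
  · exact ⟨by omega, h2, hmod _, hmod _,
      hpush (by omega) _ _ _ _ (hmod _) (hmod _) (hmod _) (by omega)⟩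
  · exact ⟨by omega, by dsimp only; omega, hpos, hpos, hpop (by omega)⟩

theorem HalvingState.InRange.size_le {x : HalvingState} (h : x.InRange N D) :
    size x ≤ (N + 2) ^ (4 * D) + (N + D + 4) := by
  obtain ⟨h1, h2, h3, h4, h5⟩ := h
  have h6 : x.2.2.2.2 < (N + 2) ^ (4 * D) :=
    h5.trans_le (Nat.pow_le_pow_right (by omega) (by omega))
  simp only [size]
  omega

end

/-! ### The halving evaluation as a space-bounded computation -/

section

open SpaceComputable

variable {α : Type} [RegData α]

theorem SpaceComputable.pushFrame {N u v w b s : α → ℕ} (hN : SpaceComputable N)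
    (hu : SpaceComputable u) (hv : SpaceComputable v) (hw : SpaceComputable w)
    (hb : SpaceComputable b) (hs : SpaceComputable s) :
    SpaceComputable fun a => pushFrame (N a) (u a) (v a) (w a) (b a) (s a) :=
  have hB := hN.add (const 2)
  ((((((hs.mul hB).add hu).mul hB).add hv).mul hB).add hw).mul hB |>.add hb

theorem SpaceComputable.halvingStep {N D : α → ℕ} {edge : α → ℕ → ℕ → Prop}
    (hN : SpaceComputable N) (hD : SpaceComputable D)
    (he : SpaceDecidable fun x : α × ℕ × ℕ => edge x.1 x.2.1 x.2.2) :
    SpaceComputable fun x : α × HalvingState => halvingStep (N x.1) (D x.1) (edge x.1) x.2 := by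
  have hN' := hN.comp (fst (α := α) (β := HalvingState))
  have hD' := hD.comp (fst (α := α) (β := HalvingState))
  have hm := (snd (α := α) (β := HalvingState)).fst'
  have hk := (snd (α := α) (β := HalvingState)).snd'.fst'
  have hu := (snd (α := α) (β := HalvingState)).snd'.snd'.fst'
  have hv := (snd (α := α) (β := HalvingState)).snd'.snd'.snd'.fst'
  have hs := (snd (α := α) (β := HalvingState)).snd'.snd'.snd'.snd'
  have hB := hN'.add (const 2)
  have h1 := hs.div hB
  have h2 := h1.div hB
  have h3 := h2.div hB
  have h4 := h3.div hB
  have hb := hs.mod hB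
  have hw := h1.mod hB
  have hv' := h2.mod hB
  have hu' := h3.mod hB
  have h0 := const (α := α × HalvingState) 0
  have hone := const (α := α × HalvingState) 1
  have htwo := const (α := α × HalvingState) 2
  have he' := he.comp (fst.pair (hu.pair hv))
  exact .ite (.eq hm h0)
    (.ite (.eq hk h0) ((hone.add (SpaceDecidable.or (.eq hu hv) he')).pair (h0.pair (h0.pair (h0.pair hs))))
      (h0.pair (hk.pred.pair (hu.pair (h0.pair (.pushFrame hN' hu hv h0 h0 hs))))))
    (.ite (.le hD' hk) snd
      (.ite (.eq hm hone)
        (.ite (.lt hw.succ hN')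
          (h0.pair (hk.pair (hu'.pair (hw.succ.pair (.pushFrame hN' hu' hv' hw.succ h0 h4)))))
          (hone.pair (hk.succ.pair (h0.pair (h0.pair h4)))))
        (.ite (.eq hb h0)
          (h0.pair (hk.pair (hw.pair (hv'.pair (.pushFrame hN' hu' hv' hw hone h4)))))
          (htwo.pair (hk.succ.pair (h0.pair (h0.pair h4)))))))

/-- The number `(N + 2) ^ (4 * D)` serves twice: it bounds the encoded stack, and it exceeds the
running time `(5 * N) ^ D`, because `5 * N ≤ (N + 2) ^ 3`. So the step is iterated that often, and
the answer waits at its fixed point. -/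
theorem SpaceDecidable.halvingReach {N D u v : α → ℕ} {edge : α → ℕ → ℕ → Prop}
    (hN : SpaceComputable N) (hD : SpaceComputable D) (hu : SpaceComputable u)
    (hv : SpaceComputable v) (he : SpaceDecidable fun x : α × ℕ × ℕ => edge x.1 x.2.1 x.2.2)
    (hb : PolyBounded fun a => (N a + 2) ^ (4 * D a)) :
    SpaceDecidable fun a => u a < N a ∧ v a < N a ∧ HalvingReach (N a) (edge a) (D a) (u a) (v a) := by
  have hpow := (hN.add (.const 2)).pow ((SpaceComputable.const 4).mul hD) hb
  -- Arguments out of range could violate the invariant that bounds the iterates. The reduction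
  -- modulo `N a + 2` prevents this and changes nothing in the only relevant case, `u a < N a` and
  -- `v a < N a`.
  have hclip : ∀ w : α → ℕ, SpaceComputable w → SpaceComputable fun a => w a % (N a + 2) :=
    fun w hw => hw.mod (hN.add (.const 2))
  have hit := iterate (step := fun a => _root_.halvingStep (N a) (D a) (edge a))
    (init := fun a => ((0, D a, u a % (N a + 2), v a % (N a + 2), 0) : HalvingState))
    ((SpaceComputable.const 0).pair (hD.pair ((hclip u hu).pair ((hclip v hv).pair (.const 0)))))
    (.halvingStep hN hD he) hpow
    (hb.add (((hN.polyBounded.add hD.polyBounded)).add (.const 4))) fun a k _ => by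
      refine HalvingState.InRange.size_le (N := N a) (D := D a) ?_
      induction k with
      | zero => exact ⟨by simp, le_rfl, Nat.mod_lt _ (by omega), Nat.mod_lt _ (by omega), by simp⟩
      | succ k ih =>
        rw [Function.iterate_succ_apply']
        exact (ih (by omega)).step
  refine ((SpaceDecidable.lt hu hN).and ((SpaceDecidable.lt hv hN).and
    (SpaceDecidable.eq hit.fst' (.const 2)))).of_iff fun a => ?_
  refine and_congr_right fun hu' => and_congr_right fun hv' => ?_
  obtain ⟨t, ht, e⟩ := iteratesWithin_halvingStep (edge := edge a) (D a) le_rfl (u a) (v a) 0 hu' hv'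
  have ht' : t ≤ (N a + 2) ^ (4 * D a) := ht.trans (by
    rw [pow_mul]
    refine Nat.pow_le_pow_left ?_ _
    have hN1 : 1 ≤ N a := by omega
    calc 5 * N a ≤ (N a + 2) ^ 3 := by ring_nf; nlinarith
      _ ≤ _ := Nat.pow_le_pow_right (by omega) (by omega))
  have hfix : ∀ j, (_root_.halvingStep (N a) (D a) (edge a))^[j]
      (1 + truthValue (HalvingReach (N a) (edge a) (D a) (u a) (v a)), D a, 0, 0, 0) =
      (1 + truthValue (HalvingReach (N a) (edge a) (D a) (u a) (v a)), D a, 0, 0, 0) := fun j =>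
    Function.iterate_fixed (by rw [add_comm 1]; exact halvingStep_done _ _ _ _) j
  rw [Nat.mod_eq_of_lt (by omega), Nat.mod_eq_of_lt (by omega),
    show (N a + 2) ^ (4 * D a) = ((N a + 2) ^ (4 * D a) - t) + t by omega,
    Function.iterate_add_apply, e, hfix]
  by_cases h : HalvingReach (N a) (edge a) (D a) (u a) (v a) <;> simp [truthValue, h]

end

/-! ### Halving and reachability -/

/-- The nodes that are reached from `u` in at most `n` steps. -/
def reachWithin (edge : ℕ → ℕ → Prop) (u : ℕ) : ℕ → Set ℕ
  | 0 => {u}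
  | n + 1 => reachWithin edge u n ∪ {v | ∃ w ∈ reachWithin edge u n, edge w v}

section

variable {N : ℕ} {edge : ℕ → ℕ → Prop}

theorem mem_reachWithin_add {u v : ℕ} (m n : ℕ) : v ∈ reachWithin edge u (m + n) ↔
    ∃ w ∈ reachWithin edge u m, v ∈ reachWithin edge w n := by
  induction n generalizing v with
  | zero => simp [reachWithin]
  | succ n ih =>
    rw [← add_assoc, reachWithin, Set.mem_union, ih, Set.mem_ofPred_eq]
    simp only [ih, reachWithin, Set.mem_union, Set.mem_ofPred_eq]
    constructor
    · rintro (⟨w, h1, h2⟩ | ⟨w, ⟨x, h1, h2⟩, h3⟩)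
      · exact ⟨w, h1, .inl h2⟩
      · exact ⟨x, h1, .inr ⟨w, h2, h3⟩⟩
    · rintro ⟨w, h1, h2 | ⟨x, h2, h3⟩⟩
      · exact .inl ⟨w, h1, h2⟩
      · exact .inr ⟨x, ⟨w, h1, h2⟩, h3⟩

theorem reachWithin_mono (u : ℕ) : Monotone (reachWithin edge u) :=
  monotone_nat_of_le_succ fun _ => Set.subset_union_left

theorem reachWithin_subset (he : ∀ u v, u < N → edge u v → v < N) {u : ℕ} (hu : u < N) (n : ℕ) :
    reachWithin edge u n ⊆ Set.Iio N := by
  induction n with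
  | zero => simpa [reachWithin] using hu
  | succ n ih => exact Set.union_subset ih fun v ⟨w, hw, h⟩ => he w v (ih hw) h

theorem halvingReach_iff (he : ∀ u v, u < N → edge u v → v < N) (k : ℕ) {u v : ℕ} (hu : u < N) :
    HalvingReach N edge k u v ↔ v ∈ reachWithin edge u (2 ^ k) := by
  induction k generalizing u v with
  | zero => simp [HalvingReach, reachWithin, eq_comm]
  | succ k ih =>
    rw [pow_succ, mul_two, mem_reachWithin_add]
    constructor
    · rintro ⟨w, hw, h1, h2⟩
      exact ⟨w, (ih hu).1 h1, (ih hw).1 h2⟩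
    · rintro ⟨w, h1, h2⟩
      have hw : w < N := reachWithin_subset he hu _ h1
      exact ⟨w, hw, (ih hu).2 h1, (ih hw).2 h2⟩

/-- The reachable sets increase, and once two consecutive ones have equal cardinality they coincide,
and so do all later ones. With `N` nodes this has happened after `N` steps. -/
theorem reachWithin_eq (he : ∀ u v, u < N → edge u v → v < N) {u : ℕ} (hu : u < N) {n : ℕ}
    (hn : N ≤ n) : reachWithin edge u n = reachWithin edge u N := by
  have hfin : ∀ m, (reachWithin edge u m).Finite := fun m =>
    (Set.finite_Iio N).subset (reachWithin_subset he hu m)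
  have key : (reachWithin edge u n).ncard = (reachWithin edge u N).ncard := by
    refine Nat.stabilises_of_monotone (f := fun m => (reachWithin edge u m).ncard)
      (fun a b h => Set.ncard_le_ncard (reachWithin_mono u h) (hfin b)) (fun m => ?_)
      (fun m h => ?_) hn
    · simpa using Set.ncard_le_ncard (reachWithin_subset he hu m) (Set.finite_Iio N)
    · have := Set.eq_of_subset_of_ncard_le (reachWithin_mono u (Nat.le_succ m)) h.symm.le
        (hfin (m + 1))
      show _ = (reachWithin edge u (m + 1) ∪ {v | ∃ w ∈ reachWithin edge u (m + 1), edge w v}).ncard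
      rw [← show reachWithin edge u m = reachWithin edge u (m + 1) from this]
      exact h
  exact (Set.eq_of_subset_of_ncard_le (reachWithin_mono u hn) key.le (hfin n)).symm

/-- Depth `M` covers `2 ^ M` steps, which is as many as there are nodes and hence enough for every
reachable node. -/
theorem halvingReach_iff_reflTransGen {M : ℕ} (he : ∀ u v, u < 2 ^ M → edge u v → v < 2 ^ M)
    {u v : ℕ} (hu : u < 2 ^ M) :
    HalvingReach (2 ^ M) edge M u v ↔ Relation.ReflTransGen edge u v := by
  rw [halvingReach_iff he M hu]
  constructor
  · suffices ∀ n v, v ∈ reachWithin edge u n → Relation.ReflTransGen edge u v from this _ _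
    intro n
    induction n with
    | zero => rintro v rfl; exact .refl
    | succ n ih =>
      rintro v (h | ⟨w, hw, h⟩)
      · exact ih v h
      · exact (ih w hw).tail h
  · intro h
    have : ∃ n, v ∈ reachWithin edge u n := by
      induction h with
      | refl => exact ⟨0, rfl⟩
      | tail _ h ih =>
        obtain ⟨n, hn⟩ := ih
        exact ⟨n + 1, .inr ⟨_, hn, h⟩⟩
    obtain ⟨n, hn⟩ := this
    rw [← reachWithin_eq he hu (le_max_right n _)]
    exact reachWithin_mono u (le_max_left _ _) hn

end

/-! ### Runs of automata -/

section

variable {α β γ σ τ : Type}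

/-- The state that a DFA reaches on a word. -/
def FinDFA.run (A : FinDFA α) (w : List α) : Option (Fin A.numStates) :=
  w.foldlM A.step A.start

theorem FinDFA.run_nil (A : FinDFA α) : A.run [] = some A.start := rfl

theorem FinDFA.run_concat (A : FinDFA α) (w : List α) (a : α) :
    A.run (w ++ [a]) = (A.run w).bind fun q => A.step q a := by
  simp only [FinDFA.run, List.foldlM_append, List.foldlM_cons, List.foldlM_nil, bind_pure]
  rfl

theorem FinDFA.mem_language (A : FinDFA α) (w : List α) :
    w ∈ A.language ↔ ∃ q, A.run w = some q ∧ A.accept q = true := Iff.rfl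

theorem FinDFA.mem_rel (A : FinDFA (α × β)) (x : List α) (y : List β) :
    (x, y) ∈ A.rel ↔ x.length = y.length ∧ x.zip y ∈ A.language := Iff.rfl

theorem FinDFA.map_mem_rel (A : FinDFA (α × β)) (w : List (α × β)) :
    (w.map Prod.fst, w.map Prod.snd) ∈ A.rel ↔ w ∈ A.language := by
  rw [FinDFA.mem_rel, ← List.zip_of_prod (xs := w) rfl rfl]
  simp

theorem FinDFA.exists_of_mem_rel {A : FinDFA (α × β)} {x : List α} {y : List β}
    (h : (x, y) ∈ A.rel) : ∃ w ∈ A.language, w.map Prod.fst = x ∧ w.map Prod.snd = y :=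
  ⟨x.zip y, h.2, List.map_fst_zip h.1.le, List.map_snd_zip h.1.ge⟩

/-- A finite deterministic transition system recognizes the language of a DFA. -/
theorem exists_finDFA [Finite σ] (step : σ → α → σ) (s : σ) (F : σ → Prop) :
    ∃ A : FinDFA α, ∀ w, w ∈ A.language ↔ F (w.foldl step s) := by
  classical
  let e := Finite.equivFin σ
  let A : FinDFA α := ⟨Nat.card σ, e s, fun q => decide (F (e.symm q)),
    fun q a => some (e (step (e.symm q) a))⟩
  refine ⟨A, fun w => ?_⟩
  have hrun : A.run w = some (e (w.foldl step s)) := by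
    induction w using List.reverseRecOn with
    | nil => rfl
    | append_singleton w a ih =>
      rw [FinDFA.run_concat, ih, List.foldl_append]
      simp [A]
  rw [FinDFA.mem_language, hrun]
  simp [A]

/-- The image of a set under a relation. -/
def relImage (r : σ → τ → Prop) (S : Set σ) : Set τ := {t | ∃ s ∈ S, r s t}

theorem mem_relImage {r : σ → τ → Prop} {S : Set σ} {t : τ} :
    t ∈ relImage r S ↔ ∃ s ∈ S, r s t := Iff.rfl

/-- A deterministic transition system reaches a state on some word if and only if it is reachable. -/
theorem exists_foldl_iff_reflTransGen (step : σ → α → σ) (s t : σ) :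
    (∃ w : List α, w.foldl step s = t) ↔
      Relation.ReflTransGen (fun u v => ∃ a, v = step u a) s t := by
  constructor
  · rintro ⟨w, rfl⟩
    induction w using List.reverseRecOn with
    | nil => exact .refl
    | append_singleton w a ih =>
      rw [List.foldl_append]
      exact ih.tail ⟨a, rfl⟩
  · intro h
    induction h with
    | refl => exact ⟨[], rfl⟩
    | tail _ h ih =>
      obtain ⟨w, rfl⟩ := ih
      obtain ⟨a, rfl⟩ := h
      exact ⟨w ++ [a], by rw [List.foldl_append]; rfl⟩

end

/-! ### The largest candidate for the second component -/

section

variable {I B O E : Type} (A : FinDFA (I × O)) (A₁ : FinDFA (I × B))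

/-- Pairs of a state of `A₁` and a state of `A`, where `none` stands for a missing run. -/
abbrev StatePair (A : FinDFA (I × O)) (A₁ : FinDFA (I × B)) : Type :=
  Fin A₁.numStates × Option (Fin A.numStates)

/-- A step of a state pair on an output letter, for some input letter. -/
def pairStep (l : B × O) (s t : StatePair A A₁) : Prop :=
  ∃ a, A₁.step s.1 (a, l.1) = some t.1 ∧ t.2 = s.2.bind fun p => A.step p (a, l.2)

/-- The state pairs that are reached on a pair of words, for some input word. -/
def pairRun (w : List (B × O)) : Set (StatePair A A₁) :=
  w.foldl (fun S l => relImage (pairStep A A₁ l) S) {(A₁.start, some A.start)}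

theorem pairRun_concat (w : List (B × O)) (l : B × O) :
    pairRun A A₁ (w ++ [l]) = relImage (pairStep A A₁ l) (pairRun A A₁ w) := by
  simp [pairRun]

/-- The set collects the outcomes of all input words `x` at once. A missing run of `A` must be kept
as `none`: if `A₁` accepts along that same `x`, it witnesses a violation. -/
theorem mem_pairRun (w : List (B × O)) (q : Fin A₁.numStates) (p : Option (Fin A.numStates)) :
    (q, p) ∈ pairRun A A₁ w ↔ ∃ x : List I, x.length = w.length ∧
      A₁.run (x.zip (w.map Prod.fst)) = some q ∧ A.run (x.zip (w.map Prod.snd)) = p := by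
  induction w using List.reverseRecOn generalizing q p with
  | nil =>
    simp only [pairRun, List.foldl_nil, Set.mem_singleton_iff, Prod.mk.injEq, List.length_nil,
      List.length_eq_zero_iff, List.map_nil, exists_eq_left, List.zip_nil_left, FinDFA.run_nil,
      Option.some.injEq]
    exact and_congr eq_comm eq_comm
  | append_singleton w l ih =>
    rw [pairRun_concat, mem_relImage]
    constructor
    · rintro ⟨⟨q', p'⟩, hmem, a, h1, h2⟩
      obtain ⟨x, hx, h3, h4⟩ := (ih q' p').1 hmem
      refine ⟨x ++ [a], by simp [hx], ?_, ?_⟩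
      · rw [List.map_append, List.zip_append (by simpa using hx)]
        simp only [List.map_cons, List.map_nil, List.zip_cons_cons, List.zip_nil_left]
        rw [FinDFA.run_concat, h3]
        exact h1
      · rw [List.map_append, List.zip_append (by simpa using hx)]
        simp only [List.map_cons, List.map_nil, List.zip_cons_cons, List.zip_nil_left]
        rw [FinDFA.run_concat, h4]
        exact h2.symm
    · rintro ⟨x, hx, h1, h2⟩
      rcases List.eq_nil_or_concat x with rfl | ⟨x, a, rfl⟩
      · simp at hx
      have hx' : x.length = w.length := by simpa using hx
      rw [List.map_append, List.concat_eq_append, List.zip_append (by simpa using hx')] at h1 h2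
      simp only [List.map_cons, List.map_nil, List.zip_cons_cons, List.zip_nil_left] at h1 h2
      rw [FinDFA.run_concat] at h1 h2
      obtain ⟨q', hq', h1⟩ := Option.bind_eq_some_iff.1 h1
      exact ⟨(q', A.run (x.zip (w.map Prod.snd))), (ih _ _).2 ⟨x, hx', hq', rfl⟩, a, h1, h2.symm⟩

/-- All input words that are accepted by `A₁` are accepted by `A`. -/
def PairGood (S : Set (StatePair A A₁)) : Prop :=
  ∀ s ∈ S, A₁.accept s.1 = true → ∃ p, s.2 = some p ∧ A.accept p = true

/-- The largest relation whose composition with the relation of `A₁` is contained in the relation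
of `A`. -/
def largestRel : SetRel (List B) (List O) :=
  {p | p.1.length = p.2.length ∧ ∀ x, (x, p.1) ∈ A₁.rel → (x, p.2) ∈ A.rel}

theorem mem_largestRel (y : List B) (z : List O) : (y, z) ∈ largestRel A A₁ ↔
    y.length = z.length ∧ ∀ x, (x, y) ∈ A₁.rel → (x, z) ∈ A.rel := Iff.rfl

/-- The quantifier over all `x` in `largestRel` becomes a condition on the final set of pairs,
because that set records every `x`. -/
theorem pairGood_pairRun (w : List (B × O)) : PairGood A A₁ (pairRun A A₁ w) ↔
    (w.map Prod.fst, w.map Prod.snd) ∈ largestRel A A₁ := by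
  rw [mem_largestRel]
  constructor
  · refine fun h => ⟨by simp, fun x hx => ?_⟩
    obtain ⟨h1, q, h2, h3⟩ := hx
    have h1' : x.length = w.length := by simpa using h1
    obtain ⟨p, h4, h5⟩ := h (q, _) ((mem_pairRun A A₁ w q _).2 ⟨x, h1', h2, rfl⟩) h3
    exact ⟨by simpa using h1', p, h4, h5⟩
  · rintro ⟨-, h⟩ ⟨q, p⟩ hs hq
    obtain ⟨x, h1, h2, h3⟩ := (mem_pairRun A A₁ w q p).1 hs
    obtain ⟨h4, p', h5, h6⟩ := h x ⟨by simpa using h1, q, h2, hq⟩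
    exact ⟨p', h3.symm.trans h5, h6⟩

/-- The sets of state pairs form a finite deterministic transition system, so the candidate is
itself admissible as an answer. -/
theorem exists_rel_eq_largestRel : ∃ A₂ : FinDFA (B × O), A₂.rel = largestRel A A₁ := by
  obtain ⟨A₂, h⟩ := exists_finDFA (fun S l => relImage (pairStep A A₁ l) S)
    {(A₁.start, some A.start)} (PairGood A A₁)
  refine ⟨A₂, Set.ext fun ⟨y, z⟩ => ?_⟩
  rw [FinDFA.mem_rel]
  refine Iff.trans (and_congr_right fun hyz => ?_)
    (show y.length = z.length ∧ (y, z) ∈ largestRel A A₁ ↔ _ from ⟨And.right, fun h => ⟨h.1, h⟩⟩)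
  rw [h]
  have := pairGood_pairRun A A₁ (y.zip z)
  rwa [List.map_fst_zip hyz.le, List.map_snd_zip hyz.ge] at this

/-! ### The decomposition conditions for the largest candidate -/

/-- Every word of the outer automaton is refined to a triple of words with the first two components
related by `A₁` and the last two components related by the largest candidate. -/
def Refinable (outer : FinDFA (I × E)) (compat : E → B → O → Prop) : Prop :=
  ∀ W ∈ outer.language, ∃ T : List (I × B × O),
    List.Forall₂ (fun l m => l.1 = m.1 ∧ compat m.2 l.2.1 l.2.2) T W ∧
      T.map (fun l => (l.1, l.2.1)) ∈ A₁.language ∧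
      (T.map fun l => l.2.1, T.map fun l => l.2.2) ∈ largestRel A A₁

variable {A A₁}

theorem forall₂_iff_map {X Y : Type} (f : X → Y) (T : List X) (W : List Y) :
    List.Forall₂ (fun l m => f l = m) T W ↔ T.map f = W := by
  rw [← List.forall₂_eq_eq_eq, List.forall₂_map_left_iff]

/-- Words of equal length as a list of triples. -/
theorem exists_triples (x : List I) (y : List B) (z : List O) (hxy : x.length = y.length)
    (hyz : y.length = z.length) : ∃ T : List (I × B × O), T.map (fun l => l.1) = x ∧
      T.map (fun l => l.2.1) = y ∧ T.map (fun l => l.2.2) = z := by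
  have h1 : (y.zip z).length = y.length := by rw [List.length_zip, hyz, min_self]
  refine ⟨x.zip (y.zip z), List.map_fst_zip (by omega), ?_, ?_⟩
  · have := List.map_map (g := Prod.fst) (f := Prod.snd) (l := x.zip (y.zip z))
    rw [List.map_snd_zip (by omega), List.map_fst_zip hyz.le] at this
    exact this.symm
  · have := List.map_map (g := Prod.snd) (f := Prod.snd) (l := x.zip (y.zip z))
    rw [List.map_snd_zip (by omega), List.map_snd_zip hyz.ge] at this
    exact this.symm

theorem mem_rel_of_triples {T : List (I × B × O)}
    (h : T.map (fun l => (l.1, l.2.1)) ∈ A₁.language) :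
    (T.map (fun l => l.1), T.map fun l => l.2.1) ∈ A₁.rel := by
  have := (A₁.map_mem_rel _).2 h
  simpa [Function.comp_def] using this

theorem mem_language_of_triples {T : List (I × B × O)}
    (h : (T.map (fun l => l.1), T.map fun l => l.2.1) ∈ A₁.rel) :
    T.map (fun l => (l.1, l.2.1)) ∈ A₁.language := by
  refine (A₁.map_mem_rel _).1 ?_
  simpa [Function.comp_def] using h

/-- The outer word fixes `x` and `y`, so a refinement amounts to a word `z` related to `y`.
Quantifying over accepted pairs `(x, y)` is quantifying over the images `y`. -/
theorem refinable_iff_cod : Refinable A A₁ A₁ (fun e b _ => e = b) ↔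
    A₁.rel.cod ⊆ (largestRel A A₁).dom := by
  constructor
  · rintro h y ⟨x, hxy⟩
    obtain ⟨W, hW, rfl, rfl⟩ := FinDFA.exists_of_mem_rel hxy
    obtain ⟨T, hT, h1, h2⟩ := h W hW
    refine ⟨T.map fun l => l.2.2, ?_⟩
    have h3 : T.map (fun l => l.2.1) = W.map Prod.snd := by
      rw [← List.forall₂_eq_eq_eq, List.forall₂_map_left_iff, List.forall₂_map_right_iff]
      exact hT.imp fun _ _ h => h.2.symm
    rw [← h3]
    exact h2
  · intro h W hW
    obtain ⟨z, hz⟩ := h ⟨W.map Prod.fst, (A₁.map_mem_rel W).2 hW⟩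
    obtain ⟨T, h1, h2, h3⟩ := exists_triples (W.map Prod.fst) (W.map Prod.snd) z (by simp) hz.1
    have h4 : T.map (fun l => (l.1, l.2.1)) = W := by
      have := List.zip_map' (f := fun l : I × B × O => l.1) (g := fun l => l.2.1) (l := T)
      rw [← this, h1, h2]
      exact (List.zip_of_prod rfl rfl).symm
    refine ⟨T, ((forall₂_iff_map _ _ _).2 h4).imp fun l m h => ?_, h4 ▸ hW, ?_⟩
    · subst h; exact ⟨rfl, rfl⟩
    · rw [h2, h3]; exact hz

/-- The outer word fixes `x` and `z`; the guessed middle word is the witness for the composition. -/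
theorem refinable_iff_subset_comp : Refinable A A₁ A (fun e _ c => e = c) ↔
    A.rel ⊆ A₁.rel.comp (largestRel A A₁) := by
  constructor
  · rintro h ⟨x, z⟩ hxz
    obtain ⟨W, hW, rfl, rfl⟩ := FinDFA.exists_of_mem_rel hxz
    obtain ⟨T, hT, h1, h2⟩ := h W hW
    have h3 : T.map (fun l => l.1) = W.map Prod.fst := by
      rw [← List.forall₂_eq_eq_eq, List.forall₂_map_left_iff, List.forall₂_map_right_iff]
      exact hT.imp fun _ _ h => h.1
    have h4 : T.map (fun l => l.2.2) = W.map Prod.snd := by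
      rw [← List.forall₂_eq_eq_eq, List.forall₂_map_left_iff, List.forall₂_map_right_iff]
      exact hT.imp fun _ _ h => h.2.symm
    rw [← h3, ← h4]
    exact ⟨T.map fun l => l.2.1, mem_rel_of_triples h1, h2⟩
  · intro h W hW
    obtain ⟨y, hy, hz⟩ := h ((A.map_mem_rel W).2 hW)
    obtain ⟨T, h1, h2, h3⟩ := exists_triples (W.map Prod.fst) y (W.map Prod.snd) hy.1 hz.1
    have h4 : T.map (fun l => (l.1, l.2.2)) = W := by
      have := List.zip_map' (f := fun l : I × B × O => l.1) (g := fun l => l.2.2) (l := T)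
      rw [← this, h1, h3]
      exact (List.zip_of_prod rfl rfl).symm
    refine ⟨T, ((forall₂_iff_map _ _ _).2 h4).imp fun l m h => ?_, mem_language_of_triples ?_, ?_⟩
    · subst h; exact ⟨rfl, rfl⟩
    · rw [h1, h2]; exact hy
    · rw [h2, h3]; exact hz

/-- Only the `x` of the outer word is binding, since the compatibility relation is trivial; both `y`
and `z` are guessed, and the output of the outer word merely certifies `x ∈ Dom R`. -/
theorem refinable_iff_subset_dom : Refinable A A₁ A (fun _ _ _ => True) ↔
    A.rel.dom ⊆ (A₁.rel.comp (largestRel A A₁)).dom := by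
  constructor
  · rintro h x ⟨z, hxz⟩
    obtain ⟨W, hW, rfl, rfl⟩ := FinDFA.exists_of_mem_rel hxz
    obtain ⟨T, hT, h1, h2⟩ := h W hW
    have h3 : T.map (fun l => l.1) = W.map Prod.fst := by
      rw [← List.forall₂_eq_eq_eq, List.forall₂_map_left_iff, List.forall₂_map_right_iff]
      exact hT.imp fun _ _ h => h.1
    rw [← h3]
    exact ⟨T.map fun l => l.2.2, T.map fun l => l.2.1, mem_rel_of_triples h1, h2⟩
  · intro h W hW
    obtain ⟨z, y, hy, hz⟩ := h ⟨W.map Prod.snd, (A.map_mem_rel W).2 hW⟩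
    obtain ⟨T, h1, h2, h3⟩ := exists_triples (W.map Prod.fst) y z hy.1 hz.1
    refine ⟨T, ?_, mem_language_of_triples ?_, ?_⟩
    · rw [← List.forall₂_eq_eq_eq, List.forall₂_map_left_iff, List.forall₂_map_right_iff] at h1
      exact h1.imp fun _ _ h => ⟨h, trivial⟩
    · rw [h1, h2]; exact hy
    · rw [h2, h3]; exact hz

/-! ### Maximality of the candidate and the two criteria -/

theorem comp_largestRel_subset : A₁.rel.comp (largestRel A A₁) ⊆ A.rel :=
  fun _ ⟨_, h1, h2⟩ => h2.2 _ h1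

/-- A pair of `A₂.rel` has words of equal length, and every `x` related to its first word gives a
pair of the composition, hence of `A.rel`. -/
theorem subset_largestRel {A₂ : FinDFA (B × O)} (h : A₁.rel.comp A₂.rel ⊆ A.rel) :
    A₂.rel ⊆ largestRel A A₁ :=
  fun ⟨_, _⟩ hp => ⟨hp.1, fun _ hx => h ⟨_, hx, hp⟩⟩

/-- Image inclusion and `A.rel ⊆ A₁.rel.comp _` survive enlarging the second component, so any
solution transfers them to the largest candidate. Its composition is contained in `A.rel` by
construction, so conversely they make it a solution. -/
theorem exists_tdCondition_iff : (∃ A₂ : FinDFA (B × O), TDCondition A.rel A₁.rel A₂.rel) ↔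
    Refinable A A₁ A₁ (fun e b _ => e = b) ∧ Refinable A A₁ A (fun e _ c => e = c) := by
  rw [refinable_iff_cod, refinable_iff_subset_comp]
  constructor
  · rintro ⟨A₂, h1, h2⟩
    have h3 := subset_largestRel h2.le
    refine ⟨fun y hy => ?_, fun p hp => ?_⟩
    · obtain ⟨z, hz⟩ := h1 hy
      exact ⟨z, h3 hz⟩
    · obtain ⟨y, hy, hz⟩ := h2.ge hp
      exact ⟨y, hy, h3 hz⟩
  · rintro ⟨h1, h2⟩
    obtain ⟨A₂, h⟩ := exists_rel_eq_largestRel A A₁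
    exact ⟨A₂, h ▸ h1, h ▸ comp_largestRel_subset.antisymm h2⟩

theorem exists_pdCondition_iff : (∃ A₂ : FinDFA (B × O), PDCondition A.rel A₁.rel A₂.rel) ↔
    Refinable A A₁ A₁ (fun e b _ => e = b) ∧ Refinable A A₁ A (fun _ _ _ => True) := by
  rw [refinable_iff_cod, refinable_iff_subset_dom]
  constructor
  · rintro ⟨A₂, h1, h2, h3⟩
    have h3 := subset_largestRel h3
    refine ⟨fun y hy => ?_, fun x hx => ?_⟩
    · obtain ⟨z, hz⟩ := h1 hy
      exact ⟨z, h3 hz⟩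
    · obtain ⟨z, y, hy, hz⟩ := h2.ge hx
      exact ⟨z, y, hy, h3 hz⟩
  · rintro ⟨h1, h2⟩
    obtain ⟨A₂, h⟩ := exists_rel_eq_largestRel A A₁
    refine ⟨A₂, h ▸ h1, ?_, h ▸ comp_largestRel_subset⟩
    rw [h]
    -- The other inclusion of domains is free, since the composition with the candidate is contained
    -- in `A.rel`.
    refine Set.Subset.antisymm ?_ h2
    rintro x ⟨z, hz⟩
    exact ⟨z, comp_largestRel_subset hz⟩

end

/-! ### Refinability as reachability -/

section

variable {I B O E : Type} (A : FinDFA (I × O)) (A₁ : FinDFA (I × B)) (outer : FinDFA (I × E))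
  (compat : E → B → O → Prop)

/-- The states of a nondeterministic automaton: either the state of `A₁` together with a set of
state pairs, or a state of the outer automaton. -/
abbrev TrackState : Type := (Set (StatePair A A₁) × Fin A₁.numStates) ⊕ Fin outer.numStates

/-- The transitions of the nondeterministic automaton. -/
inductive TrackStep (m : I × E) : TrackState A A₁ outer → TrackState A A₁ outer → Prop
  -- The set `S` depends only on the guessed letters `(b, c)`: it follows all input words, not just
  -- the one that drives `q`.
  | refine {S q q'} (b : B) (c : O) (h : compat m.2 b c) (hq : A₁.step q (m.1, b) = some q') :
      TrackStep m (.inl (S, q)) (.inl (relImage (pairStep A A₁ (b, c)) S, q'))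
  | outer {q q'} (hq : outer.step q m = some q') : TrackStep m (.inr q) (.inr q')

/-- The set of states of the nondeterministic automaton that are reached on a word. -/
def trackRun (W : List (I × E)) : Set (TrackState A A₁ outer) :=
  W.foldl (fun M m => relImage (TrackStep A A₁ outer compat m) M)
    {.inl ({(A₁.start, some A.start)}, A₁.start), .inr outer.start}

/-- A set of states that refutes refinability. -/
def TrackBad (M : Set (TrackState A A₁ outer)) : Prop :=
  (∃ q, .inr q ∈ M ∧ outer.accept q = true) ∧
    ∀ S q, .inl (S, q) ∈ M → A₁.accept q = true → ¬PairGood A A₁ S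

variable {A A₁ outer compat}

theorem trackRun_concat (W : List (I × E)) (m : I × E) : trackRun A A₁ outer compat (W ++ [m]) =
    relImage (TrackStep A A₁ outer compat m) (trackRun A A₁ outer compat W) := by
  simp [trackRun]

theorem inr_mem_trackRun (W : List (I × E)) (q : Fin outer.numStates) :
    .inr q ∈ trackRun A A₁ outer compat W ↔ outer.run W = some q := by
  induction W using List.reverseRecOn generalizing q with
  | nil => simp [trackRun, FinDFA.run_nil, eq_comm]
  | append_singleton W m ih =>
    rw [trackRun_concat, FinDFA.run_concat, Option.bind_eq_some_iff]
    constructor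
    · rintro ⟨s, hs, h⟩
      cases h with
      | outer hq => exact ⟨_, (ih _).1 hs, hq⟩
    · rintro ⟨q', h, hq⟩
      exact ⟨_, (ih _).2 h, .outer hq⟩

/-- The nondeterminism is exactly the choice of a refinement `T` of `W`; each `T` along which `A₁`
has a run contributes one state. -/
theorem inl_mem_trackRun (W : List (I × E)) (S : Set (StatePair A A₁)) (q : Fin A₁.numStates) :
    .inl (S, q) ∈ trackRun A A₁ outer compat W ↔ ∃ T : List (I × B × O),
      List.Forall₂ (fun l m => l.1 = m.1 ∧ compat m.2 l.2.1 l.2.2) T W ∧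
        A₁.run (T.map fun l => (l.1, l.2.1)) = some q ∧ pairRun A A₁ (T.map Prod.snd) = S := by
  induction W using List.reverseRecOn generalizing S q with
  | nil => simp [trackRun, FinDFA.run_nil, pairRun, eq_comm, and_comm]
  | append_singleton W m ih =>
    rw [trackRun_concat]
    constructor
    · rintro ⟨s, hs, h⟩
      cases h with
      | refine b c h hq =>
        obtain ⟨T, h1, h2, h3⟩ := (ih _ _).1 hs
        refine ⟨T ++ [(m.1, b, c)], List.rel_append h1 (.cons ⟨rfl, h⟩ .nil), ?_, ?_⟩
        · rw [List.map_append, List.map_cons, List.map_nil, FinDFA.run_concat, h2]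
          exact hq
        · rw [List.map_append, List.map_cons, List.map_nil, pairRun_concat, h3]
    · rintro ⟨T, h1, h2, h3⟩
      rcases List.eq_nil_or_concat T with rfl | ⟨T, l, rfl⟩
      · have := h1.length_eq
        simp at this
      rw [List.concat_eq_append] at h1 h2 h3
      obtain ⟨h4, h5⟩ : List.Forall₂ (fun l m => l.1 = m.1 ∧ compat m.2 l.2.1 l.2.2) T W ∧
          (l.1 = m.1 ∧ compat m.2 l.2.1 l.2.2) := by
        have h6 := List.forall₂_reverse_iff.2 h1
        simp only [List.reverse_append, List.reverse_cons, List.reverse_nil, List.nil_append,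
          List.singleton_append, List.forall₂_cons] at h6
        exact ⟨List.forall₂_reverse_iff.1 h6.2, h6.1⟩
      rw [List.map_append, List.map_cons, List.map_nil, FinDFA.run_concat] at h2
      rw [List.map_append, List.map_cons, List.map_nil, pairRun_concat] at h3
      obtain ⟨q', hq', h2⟩ := Option.bind_eq_some_iff.1 h2
      subst h3
      exact ⟨_, (ih _ _).2 ⟨T, h4, hq', rfl⟩, .refine l.2.1 l.2.2 h5.2 (h5.1 ▸ h2)⟩

/-- A word refutes refinability when the outer automaton accepts it while every guess fails, either
because `A₁` rejects or because the final set of pairs is not good. All guesses are visible in the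
determinized state. -/
theorem refinable_iff_forall_not_trackBad : Refinable A A₁ outer compat ↔
    ∀ W, ¬TrackBad A A₁ outer (trackRun A A₁ outer compat W) := by
  refine forall_congr' fun W => ?_
  rw [FinDFA.mem_language]
  simp only [TrackBad, inr_mem_trackRun, inl_mem_trackRun]
  constructor
  · rintro h ⟨h1, h2⟩
    obtain ⟨T, h3, ⟨q, h4, h5⟩, h6⟩ := h h1
    refine h2 _ q ⟨T, h3, h4, rfl⟩ h5 ((pairGood_pairRun A A₁ _).2 ?_)
    simpa [Function.comp_def] using h6
  · rintro h h1
    by_contra hT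
    refine h ⟨h1, ?_⟩
    rintro S q ⟨T, h3, h4, rfl⟩ h5 h6
    refine hT ⟨T, h3, ⟨q, h4, h5⟩, ?_⟩
    simpa [Function.comp_def] using (pairGood_pairRun A A₁ _).1 h6

/-- Refinability is the unreachability of bad sets of states. -/
theorem refinable_iff : Refinable A A₁ outer compat ↔ ¬∃ M, Relation.ReflTransGen
    (fun M M' => ∃ m, M' = relImage (TrackStep A A₁ outer compat m) M)
    {.inl ({(A₁.start, some A.start)}, A₁.start), .inr outer.start} M ∧ TrackBad A A₁ outer M := by
  rw [refinable_iff_forall_not_trackBad]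
  push Not
  constructor
  · intro h M hM
    obtain ⟨W, rfl⟩ := (exists_foldl_iff_reflTransGen _ _ _).2 hM
    exact h W
  · exact fun h W => h _ ((exists_foldl_iff_reflTransGen _ _ _).1 ⟨W, rfl⟩)

end

/-! ### Sets as numbers -/

section

variable {σ : Type} {M : ℕ}

open Classical in
/-- Subsets of a type with `M` elements as numbers less than `2 ^ M`. -/
noncomputable def setEquiv (e : σ ≃ Fin M) : Set σ ≃ Fin (2 ^ M) where
  toFun S := ⟨Nat.ofBits fun i : Fin M => decide (e.symm i ∈ S), Nat.ofBits_lt_two_pow _⟩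
  invFun v := {s | (v : ℕ).testBit (e s) = true}
  left_inv S := by
    ext s
    show Nat.testBit _ _ = true ↔ _
    rw [Nat.testBit_ofBits_lt _ _ (e s).2]
    simp
  right_inv v := by
    refine Fin.ext (Nat.eq_of_testBit_eq fun i => ?_)
    by_cases hi : i < M
    · dsimp only
      rw [Nat.testBit_ofBits_lt _ _ hi]
      simp
    · rw [Nat.testBit_lt_two_pow ((Nat.ofBits_lt_two_pow _).trans_le
        (Nat.pow_le_pow_right (by omega) (not_lt.1 hi))),
        Nat.testBit_lt_two_pow (v.2.trans_le (Nat.pow_le_pow_right (by omega) (not_lt.1 hi)))]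

theorem testBit_setEquiv (e : σ ≃ Fin M) (S : Set σ) (s : σ) :
    ((setEquiv e S : Fin (2 ^ M)) : ℕ).testBit (e s) = true ↔ s ∈ S := by
  show Nat.testBit (Nat.ofBits _) _ = true ↔ _
  rw [Nat.testBit_ofBits_lt _ _ (e s).2]
  simp

/-- The number `v` presents the image of the set that `u` presents. -/
def IsImage (M : ℕ) (r : ℕ → ℕ → Prop) (u v : ℕ) : Prop :=
  ∀ j < M, v.testBit j = true ↔ ∃ i < M, u.testBit i = true ∧ r i j

theorem forall_lt_iff_equiv (e : σ ≃ Fin M) (p : ℕ → Prop) : (∀ i < M, p i) ↔ ∀ s, p (e s) :=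
  ⟨fun h s => h _ (e s).2, fun h i hi => by simpa using h (e.symm ⟨i, hi⟩)⟩

theorem exists_lt_iff_equiv (e : σ ≃ Fin M) (p : ℕ → Prop) : (∃ i < M, p i) ↔ ∃ s, p (e s) :=
  ⟨fun ⟨i, hi, h⟩ => ⟨e.symm ⟨i, hi⟩, by simpa using h⟩, fun ⟨s, h⟩ => ⟨_, (e s).2, h⟩⟩

theorem exists_lt_iff_fin (p : ℕ → Prop) : (∃ i < M, p i) ↔ ∃ i : Fin M, p i :=
  exists_lt_iff_equiv (Equiv.refl _) p

theorem isImage_setEquiv (e : σ ≃ Fin M) {r' : ℕ → ℕ → Prop} {r : σ → σ → Prop}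
    (h : ∀ s t, r' (e s) (e t) ↔ r s t) (S T : Set σ) :
    IsImage M r' (setEquiv e S : Fin (2 ^ M)) (setEquiv e T : Fin (2 ^ M)) ↔ T = relImage r S := by
  rw [IsImage, forall_lt_iff_equiv e, Set.ext_iff]
  refine forall_congr' fun t => ?_
  rw [testBit_setEquiv, exists_lt_iff_equiv e]
  simp only [testBit_setEquiv, h, mem_relImage]

end

/-! ### Refinability in terms of tables of numbers -/

/-- Tables for the automata and the compatibility relation in the definition of `Refinable`. In the
tables of transitions, `0` means that there is no successor, and `p + 1` is the successor `p`. -/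
structure Tables where
  (sizeI sizeB sizeO sizeE num num₁ numOut start start₁ startOut : ℕ)
  (next next₁ nextOut : ℕ → ℕ → ℕ → ℕ)
  (acc acc₁ accOut : ℕ → Prop)
  (compat : ℕ → ℕ → ℕ → Prop)

namespace Tables

variable (t : Tables)

/-- The number of state pairs. -/
def numPairs : ℕ := t.num₁ * (t.num + 1)

/-- The number of the states that consist of a state and a set of state pairs. -/
def numInner : ℕ := 2 ^ t.numPairs * t.num₁

/-- The number of states of the nondeterministic automaton. -/
def numTracks : ℕ := t.numInner + t.numOut

/-- The pair of the state `q` and an optional state has the number `q * (num + 1) + p`, with `p = 0`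
for a missing run and `p = k + 1` for the state `k`. This is also the convention of the tables, so
an entry of `next` can be used as `p` directly. -/
def PairNext (b c i j : ℕ) : Prop :=
  ∃ a < t.sizeI, t.next₁ (i / (t.num + 1)) a b = j / (t.num + 1) + 1 ∧
    j % (t.num + 1) =
      if i % (t.num + 1) = 0 then 0 else t.next (i % (t.num + 1) - 1) a c

/-- A set with number `S` and a state `q` are combined into `S * num₁ + q`. -/
def InnerNext (a e i j : ℕ) : Prop :=
  ∃ b < t.sizeB, ∃ c < t.sizeO, t.compat e b c ∧ t.next₁ (i % t.num₁) a b = j % t.num₁ + 1 ∧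
    IsImage t.numPairs (t.PairNext b c) (i / t.num₁) (j / t.num₁)

/-- The states of the outer automaton are numbered after the inner ones, from `numInner` on. -/
def TrackNext (a e i j : ℕ) : Prop :=
  (i < t.numInner ∧ j < t.numInner ∧ t.InnerNext a e i j) ∨
    (t.numInner ≤ i ∧ t.numInner ≤ j ∧ t.nextOut (i - t.numInner) a e = j - t.numInner + 1)

/-- `IsImage` constrains only the bits below `numTracks`; the bound on `v` excludes numbers with
further bits, which present no set. -/
def Edge (u v : ℕ) : Prop :=
  v < 2 ^ t.numTracks ∧ ∃ a < t.sizeI, ∃ e < t.sizeE, IsImage t.numTracks (t.TrackNext a e) u v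

def Good (v : ℕ) : Prop :=
  ∀ i < t.numPairs, v.testBit i = true → t.acc₁ (i / (t.num + 1)) →
    i % (t.num + 1) ≠ 0 ∧ t.acc (i % (t.num + 1) - 1)

def Bad (u : ℕ) : Prop :=
  (∃ q < t.numOut, u.testBit (t.numInner + q) = true ∧ t.accOut q) ∧
    ∀ i < t.numInner, u.testBit i = true → t.acc₁ (i % t.num₁) → ¬t.Good (i / t.num₁)

def InitInner (i : ℕ) : Prop :=
  i % t.num₁ = t.start₁ ∧ ∀ j < t.numPairs,
    ((i / t.num₁).testBit j = true ↔ j = t.start₁ * (t.num + 1) + (t.start + 1))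

def Init (u : ℕ) : Prop :=
  ∀ i < t.numTracks, (u.testBit i = true ↔
    (i < t.numInner ∧ t.InitInner i) ∨ i = t.numInner + t.startOut)

/-- A bad set of states is reachable. -/
def ReachBad : Prop :=
  ∃ u < 2 ^ t.numTracks, t.Init u ∧ ∃ v < 2 ^ t.numTracks, t.Bad v ∧
    -- The bounds are repeated to match the form of the predicate in `SpaceDecidable.halvingReach`.
    (u < 2 ^ t.numTracks ∧ v < 2 ^ t.numTracks ∧
      HalvingReach (2 ^ t.numTracks) t.Edge t.numTracks u v)

end Tables

/-- An optional state as a number. -/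
def optionCode {n : ℕ} (p : Option (Fin n)) : ℕ := p.elim 0 fun i => (i : ℕ) + 1

theorem optionCode_injective {n : ℕ} : Function.Injective (optionCode (n := n)) := by
  rintro (- | p) (- | q) h
  · rfl
  · simp [optionCode] at h
  · simp [optionCode] at h
  · simpa [optionCode, Fin.ext_iff] using h

theorem optionCode_eq_succ {n : ℕ} {p : Option (Fin n)} {q : Fin n} :
    optionCode p = q + 1 ↔ p = some q :=
  optionCode_injective.eq_iff (b := some q)

theorem optionCode_lt {n : ℕ} (p : Option (Fin n)) : optionCode p < n + 1 := by
  rcases p with - | p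
  · simp [optionCode]
  · simp [optionCode]

/-- The tables describe the automata and the compatibility relation. -/
structure Tables.Represents (t : Tables) {i b o e : ℕ} (A : FinDFA (Fin i × Fin o))
    (A₁ : FinDFA (Fin i × Fin b)) (outer : FinDFA (Fin i × Fin e))
    (compat : Fin e → Fin b → Fin o → Prop) : Prop where
  sizeI : t.sizeI = i
  sizeB : t.sizeB = b
  sizeO : t.sizeO = o
  sizeE : t.sizeE = e
  num : t.num = A.numStates
  num₁ : t.num₁ = A₁.numStates
  numOut : t.numOut = outer.numStates
  start : t.start = A.start
  start₁ : t.start₁ = A₁.start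
  startOut : t.startOut = outer.start
  next : ∀ q a c, t.next (q : Fin _) (a : Fin _) (c : Fin _) = optionCode (A.step q (a, c))
  next₁ : ∀ q a c, t.next₁ (q : Fin _) (a : Fin _) (c : Fin _) = optionCode (A₁.step q (a, c))
  nextOut : ∀ q a c, t.nextOut (q : Fin _) (a : Fin _) (c : Fin _) = optionCode (outer.step q (a, c))
  acc : ∀ q : Fin _, t.acc q ↔ A.accept q = true
  acc₁ : ∀ q : Fin _, t.acc₁ q ↔ A₁.accept q = true
  accOut : ∀ q : Fin _, t.accOut q ↔ outer.accept q = true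
  compat : ∀ (x : Fin e) (y : Fin b) (z : Fin o), t.compat x y z ↔ compat x y z

/-! ### Agreement of the numerical predicates with the automata -/

namespace Tables.Represents

variable {t : Tables} {i b o e : ℕ} {A : FinDFA (Fin i × Fin o)} {A₁ : FinDFA (Fin i × Fin b)}
  {outer : FinDFA (Fin i × Fin e)} {compat : Fin e → Fin b → Fin o → Prop}

/-- The numbering of the state pairs. -/
noncomputable def pairEquiv (h : t.Represents A A₁ outer compat) :
    StatePair A A₁ ≃ Fin t.numPairs :=
  ((Equiv.refl _).prodCongr (finSuccEquiv A.numStates).symm).trans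
    (finProdFinEquiv.trans (finCongr (by rw [numPairs, h.num, h.num₁])))

theorem pairEquiv_apply (h : t.Represents A A₁ outer compat) (s : StatePair A A₁) :
    (h.pairEquiv s : ℕ) = optionCode s.2 + (t.num + 1) * s.1 := by
  obtain ⟨q, - | p⟩ := s <;> simp [pairEquiv, optionCode, h.num]

theorem pairEquiv_div (h : t.Represents A A₁ outer compat) (s : StatePair A A₁) :
    (h.pairEquiv s : ℕ) / (t.num + 1) = s.1 := by
  have := optionCode_lt s.2
  rw [h.pairEquiv_apply, Nat.add_mul_div_left _ _ (Nat.succ_pos _), Nat.div_eq_of_lt, zero_add]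
  rwa [h.num]

theorem pairEquiv_mod (h : t.Represents A A₁ outer compat) (s : StatePair A A₁) :
    (h.pairEquiv s : ℕ) % (t.num + 1) = optionCode s.2 := by
  have := optionCode_lt s.2
  rw [h.pairEquiv_apply, Nat.add_mul_mod_self_left, Nat.mod_eq_of_lt]
  rwa [h.num]

theorem pairNext_iff (h : t.Represents A A₁ outer compat) (y : Fin b) (z : Fin o)
    (s s' : StatePair A A₁) :
    t.PairNext y z (h.pairEquiv s) (h.pairEquiv s') ↔ pairStep A A₁ (y, z) s s' := by
  rw [PairNext, h.sizeI, exists_lt_iff_fin]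
  refine exists_congr fun a => ?_
  rw [h.pairEquiv_div, h.pairEquiv_div, h.pairEquiv_mod, h.pairEquiv_mod, h.next₁,
    optionCode_eq_succ]
  refine and_congr_right fun _ => ?_
  rw [← optionCode_injective.eq_iff]
  obtain ⟨q, - | p⟩ := s
  · simp [optionCode]
  · have : optionCode (some p) = p + 1 := rfl
    simp [this, h.next]

/-- The numbering of the states that consist of a set of state pairs and a state. -/
noncomputable def innerEquiv (h : t.Represents A A₁ outer compat) :
    Set (StatePair A A₁) × Fin A₁.numStates ≃ Fin t.numInner :=
  ((setEquiv h.pairEquiv).prodCongr (Equiv.refl _)).trans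
    (finProdFinEquiv.trans (finCongr (by rw [numInner, h.num₁])))

theorem innerEquiv_apply (h : t.Represents A A₁ outer compat)
    (s : Set (StatePair A A₁) × Fin A₁.numStates) :
    (h.innerEquiv s : ℕ) = s.2 + t.num₁ * (setEquiv h.pairEquiv s.1 : Fin _) := by
  simp [innerEquiv, h.num₁]

theorem innerEquiv_div (h : t.Represents A A₁ outer compat)
    (s : Set (StatePair A A₁) × Fin A₁.numStates) :
    (h.innerEquiv s : ℕ) / t.num₁ = (setEquiv h.pairEquiv s.1 : Fin _) := by
  have : (s.2 : ℕ) < t.num₁ := s.2.2.trans_eq h.num₁.symm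
  rw [h.innerEquiv_apply, Nat.add_mul_div_left _ _ (by omega), Nat.div_eq_of_lt this, zero_add]

theorem innerEquiv_mod (h : t.Represents A A₁ outer compat)
    (s : Set (StatePair A A₁) × Fin A₁.numStates) :
    (h.innerEquiv s : ℕ) % t.num₁ = s.2 := by
  have : (s.2 : ℕ) < t.num₁ := s.2.2.trans_eq h.num₁.symm
  rw [h.innerEquiv_apply, Nat.add_mul_mod_self_left, Nat.mod_eq_of_lt this]

/-- The numbering of the states of the nondeterministic automaton. -/
noncomputable def trackEquiv (h : t.Represents A A₁ outer compat) :
    TrackState A A₁ outer ≃ Fin t.numTracks :=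
  (h.innerEquiv.sumCongr (Equiv.refl _)).trans
    (finSumFinEquiv.trans (finCongr (by rw [numTracks, h.numOut])))

theorem trackEquiv_inl (h : t.Represents A A₁ outer compat)
    (s : Set (StatePair A A₁) × Fin A₁.numStates) :
    (h.trackEquiv (.inl s) : ℕ) = h.innerEquiv s := by
  simp [trackEquiv]

theorem trackEquiv_inr (h : t.Represents A A₁ outer compat) (q : Fin outer.numStates) :
    (h.trackEquiv (.inr q) : ℕ) = t.numInner + q := by
  simp [trackEquiv]

theorem innerNext_iff (h : t.Represents A A₁ outer compat) (x : Fin i) (w : Fin e)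
    (s s' : Set (StatePair A A₁) × Fin A₁.numStates) :
    t.InnerNext x w (h.innerEquiv s) (h.innerEquiv s') ↔
      TrackStep A A₁ outer compat (x, w) (.inl s) (.inl s') := by
  rw [InnerNext, h.sizeB, h.sizeO, exists_lt_iff_fin]
  simp only [exists_lt_iff_fin, h.innerEquiv_div, h.innerEquiv_mod, h.next₁, optionCode_eq_succ,
    h.compat, isImage_setEquiv h.pairEquiv (h.pairNext_iff _ _)]
  constructor
  · rintro ⟨y, z, h1, h2, h3⟩
    obtain ⟨S, q⟩ := s
    obtain ⟨S', q'⟩ := s'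
    dsimp only at h2 h3
    subst h3
    exact .refine y z h1 h2
  · intro h1
    cases h1 with
    | refine y z h1 h2 => exact ⟨y, z, h1, h2, rfl⟩

theorem trackNext_iff (h : t.Represents A A₁ outer compat) (x : Fin i) (w : Fin e)
    (s s' : TrackState A A₁ outer) : t.TrackNext x w (h.trackEquiv s) (h.trackEquiv s') ↔
      TrackStep A A₁ outer compat (x, w) s s' := by
  rcases s with s | q <;> rcases s' with s' | q' <;>
    simp only [TrackNext, h.trackEquiv_inl, h.trackEquiv_inr]
  · have h1 := (h.innerEquiv s).2
    have h2 := (h.innerEquiv s').2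
    simp [h1, h2, h1.not_ge, h2.not_ge, h.innerNext_iff]
  · have h1 := (h.innerEquiv s).2
    simp only [h1, h1.not_ge, true_and, false_and, or_false]
    constructor
    · rintro ⟨h2, -⟩; omega
    · intro h2; cases h2
  · have h1 := (h.innerEquiv s').2
    simp only [h1, h1.not_ge, true_and, false_and, and_false, or_false]
    constructor
    · rintro ⟨h2, -⟩; omega
    · intro h2; cases h2
  · have h1 : ¬t.numInner + (q : ℕ) < t.numInner := by omega
    simp only [h1, false_and, false_or, Nat.le_add_right, true_and, Nat.add_sub_cancel_left,
      h.nextOut, optionCode_eq_succ]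
    constructor
    · exact .outer
    · intro h2
      cases h2 with
      | outer h2 => exact h2

theorem edge_iff (h : t.Represents A A₁ outer compat) (S T : Set (TrackState A A₁ outer)) :
    t.Edge (setEquiv h.trackEquiv S : Fin _) (setEquiv h.trackEquiv T : Fin _) ↔
      ∃ m, T = relImage (TrackStep A A₁ outer compat m) S := by
  rw [Edge, h.sizeI, h.sizeE, exists_lt_iff_fin]
  simp only [exists_lt_iff_fin, isImage_setEquiv h.trackEquiv (h.trackNext_iff _ _), Fin.is_lt,
    true_and, Prod.exists]

theorem good_iff (h : t.Represents A A₁ outer compat) (S : Set (StatePair A A₁)) :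
    t.Good (setEquiv h.pairEquiv S : Fin _) ↔ PairGood A A₁ S := by
  rw [Good, forall_lt_iff_equiv h.pairEquiv]
  refine forall_congr' fun s => ?_
  rw [testBit_setEquiv, h.pairEquiv_div, h.pairEquiv_mod, h.acc₁]
  refine imp_congr_right fun _ => imp_congr_right fun _ => ?_
  obtain ⟨q, - | p⟩ := s
  · simp [optionCode]
  · have : optionCode (some p) = p + 1 := rfl
    simp [this, h.acc]

theorem bad_iff (h : t.Represents A A₁ outer compat) (S : Set (TrackState A A₁ outer)) :
    t.Bad (setEquiv h.trackEquiv S : Fin _) ↔ TrackBad A A₁ outer S := by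
  rw [Bad, TrackBad, h.numOut, exists_lt_iff_fin, forall_lt_iff_equiv h.innerEquiv]
  simp only [← h.trackEquiv_inr, ← h.trackEquiv_inl, testBit_setEquiv, h.accOut]
  simp only [h.trackEquiv_inl, h.innerEquiv_mod, h.innerEquiv_div, h.acc₁, h.good_iff, Prod.forall]

theorem init_iff (h : t.Represents A A₁ outer compat) (S : Set (TrackState A A₁ outer)) :
    t.Init (setEquiv h.trackEquiv S : Fin _) ↔
      S = {.inl ({(A₁.start, some A.start)}, A₁.start), .inr outer.start} := by
  rw [Init, forall_lt_iff_equiv h.trackEquiv, Set.ext_iff]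
  refine forall_congr' fun s => iff_congr (testBit_setEquiv _ _ _) ?_
  rcases s with s | q
  · have h1 := (h.innerEquiv s).2
    rw [h.trackEquiv_inl]
    have h2 : (h.innerEquiv s : ℕ) ≠ t.numInner + t.startOut := by omega
    simp only [h1, true_and, h2, or_false, Set.mem_insert_iff, Set.mem_singleton_iff, Sum.inl.injEq,
      reduceCtorEq, InitInner, h.innerEquiv_mod, h.innerEquiv_div, h.start₁]
    rw [forall_lt_iff_equiv h.pairEquiv]
    obtain ⟨S, q⟩ := s
    rw [Prod.mk.injEq, and_comm]
    refine and_congr ?_ Fin.ext_iff.symm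
    rw [Set.ext_iff]
    refine forall_congr' fun s => iff_congr (testBit_setEquiv _ _ _) ?_
    have h3 : (A₁.start : ℕ) * (t.num + 1) + (t.start + 1) =
        h.pairEquiv (A₁.start, some A.start) := by
      rw [h.pairEquiv_apply, h.start]
      simp only [optionCode, Option.elim_some]
      ring
    rw [h3, ← Fin.ext_iff, h.pairEquiv.injective.eq_iff, Set.mem_singleton_iff]
  · rw [h.trackEquiv_inr, h.startOut]
    have h1 : ¬t.numInner + (q : ℕ) < t.numInner := by omega
    simp [h1, Fin.ext_iff]

/-- Every edge ends below `2 ^ numTracks`, hence at the number of a set; so paths of numbers that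
start at a set are the same as paths of sets. -/
theorem edge_lt (h : t.Represents A A₁ outer compat) (S : Set (TrackState A A₁ outer)) (v : ℕ) :
    Relation.ReflTransGen t.Edge (setEquiv h.trackEquiv S : Fin _) v ↔
      ∃ T, v = (setEquiv h.trackEquiv T : Fin _) ∧ Relation.ReflTransGen
        (fun M M' => ∃ m, M' = relImage (TrackStep A A₁ outer compat m) M) S T := by
  constructor
  · intro h1
    induction h1 with
    | refl => exact ⟨S, rfl, .refl⟩
    | @tail v w _ hvw ih =>
      obtain ⟨T, rfl, hT⟩ := ih
      obtain ⟨T', hT'⟩ := (setEquiv h.trackEquiv).surjective ⟨w, hvw.1⟩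
      have hw : w = (setEquiv h.trackEquiv T' : Fin _) := by rw [hT']
      subst hw
      exact ⟨T', rfl, hT.tail ((h.edge_iff _ _).1 hvw)⟩
  · rintro ⟨T, rfl, hT⟩
    induction hT with
    | refl => exact .refl
    | tail _ h1 ih => exact ih.tail ((h.edge_iff _ _).2 h1)

/-- There are `2 ^ numTracks` nodes, so halving to depth `numTracks` is full reachability, and
`refinable_iff` applies to the sets behind the numbers. -/
theorem reachBad_iff (h : t.Represents A A₁ outer compat) :
    t.ReachBad ↔ ¬Refinable A A₁ outer compat := by
  rw [refinable_iff, not_not, ReachBad, exists_lt_iff_equiv (setEquiv h.trackEquiv)]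
  simp only [exists_lt_iff_equiv (setEquiv h.trackEquiv), h.init_iff, exists_eq_left, h.bad_iff,
    Fin.is_lt, true_and]
  refine exists_congr fun T => ?_
  rw [halvingReach_iff_reflTransGen (fun _ _ _ h => h.1) (Fin.is_lt _), h.edge_lt, and_comm]
  refine and_congr_left fun _ => ⟨?_, fun h1 => ⟨T, rfl, h1⟩⟩
  rintro ⟨T', h1, h2⟩
  rwa [(setEquiv h.trackEquiv).injective (Fin.ext h1)]

end Tables.Represents

/-! ### Computability of the reachability problem -/

/-- A family of tables whose entries are computable in bounded space. -/
structure TablesComputable {α : Type} [RegData α] (t : α → Tables) : Prop where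
  sizeI : SpaceComputable fun a => (t a).sizeI
  sizeB : SpaceComputable fun a => (t a).sizeB
  sizeO : SpaceComputable fun a => (t a).sizeO
  sizeE : SpaceComputable fun a => (t a).sizeE
  num : SpaceComputable fun a => (t a).num
  num₁ : SpaceComputable fun a => (t a).num₁
  numOut : SpaceComputable fun a => (t a).numOut
  start : SpaceComputable fun a => (t a).start
  start₁ : SpaceComputable fun a => (t a).start₁
  startOut : SpaceComputable fun a => (t a).startOut
  next : SpaceComputable fun x : α × ℕ × ℕ × ℕ => (t x.1).next x.2.1 x.2.2.1 x.2.2.2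
  next₁ : SpaceComputable fun x : α × ℕ × ℕ × ℕ => (t x.1).next₁ x.2.1 x.2.2.1 x.2.2.2
  nextOut : SpaceComputable fun x : α × ℕ × ℕ × ℕ => (t x.1).nextOut x.2.1 x.2.2.1 x.2.2.2
  acc : SpaceDecidable fun x : α × ℕ => (t x.1).acc x.2
  acc₁ : SpaceDecidable fun x : α × ℕ => (t x.1).acc₁ x.2
  accOut : SpaceDecidable fun x : α × ℕ => (t x.1).accOut x.2
  compat : SpaceDecidable fun x : α × ℕ × ℕ × ℕ => (t x.1).compat x.2.1 x.2.2.1 x.2.2.2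
  pow_numPairs : PolyBounded fun a => 2 ^ (t a).numPairs
  pow_numTracks : PolyBounded fun a => (2 ^ (t a).numTracks + 2) ^ (4 * (t a).numTracks)

theorem SpaceDecidable.isImage {γ : Type} [RegData γ] {M u v : γ → ℕ} {r : γ → ℕ → ℕ → Prop}
    (hM : SpaceComputable M) (hu : SpaceComputable u) (hv : SpaceComputable v)
    (hr : SpaceDecidable fun x : γ × ℕ × ℕ => r x.1 x.2.1 x.2.2) :
    SpaceDecidable fun g => IsImage (M g) (r g) (u g) (v g) := by
  refine .forall_lt (.iff (.testBit (hv.comp .fst) .snd) (.exists_lt (.and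
    (.testBit ((hu.comp .fst).comp .fst) .snd) ?_) (hM.comp .fst))) hM
  exact hr.comp ((SpaceComputable.fst.comp .fst).pair
    (SpaceComputable.snd.pair (SpaceComputable.snd.comp .fst)))

namespace TablesComputable

open SpaceComputable

variable {α : Type} [RegData α] {t : α → Tables} (h : TablesComputable t)

include h

theorem numPairs : SpaceComputable fun a => (t a).numPairs :=
  h.num₁.mul h.num.succ

theorem numInner : SpaceComputable fun a => (t a).numInner :=
  ((const 2).pow h.numPairs h.pow_numPairs).mul h.num₁

theorem numTracks : SpaceComputable fun a => (t a).numTracks :=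
  h.numInner.add h.numOut

theorem powTracks : SpaceComputable fun a => 2 ^ (t a).numTracks :=
  (const 2).pow h.numTracks <| h.pow_numTracks.mono fun a => by
    generalize (t a).numTracks = M
    -- For `M = 0` the exponent vanishes, but both sides are one.
    rcases M with - | M
    · simp
    · exact (Nat.le_add_right _ 2).trans (Nat.le_self_pow (by omega) _)

theorem pairNext : SpaceDecidable fun x : α × (ℕ × ℕ) × ℕ × ℕ =>
    (t x.1).PairNext x.2.1.1 x.2.1.2 x.2.2.1 x.2.2.2 := by
  refine .exists_lt ?_ (h.sizeI.comp fst)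
  have hA : SpaceComputable fun x : (α × (ℕ × ℕ) × ℕ × ℕ) × ℕ => x.1.1 := fst.fst'
  have hb : SpaceComputable fun x : (α × (ℕ × ℕ) × ℕ × ℕ) × ℕ => x.1.2.1.1 := fst.snd'.fst'.fst'
  have hc : SpaceComputable fun x : (α × (ℕ × ℕ) × ℕ × ℕ) × ℕ => x.1.2.1.2 := fst.snd'.fst'.snd'
  have hi : SpaceComputable fun x : (α × (ℕ × ℕ) × ℕ × ℕ) × ℕ => x.1.2.2.1 := fst.snd'.snd'.fst'
  have hj : SpaceComputable fun x : (α × (ℕ × ℕ) × ℕ × ℕ) × ℕ => x.1.2.2.2 := fst.snd'.snd'.snd'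
  have hn := (h.num.comp hA).succ
  refine .and (.eq ?_ (hj.div hn).succ) (.eq (hj.mod hn) (.ite (.eq (hi.mod hn) (const 0)) (const 0) ?_))
  · exact h.next₁.comp (hA.pair ((hi.div hn).pair (snd.pair hb)))
  · exact h.next.comp (hA.pair ((hi.mod hn).pred.pair (snd.pair hc)))

theorem innerNext : SpaceDecidable fun x : α × (ℕ × ℕ) × ℕ × ℕ =>
    (t x.1).InnerNext x.2.1.1 x.2.1.2 x.2.2.1 x.2.2.2 := by
  refine .exists_lt (.exists_lt ?_ ((h.sizeO.comp fst).comp fst)) (h.sizeB.comp fst)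
  let X := ((α × (ℕ × ℕ) × ℕ × ℕ) × ℕ) × ℕ
  have hA : SpaceComputable fun x : X => x.1.1.1 := fst.fst'.fst'
  have ha : SpaceComputable fun x : X => x.1.1.2.1.1 := fst.fst'.snd'.fst'.fst'
  have he : SpaceComputable fun x : X => x.1.1.2.1.2 := fst.fst'.snd'.fst'.snd'
  have hi : SpaceComputable fun x : X => x.1.1.2.2.1 := fst.fst'.snd'.snd'.fst'
  have hj : SpaceComputable fun x : X => x.1.1.2.2.2 := fst.fst'.snd'.snd'.snd'
  have hb : SpaceComputable fun x : X => x.1.2 := fst.snd'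
  have hn := h.num₁.comp hA
  refine .and ?_ (.and (.eq ?_ (hj.mod hn).succ)
    (.isImage (h.numPairs.comp hA) (hi.div hn) (hj.div hn) ?_))
  · exact h.compat.comp (hA.pair (he.pair (hb.pair snd)))
  · exact h.next₁.comp (hA.pair ((hi.mod hn).pair (ha.pair hb)))
  · exact h.pairNext.comp ((hA.comp fst).pair (((hb.comp fst).pair (snd.comp fst)).pair
      (snd.fst'.pair snd.snd')))

theorem trackNext : SpaceDecidable fun x : α × (ℕ × ℕ) × ℕ × ℕ =>
    (t x.1).TrackNext x.2.1.1 x.2.1.2 x.2.2.1 x.2.2.2 := by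
  let X := α × (ℕ × ℕ) × ℕ × ℕ
  have ha : SpaceComputable fun x : X => x.2.1.1 := snd.fst'.fst'
  have he : SpaceComputable fun x : X => x.2.1.2 := snd.fst'.snd'
  have hi : SpaceComputable fun x : X => x.2.2.1 := snd.snd'.fst'
  have hj : SpaceComputable fun x : X => x.2.2.2 := snd.snd'.snd'
  have hK := h.numInner.comp (fst (α := α) (β := (ℕ × ℕ) × ℕ × ℕ))
  refine .or (.and (.lt hi hK) (.and (.lt hj hK) h.innerNext))
    (.and (.le hK hi) (.and (.le hK hj) (.eq ?_ (hj.sub hK).succ)))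
  exact h.nextOut.comp (fst.pair ((hi.sub hK).pair (ha.pair he)))

theorem edge : SpaceDecidable fun x : α × ℕ × ℕ => (t x.1).Edge x.2.1 x.2.2 := by
  refine .and (.lt snd.snd' (h.powTracks.comp fst)) (.exists_lt (.exists_lt (.isImage
    (h.numTracks.comp fst.fst'.fst') fst.fst'.snd'.fst' fst.fst'.snd'.snd' ?_)
    (h.sizeE.comp fst.fst')) (h.sizeI.comp fst))
  exact h.trackNext.comp (fst.fst'.fst'.fst'.pair ((fst.fst'.snd'.pair fst.snd').pair
    (snd.fst'.pair snd.snd')))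

theorem good : SpaceDecidable fun x : α × ℕ => (t x.1).Good x.2 := by
  have hn := (h.num.comp (fst.fst' : SpaceComputable fun x : (α × ℕ) × ℕ => x.1.1)).succ
  refine .forall_lt (.imp (.testBit fst.snd' snd) (.imp ?_ (.and (.not (.eq (snd.mod hn) (const 0)))
    ?_))) (h.numPairs.comp fst)
  · exact h.acc₁.comp (fst.fst'.pair (snd.div hn))
  · exact h.acc.comp (fst.fst'.pair (snd.mod hn).pred)

theorem bad : SpaceDecidable fun x : α × ℕ => (t x.1).Bad x.2 := by
  have hn := h.num₁.comp (fst.fst' : SpaceComputable fun x : (α × ℕ) × ℕ => x.1.1)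
  refine .and (.exists_lt (.and (.testBit fst.snd' ((h.numInner.comp fst.fst').add snd)) ?_)
    (h.numOut.comp fst)) (.forall_lt (.imp (.testBit fst.snd' snd) (.imp ?_ (.not ?_)))
      (h.numInner.comp fst))
  · exact h.accOut.comp (fst.fst'.pair snd)
  · exact h.acc₁.comp (fst.fst'.pair (snd.mod hn))
  · exact h.good.comp (fst.fst'.pair (snd.div hn))

theorem init : SpaceDecidable fun x : α × ℕ => (t x.1).Init x.2 := by
  have hA : SpaceComputable fun x : (α × ℕ) × ℕ => x.1.1 := fst.fst'
  have hn := h.num₁.comp hA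
  refine .forall_lt (.iff (.testBit fst.snd' snd) (.or (.and (.lt snd (h.numInner.comp hA))
    (.and (.eq (snd.mod hn) (h.start₁.comp hA)) (.forall_lt (.iff
      (.testBit ((snd.div hn).comp fst) snd) (.eq snd ?_)) (h.numPairs.comp hA))))
    (.eq snd ((h.numInner.comp hA).add (h.startOut.comp hA))))) (h.numTracks.comp fst)
  exact (((h.start₁.comp hA).mul (h.num.comp hA).succ).add (h.start.comp hA).succ).comp fst

theorem reachBad : SpaceDecidable fun a => (t a).ReachBad := by
  refine .exists_lt (.and h.init (.exists_lt (.and ?_ ?_) (h.powTracks.comp fst))) h.powTracks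
  · exact h.bad.comp (fst.fst'.pair snd)
  · refine .halvingReach (h.powTracks.comp fst.fst') (h.numTracks.comp fst.fst') fst.snd' snd ?_ ?_
    · exact h.edge.comp (fst.fst'.fst'.pair snd)
    · obtain ⟨c, hc⟩ := h.pow_numTracks
      refine ⟨c, fun x => (hc x.1.1).trans (Nat.pow_le_pow_left (Nat.add_le_add_right ?_ 2) c)⟩
      exact (le_max_left _ _).trans (le_max_left _ _)

end TablesComputable

/-! ### Reading a sequence of numbers from a word -/

/-- The number with index `j` in a sequence of numbers that is presented in unary. -/
def unaryEntry : List Bool → ℕ → ℕ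
  | [], _ => 0
  | true :: w, 0 => unaryEntry w 0 + 1
  | true :: w, j + 1 => unaryEntry w (j + 1)
  | false :: _, 0 => 0
  | false :: w, j + 1 => unaryEntry w j

theorem unaryEntry_le_length (w : List Bool) (j : ℕ) : unaryEntry w j ≤ w.length := by
  induction w generalizing j with
  | nil => simp [unaryEntry]
  | cons b w ih =>
    rw [List.length_cons]
    cases b <;> rcases j with - | j <;> simp only [unaryEntry]
    · omega
    · have := ih j; omega
    · have := ih 0; omega
    · have := ih (j + 1); omega

theorem unaryWord_cons (m : ℕ) (l : List ℕ) :
    unaryWord (m :: l) = List.replicate m true ++ false :: unaryWord l := by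
  simp [unaryWord]

theorem unaryEntry_unaryWord (l : List ℕ) (j : ℕ) : unaryEntry (unaryWord l) j = l.getD j 0 := by
  induction l generalizing j with
  | nil => simp [unaryWord, unaryEntry]
  | cons m l ih =>
    rw [unaryWord_cons]
    induction m with
    | zero => rcases j with - | j <;> simp [unaryEntry, ih]
    | succ m ihm => rcases j with - | j <;> simpa [List.replicate_succ, unaryEntry] using ihm

theorem count_unaryWord (l : List ℕ) : (unaryWord l).count false = l.length := by
  induction l with
  | nil => rfl
  | cons m l ih => rw [unaryWord_cons]; simp [List.count_replicate, ih]

/-- The hypothesis says that no `true` follows the last `false`; otherwise the tail of the word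
would be an unterminated number. -/
theorem eq_unaryWord (w : List Bool) (h : unaryEntry w (w.count false) = 0) :
    w = unaryWord ((List.range (w.count false)).map (unaryEntry w)) := by
  induction w with
  | nil => rfl
  | cons b w ih =>
    cases b
    · rw [List.count_cons_self] at h ⊢
      rw [List.range_succ_eq_map, List.map_cons, unaryWord_cons, List.map_map]
      simp only [unaryEntry, List.replicate_zero, List.nil_append, List.cons.injEq, true_and]
      exact ih h
    · rw [List.count_cons_of_ne (by simp)] at h ⊢
      rcases hc : w.count false with - | k
      · rw [hc] at h; simp [unaryEntry] at h
      · rw [hc] at h ih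
        have := ih h
        have e : unaryEntry (true :: w) ∘ Nat.succ = unaryEntry w ∘ Nat.succ :=
          funext fun j => by simp [unaryEntry]
        rw [List.range_succ_eq_map, List.map_cons, unaryWord_cons, List.map_map] at this ⊢
        rw [e]
        simp only [unaryEntry, List.replicate_succ, List.cons_append]
        exact congrArg _ this

/-- One step of the search for an entry of a sequence of numbers. -/
def entryStep (x : ℕ × ℕ × ℕ) : ℕ × ℕ × ℕ :=
  -- The components are the rest of the word as a number, the count of entries still to skip, and
  -- the result so far. In bijective numeration `(v - 1) / 2` removes the first digit, and the
  -- parity tells which digit it was. The end of the desired entry empties the word and so stops the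
  -- search.
  if x.1 = 0 then x
  else if x.1 % 2 = 1 then
    if x.2.1 = 0 then ((x.1 - 1) / 2, 0, x.2.2 + 1) else ((x.1 - 1) / 2, x.2.1, x.2.2)
  else if x.2.1 = 0 then (0, 0, x.2.2) else ((x.1 - 1) / 2, x.2.1 - 1, x.2.2)

theorem iterate_entryStep_zero (k j s : ℕ) : entryStep^[k] (0, j, s) = (0, j, s) :=
  Function.iterate_fixed (by simp [entryStep]) k

theorem iterate_entryStep (w : List Bool) (j s k : ℕ) (hk : w.length ≤ k) :
    (entryStep^[k] (numeralValue w, j, s)).2.2 = s + unaryEntry w j := by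
  induction w generalizing j s k with
  | nil => simp [numeralValue, iterate_entryStep_zero, unaryEntry]
  | cons b w ih =>
    rcases k with - | k
    · simp at hk
    have hk' : w.length ≤ k := by simpa using hk
    rw [Function.iterate_succ_apply]
    cases b
    · have h1 : numeralValue (false :: w) = 2 * numeralValue w + 2 := rfl
      rcases j with - | j
      · have : entryStep (numeralValue (false :: w), 0, s) = (0, 0, s) := by
          simp [entryStep, h1]
        rw [this, iterate_entryStep_zero]
        simp [unaryEntry]
      · have : entryStep (numeralValue (false :: w), j + 1, s) = (numeralValue w, j, s) := by
          simp only [entryStep, h1]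
          rw [if_neg (by omega), if_neg (by omega), if_neg (by omega)]
          simp; omega
        rw [this, ih _ _ _ hk']
        simp [unaryEntry]
    · have h1 : numeralValue (true :: w) = 2 * numeralValue w + 1 := rfl
      rcases j with - | j
      · have : entryStep (numeralValue (true :: w), 0, s) = (numeralValue w, 0, s + 1) := by
          simp only [entryStep, h1]
          rw [if_neg (by omega), if_pos (by omega), if_pos trivial]
          simp
        rw [this, ih _ _ _ hk']
        simp only [unaryEntry]; omega
      · have : entryStep (numeralValue (true :: w), j + 1, s) = (numeralValue w, j + 1, s) := by
          simp only [entryStep, h1]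
          rw [if_neg (by omega), if_pos (by omega), if_neg (by omega)]
          simp
        rw [this, ih _ _ _ hk']
        simp [unaryEntry]

/-- A crude bound on the number of digits that lets a loop over the digits of `x` run `x` times,
since only space is measured. -/
theorem length_numeral_le_self (x : ℕ) : (numeral x).length ≤ x := by
  have h := two_pow_length_le (numeral x)
  rw [numeralValue_numeral] at h
  have := Nat.lt_two_pow_self (n := (numeral x).length)
  omega

/-- Removing a digit lowers the number by at least one, which pays for the increase of the counter;
so the sum is a nonincreasing potential that bounds all iterates. -/
theorem size_entryStep_le (x : ℕ × ℕ × ℕ) :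
    (entryStep x).1 + (entryStep x).2.2 ≤ x.1 + x.2.2 ∧ (entryStep x).2.1 ≤ x.2.1 := by
  unfold entryStep
  split_ifs <;> (try dsimp only) <;> omega

/-- One step of the computation of the length of a sequence of numbers. -/
def countStep (x : ℕ × ℕ) : ℕ × ℕ :=
  if x.1 = 0 then x else ((x.1 - 1) / 2, if x.1 % 2 = 0 then x.2 + 1 else x.2)

theorem iterate_countStep (w : List Bool) (s k : ℕ) (hk : w.length ≤ k) :
    (countStep^[k] (numeralValue w, s)).2 = s + w.count false := by
  induction w generalizing s k with
  | nil =>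
    rw [Function.iterate_fixed (by simp [countStep, numeralValue])]
    rfl
  | cons b w ih =>
    rcases k with - | k
    · simp at hk
    have hk' : w.length ≤ k := by simpa using hk
    rw [Function.iterate_succ_apply]
    cases b
    · have h1 : numeralValue (false :: w) = 2 * numeralValue w + 2 := rfl
      have : countStep (numeralValue (false :: w), s) = (numeralValue w, s + 1) := by
        simp only [countStep, h1]
        rw [if_neg (by omega), if_pos (by omega)]
        simp; omega
      rw [this, ih _ _ hk', List.count_cons_self]
      omega
    · have h1 : numeralValue (true :: w) = 2 * numeralValue w + 1 := rfl
      have : countStep (numeralValue (true :: w), s) = (numeralValue w, s) := by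
        simp only [countStep, h1]
        rw [if_neg (by omega), if_neg (by omega)]
        simp
      rw [this, ih _ _ hk', List.count_cons_of_ne (by simp)]

theorem size_countStep_le (x : ℕ × ℕ) :
    (countStep x).1 + (countStep x).2 ≤ x.1 + x.2 := by
  unfold countStep
  split_ifs <;> (try dsimp only) <;> omega

/-! ### Space-bounded reading of the input -/

section

open SpaceComputable

variable {α : Type} [RegData α]

theorem SpaceComputable.unaryEntry {f g : α → ℕ} (hf : SpaceComputable f) (hg : SpaceComputable g) :
    SpaceComputable fun a => unaryEntry (numeral (f a)) (g a) := by
  have hstep : SpaceComputable entryStep := by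
    have h1 : SpaceComputable fun x : ℕ × ℕ × ℕ => x.1 := fst
    have h2 : SpaceComputable fun x : ℕ × ℕ × ℕ => x.2.1 := snd.fst'
    have h3 : SpaceComputable fun x : ℕ × ℕ × ℕ => x.2.2 := snd.snd'
    have ht := h1.pred.div (const 2)
    exact .ite (.eq h1 (const 0)) .id (.ite (.eq (h1.mod (const 2)) (const 1))
      (.ite (.eq h2 (const 0)) (ht.pair ((const 0).pair h3.succ)) (ht.pair (h2.pair h3)))
      (.ite (.eq h2 (const 0)) ((const 0).pair ((const 0).pair h3)) (ht.pair (h2.pred.pair h3))))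
  have hit := iterate (step := fun _ : α => entryStep) (init := fun a => (f a, g a, 0))
    (hf.pair (hg.pair (const 0))) (hstep.comp snd) hf (hf.polyBounded.add hg.polyBounded)
    fun a k _ => by
      have key : (entryStep^[k] (f a, g a, 0)).1 + (entryStep^[k] (f a, g a, 0)).2.2 ≤ f a ∧
          (entryStep^[k] (f a, g a, 0)).2.1 ≤ g a := by
        induction k with
        | zero => simp
        | succ k ih =>
          rw [Function.iterate_succ_apply']
          have h1 := size_entryStep_le (entryStep^[k] (f a, g a, 0))
          have h2 := ih (by omega)
          omega
      simp only [size]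
      omega
  refine hit.snd'.snd'.of_eq fun a => ?_
  have := iterate_entryStep (numeral (f a)) (g a) 0 (f a) (length_numeral_le_self _)
  rwa [numeralValue_numeral, zero_add] at this

theorem SpaceComputable.countFalse {f : α → ℕ} (hf : SpaceComputable f) :
    SpaceComputable fun a => (numeral (f a)).count false := by
  have hstep : SpaceComputable countStep := by
    have h1 : SpaceComputable fun x : ℕ × ℕ => x.1 := fst
    exact .ite (.eq h1 (const 0)) .id ((h1.pred.div (const 2)).pair
      (.ite (.eq (h1.mod (const 2)) (const 0)) snd.succ snd))
  have hit := iterate (step := fun _ : α => countStep) (init := fun a => (f a, 0))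
    (hf.pair (const 0)) (hstep.comp snd) hf hf.polyBounded fun a k _ => by
      have key : (countStep^[k] (f a, 0)).1 + (countStep^[k] (f a, 0)).2 ≤ f a := by
        induction k with
        | zero => simp
        | succ k ih =>
          rw [Function.iterate_succ_apply']
          have h1 := size_countStep_le (countStep^[k] (f a, 0))
          have h2 := ih (by omega)
          omega
      simp only [size]
      omega
  refine hit.snd'.of_eq fun a => ?_
  have := iterate_countStep (numeral (f a)) 0 (f a) (length_numeral_le_self _)
  rwa [numeralValue_numeral, zero_add] at this

end

/-! ### Instances and their codes -/

/-- The numbers `f off, f (off + 1), …` are the code of the automaton. -/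
structure FinDFA.CodedAt {k l : ℕ} (A : FinDFA (Fin k × Fin l)) (f : ℕ → ℕ) (off : ℕ) : Prop where
  num : f off = A.numStates
  start : f (off + 1) = A.start
  acc : ∀ q : Fin A.numStates, f (off + 2 + q) = (A.accept q).toNat
  step : ∀ (q : Fin A.numStates) (a : Fin k) (b : Fin l),
    f (off + 2 + A.numStates + (q * (k * l) + (a * l + b))) = optionCode (A.step q (a, b))

theorem getElem?_flatMap {X Y : Type} (L : List X) (g : X → List Y) (m : ℕ)
    (hg : ∀ x, (g x).length = m) (i r : ℕ) (hr : r < m) :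
    (L.flatMap g)[i * m + r]? = L[i]?.bind fun x => (g x)[r]? := by
  induction L generalizing i with
  | nil => simp
  | cons x L ih =>
    rw [List.flatMap_cons]
    rcases i with - | i
    · rw [zero_mul, zero_add, List.getElem?_append_left (by rw [hg]; exact hr)]
      simp
    · have h1 : (g x).length ≤ (i + 1) * m + r := by rw [hg, add_mul]; omega
      rw [List.getElem?_append_right h1, hg,
        show (i + 1) * m + r - m = i * m + r by rw [add_mul]; omega, ih]
      simp

theorem FinDFA.length_code {k l : ℕ} (A : FinDFA (Fin k × Fin l)) :
    A.code.length = 2 + A.numStates + A.numStates * (k * l) := by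
  simp [FinDFA.code, List.length_flatMap]
  ring

theorem FinDFA.codedAt {k l : ℕ} (A : FinDFA (Fin k × Fin l)) (u v : List ℕ) :
    A.CodedAt (fun j => (u ++ A.code ++ v).getD j 0) u.length := by
  have key : ∀ j x, A.code[j]? = some x → (u ++ A.code ++ v).getD (u.length + j) 0 = x := by
    intro j x h
    have hj := (List.getElem?_eq_some_iff.1 h).1
    rw [List.getD_eq_getElem?_getD, List.append_assoc, List.getElem?_append_right (by omega),
      Nat.add_sub_cancel_left, List.getElem?_append_left hj, h]
    rfl
  constructor
  · exact key 0 _ (by simp [FinDFA.code])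
  · exact key 1 _ (by simp [FinDFA.code])
  · intro q
    rw [add_assoc]
    refine key _ _ ?_
    rw [FinDFA.code, List.append_assoc, List.getElem?_append_right (by simp)]
    rw [List.getElem?_append_left (by simp)]
    simp
  · intro q a b
    rw [add_assoc u.length, add_assoc u.length]
    refine key _ _ ?_
    have hr : (a * l + b : ℕ) < k * l := by
      have := b.2
      have := a.2
      nlinarith
    generalize hm : (q * (k * l) + (a * l + b) : ℕ) = m
    rw [FinDFA.code, List.getElem?_append_right (by simp; omega)]
    subst hm
    simp only [List.length_append, List.length_cons, List.length_nil, List.length_map,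
      List.length_finRange, zero_add, Nat.reduceAdd, Nat.add_sub_cancel_left]
    rw [getElem?_flatMap _ _ (k * l) (by simp [List.length_flatMap]) _ _ hr]
    rw [List.getElem?_eq_getElem (by simp), Option.bind_some,
      getElem?_flatMap _ _ l (by simp) _ _ b.2, List.getElem?_eq_getElem (by simp)]
    simp [optionCode]

theorem range_mul (n m : ℕ) : List.range (n * m) =
    (List.range n).flatMap fun q => (List.range m).map fun r => q * m + r := by
  induction n with
  | zero => simp
  | succ n ih =>
    rw [add_mul, one_mul, List.range_add, ih, List.range_succ, List.flatMap_append]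
    simp

theorem map_finRange {X : Type} (n : ℕ) (F : ℕ → X) (G : Fin n → X) (h : ∀ i, G i = F i) :
    (List.finRange n).map G = (List.range n).map F := by
  rw [← List.map_coe_finRange_eq_range, List.map_map]
  exact List.map_congr_left fun i _ => h i

theorem flatMap_finRange {X : Type} (n : ℕ) (F : ℕ → List X) (G : Fin n → List X)
    (h : ∀ i, G i = F i) : (List.finRange n).flatMap G = (List.range n).flatMap F := by
  rw [List.flatMap_def, List.flatMap_def, map_finRange n F G h]

theorem FinDFA.CodedAt.code_eq {k l : ℕ} {A : FinDFA (Fin k × Fin l)} {f : ℕ → ℕ} {off : ℕ}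
    (h : A.CodedAt f off) : A.code =
      (List.range (2 + A.numStates + A.numStates * (k * l))).map fun i => f (off + i) := by
  rw [List.range_add, List.range_add, List.map_append, List.map_append, List.map_map, List.map_map,
    FinDFA.code]
  congr 1
  · congr 1
    · simp [List.range_succ, h.num, h.start]
    · refine map_finRange _ _ _ fun q => ?_
      rw [← h.acc, add_assoc]
      rfl
  · rw [range_mul, List.map_flatMap]
    refine flatMap_finRange _ _ _ fun q => ?_
    rw [range_mul, List.map_flatMap, List.map_flatMap]
    refine flatMap_finRange _ _ _ fun a => ?_
    rw [List.map_map, List.map_map]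
    refine map_finRange _ _ _ fun b => ?_
    refine (h.step q a b).symm.trans ?_
    simp only [Function.comp_apply]
    congr 1
    omega

/-- The numbers `f off, f (off + 1), …` are the code of some automaton. -/
def IsDFACode (f : ℕ → ℕ) (off k l : ℕ) : Prop :=
  f (off + 1) < f off ∧ (∀ q < f off, f (off + 2 + q) ≤ 1) ∧
    ∀ q < f off, ∀ a < k, ∀ b < l, f (off + 2 + f off + (q * (k * l) + (a * l + b))) ≤ f off

theorem FinDFA.CodedAt.isDFACode {k l : ℕ} {A : FinDFA (Fin k × Fin l)} {f : ℕ → ℕ} {off : ℕ}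
    (h : A.CodedAt f off) : IsDFACode f off k l := by
  refine ⟨by rw [h.num, h.start]; exact A.start.2, fun q hq => ?_, fun q hq a ha b hb => ?_⟩
  · rw [h.num] at hq
    have := h.acc ⟨q, hq⟩
    dsimp only at this
    rw [this]
    cases A.accept ⟨q, hq⟩ <;> simp
  · rw [h.num] at hq ⊢
    have := h.step ⟨q, hq⟩ ⟨a, ha⟩ ⟨b, hb⟩
    dsimp only at this
    rw [this]
    exact Nat.lt_succ_iff.1 (optionCode_lt _)

theorem IsDFACode.exists_codedAt {f : ℕ → ℕ} {off k l : ℕ} (h : IsDFACode f off k l) :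
    ∃ A : FinDFA (Fin k × Fin l), A.CodedAt f off := by
  obtain ⟨h1, h2, h3⟩ := h
  refine ⟨⟨f off, ⟨f (off + 1), h1⟩, fun q => decide (f (off + 2 + q) = 1), fun q p =>
    if hp : f (off + 2 + f off + (q * (k * l) + (p.1 * l + p.2))) = 0 then none
    else some ⟨f (off + 2 + f off + (q * (k * l) + (p.1 * l + p.2))) - 1, by
      have := h3 q q.2 p.1 p.1.2 p.2 p.2.2
      omega⟩⟩, rfl, rfl, fun q => ?_, fun q a b => ?_⟩
  · have := h2 q q.2
    dsimp only
    rcases Nat.le_one_iff_eq_zero_or_eq_one.1 this with h | h <;> simp [h]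
  · dsimp only
    split_ifs with hp
    · rw [hp]; rfl
    · simp only [optionCode, Option.elim_some]
      omega

/-- The position of the code of the second automaton. -/
def secondOffset (f : ℕ → ℕ) : ℕ := 3 + (2 + f 3 + f 3 * (f 0 * f 2))

/-- The length of the code of an instance. -/
def instanceLength (f : ℕ → ℕ) : ℕ :=
  secondOffset f + (2 + f (secondOffset f) + f (secondOffset f) * (f 0 * f 1))

/-- The word presents an instance. -/
def IsInstanceCode (w : List Bool) : Prop :=
  IsDFACode (unaryEntry w) 3 (unaryEntry w 0) (unaryEntry w 2) ∧
    IsDFACode (unaryEntry w) (secondOffset (unaryEntry w)) (unaryEntry w 0) (unaryEntry w 1) ∧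
    -- Every number ends with one `false`, so this fixes how many numbers there are; the next
    -- condition forbids an unterminated remainder.
    w.count false = instanceLength (unaryEntry w) ∧
    unaryEntry w (instanceLength (unaryEntry w)) = 0

/-- The sequence `f` of numbers is the code of an instance. -/
structure HintInstance.CodedBy (x : HintInstance) (f : ℕ → ℕ) : Prop where
  sizeI : f 0 = x.sizeI
  sizeB : f 1 = x.sizeB
  sizeO : f 2 = x.sizeO
  dfaR : x.dfaR.CodedAt f 3
  dfaR₁ : x.dfaR₁.CodedAt f (secondOffset f)

theorem HintInstance.codedBy_encode (x : HintInstance) : x.CodedBy (unaryEntry x.encode) := by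
  have hf : unaryEntry x.encode = fun j =>
      ([x.sizeI, x.sizeB, x.sizeO] ++ x.dfaR.code ++ x.dfaR₁.code).getD j 0 :=
    funext fun j => unaryEntry_unaryWord _ j
  have h1 := x.dfaR.codedAt [x.sizeI, x.sizeB, x.sizeO] x.dfaR₁.code
  have h2 := x.dfaR₁.codedAt ([x.sizeI, x.sizeB, x.sizeO] ++ x.dfaR.code) []
  rw [List.append_nil] at h2
  rw [← hf] at h1 h2
  have e0 : unaryEntry x.encode 0 = x.sizeI := by rw [hf]; rfl
  have e2 : unaryEntry x.encode 2 = x.sizeO := by rw [hf]; rfl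
  refine ⟨e0, by rw [hf]; rfl, e2, h1, ?_⟩
  have e3 : unaryEntry x.encode 3 = x.dfaR.numStates := h1.num
  rw [secondOffset, e0, e2, e3, ← x.dfaR.length_code]
  have e4 : ([x.sizeI, x.sizeB, x.sizeO] ++ x.dfaR.code).length = 3 + x.dfaR.code.length := by
    rw [List.length_append]; rfl
  rwa [e4] at h2

theorem HintInstance.CodedBy.instanceLength {x : HintInstance} {f : ℕ → ℕ} (h : x.CodedBy f) :
    instanceLength f = ([x.sizeI, x.sizeB, x.sizeO] ++ x.dfaR.code ++ x.dfaR₁.code).length := by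
  rw [_root_.instanceLength, h.dfaR₁.num, secondOffset, h.dfaR.num, h.sizeI, h.sizeB, h.sizeO,
    List.length_append, List.length_append, x.dfaR.length_code, x.dfaR₁.length_code]
  rfl

theorem HintInstance.isInstanceCode_encode (x : HintInstance) : IsInstanceCode x.encode := by
  have h := x.codedBy_encode
  refine ⟨?_, ?_, ?_, ?_⟩
  · rw [h.sizeI, h.sizeO]; exact h.dfaR.isDFACode
  · rw [h.sizeI, h.sizeB]; exact h.dfaR₁.isDFACode
  · rw [h.instanceLength]; exact count_unaryWord _
  · rw [h.instanceLength, HintInstance.encode, unaryEntry_unaryWord]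
    exact List.getD_eq_default _ _ le_rfl

theorem map_range_add_add (f : ℕ → ℕ) (m n : ℕ) : (List.range (3 + m + n)).map f =
    [f 0, f 1, f 2] ++ (List.range m).map (fun i => f (3 + i)) ++
      (List.range n).map (fun i => f (3 + m + i)) := by
  rw [List.range_add, List.range_add]
  simp [List.range_succ, Function.comp_def]

theorem IsInstanceCode.exists_encode {w : List Bool} (h : IsInstanceCode w) :
    ∃ x : HintInstance, x.encode = w := by
  obtain ⟨h1, h2, h3, h4⟩ := h
  obtain ⟨A, hA⟩ := h1.exists_codedAt
  obtain ⟨A₁, hA₁⟩ := h2.exists_codedAt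
  refine ⟨⟨unaryEntry w 0, unaryEntry w 1, unaryEntry w 2, A, A₁⟩, ?_⟩
  refine Eq.trans ?_ (eq_unaryWord w (h3 ▸ h4)).symm
  rw [HintInstance.encode, h3, hA.code_eq, hA₁.code_eq]
  congr 1
  have h5 : secondOffset (unaryEntry w) =
      3 + (2 + A.numStates + A.numStates * (unaryEntry w 0 * unaryEntry w 2)) := by
    rw [secondOffset, hA.num]
  have h6 := hA₁.num
  rw [instanceLength, h6]
  rw [h5] at h6 ⊢
  exact (map_range_add_add _ _ _).symm

/-! ### The tables of an instance -/

/-- The tables of the automata of the instance with code `f`. The outer automaton is the one with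
code at position `off`, and its second alphabet has size `e`. -/
def instanceTables (f : ℕ → ℕ) (off e : ℕ) (compat : ℕ → ℕ → ℕ → Prop) : Tables where
  sizeI := f 0
  sizeB := f 1
  sizeO := f 2
  sizeE := e
  num := f 3
  num₁ := f (secondOffset f)
  numOut := f off
  start := f (3 + 1)
  start₁ := f (secondOffset f + 1)
  startOut := f (off + 1)
  next q a c := f (3 + 2 + f 3 + (q * (f 0 * f 2) + (a * f 2 + c)))
  next₁ q a b := f (secondOffset f + 2 + f (secondOffset f) + (q * (f 0 * f 1) + (a * f 1 + b)))
  nextOut q a b := f (off + 2 + f off + (q * (f 0 * e) + (a * e + b)))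
  acc q := f (3 + 2 + q) = 1
  acc₁ q := f (secondOffset f + 2 + q) = 1
  accOut q := f (off + 2 + q) = 1
  compat := compat

theorem FinDFA.CodedAt.acc_eq_one {k l : ℕ} {A : FinDFA (Fin k × Fin l)} {f : ℕ → ℕ} {off : ℕ}
    (h : A.CodedAt f off) (q : Fin A.numStates) : f (off + 2 + q) = 1 ↔ A.accept q = true := by
  rw [h.acc]
  cases A.accept q <;> simp

theorem HintInstance.CodedBy.represents {x : HintInstance} {f : ℕ → ℕ} (h : x.CodedBy f)
    {off e : ℕ} {outer : FinDFA (Fin x.sizeI × Fin e)} (ho : outer.CodedAt f off)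
    {compat : ℕ → ℕ → ℕ → Prop} {compat' : Fin e → Fin x.sizeB → Fin x.sizeO → Prop}
    (hc : ∀ i j k, compat (i : Fin e) (j : Fin x.sizeB) (k : Fin x.sizeO) ↔ compat' i j k) :
    (instanceTables f off e compat).Represents x.dfaR x.dfaR₁ outer compat' where
  sizeI := h.sizeI
  sizeB := h.sizeB
  sizeO := h.sizeO
  sizeE := rfl
  num := h.dfaR.num
  num₁ := h.dfaR₁.num
  numOut := ho.num
  start := h.dfaR.start
  start₁ := h.dfaR₁.start
  startOut := ho.start
  next q a c := by
    rw [← h.dfaR.step]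
    simp only [instanceTables, h.dfaR.num, h.sizeI, h.sizeO]
  next₁ q a c := by
    rw [← h.dfaR₁.step]
    simp only [instanceTables, h.dfaR₁.num, h.sizeI, h.sizeB]
  nextOut q a c := by
    rw [← ho.step]
    simp only [instanceTables, ho.num, h.sizeI]
  acc := h.dfaR.acc_eq_one
  acc₁ := h.dfaR₁.acc_eq_one
  accOut := ho.acc_eq_one
  compat := hc

/-- The tables for the condition that the images of the hint lie in the domain. -/
def codTables (f : ℕ → ℕ) : Tables := instanceTables f (secondOffset f) (f 1) fun e b _ => e = b

/-- The tables for the condition that the composition contains the given relation. -/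
def totalTables (f : ℕ → ℕ) : Tables := instanceTables f 3 (f 2) fun e _ c => e = c

/-- The tables for the condition that the composition has the domain of the given relation. -/
def domTables (f : ℕ → ℕ) : Tables := instanceTables f 3 (f 2) fun _ _ _ => True

namespace HintInstance.CodedBy

variable {x : HintInstance} {f : ℕ → ℕ} (h : x.CodedBy f)

include h

theorem codTables : (codTables f).ReachBad ↔
    ¬Refinable x.dfaR x.dfaR₁ x.dfaR₁ fun e b _ => e = b := by
  rw [_root_.codTables, h.sizeB]
  exact (h.represents h.dfaR₁ fun _ _ _ => Fin.ext_iff.symm).reachBad_iff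

theorem totalTables : (totalTables f).ReachBad ↔
    ¬Refinable x.dfaR x.dfaR₁ x.dfaR fun e _ c => e = c := by
  rw [_root_.totalTables, h.sizeO]
  exact (h.represents h.dfaR fun _ _ _ => Fin.ext_iff.symm).reachBad_iff

theorem domTables : (domTables f).ReachBad ↔
    ¬Refinable x.dfaR x.dfaR₁ x.dfaR fun _ _ _ => True := by
  rw [_root_.domTables, h.sizeO]
  exact (h.represents h.dfaR fun _ _ _ => Iff.rfl).reachBad_iff

theorem hasTD_iff : x.HasTD ↔
    ¬(_root_.codTables f).ReachBad ∧ ¬(_root_.totalTables f).ReachBad := by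
  rw [h.codTables, h.totalTables, not_not, not_not]
  exact exists_tdCondition_iff

theorem hasPD_iff : x.HasPD ↔
    ¬(_root_.codTables f).ReachBad ∧ ¬(_root_.domTables f).ReachBad := by
  rw [h.codTables, h.domTables, not_not, not_not]
  exact exists_pdCondition_iff

end HintInstance.CodedBy

/-- The property depends only on the number sequence, and `IsInstanceCode` suffices to rebuild an
instance; so both the syntax check and the question are decided from the entries of the word. -/
theorem exists_encode_iff {P : HintInstance → Prop} {Q : (ℕ → ℕ) → Prop}
    (h : ∀ x f, x.CodedBy f → (P x ↔ Q f)) (w : List Bool) :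
    (∃ x : HintInstance, x.encode = w ∧ P x) ↔ IsInstanceCode w ∧ Q (unaryEntry w) := by
  constructor
  · rintro ⟨x, rfl, hx⟩
    exact ⟨x.isInstanceCode_encode, (h x _ x.codedBy_encode).1 hx⟩
  · rintro ⟨h1, h2⟩
    obtain ⟨x, rfl⟩ := h1.exists_encode
    exact ⟨x, rfl, (h x _ x.codedBy_encode).2 h2⟩

theorem mem_tdpHint (w : List Bool) : w ∈ TDPHint ↔ IsInstanceCode w ∧
    ¬(codTables (unaryEntry w)).ReachBad ∧ ¬(totalTables (unaryEntry w)).ReachBad :=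
  exists_encode_iff (Q := fun f => ¬(codTables f).ReachBad ∧ ¬(totalTables f).ReachBad)
    (fun _ _ h => h.hasTD_iff) w

theorem mem_pdpHint (w : List Bool) : w ∈ PDPHint ↔ IsInstanceCode w ∧
    ¬(codTables (unaryEntry w)).ReachBad ∧ ¬(domTables (unaryEntry w)).ReachBad :=
  exists_encode_iff (Q := fun f => ¬(codTables f).ReachBad ∧ ¬(domTables f).ReachBad)
    (fun _ _ h => h.hasPD_iff) w

/-! ### Computability of the tables -/

section

open SpaceComputable

variable {α : Type} [RegData α] {f : α → ℕ → ℕ} (hf : SpaceComputable fun x : α × ℕ => f x.1 x.2)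

include hf

theorem SpaceComputable.secondOffset : SpaceComputable fun a => secondOffset (f a) := by
  have h n : SpaceComputable fun a => f a n := hf.comp (SpaceComputable.id.pair (const n))
  exact (const 3).add (((const 2).add (h 3)).add ((h 3).mul ((h 0).mul (h 2))))

theorem SpaceComputable.instanceLength : SpaceComputable fun a => instanceLength (f a) := by
  have h n : SpaceComputable fun a => f a n := hf.comp (SpaceComputable.id.pair (const n))
  have h2 : SpaceComputable fun a => f a (_root_.secondOffset (f a)) :=
    hf.comp (SpaceComputable.id.pair (secondOffset hf))
  exact (secondOffset hf).add (((const 2).add h2).add (h2.mul ((h 0).mul (h 1))))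

theorem SpaceDecidable.isDFACode {off k l : α → ℕ} (ho : SpaceComputable off)
    (hk : SpaceComputable k) (hl : SpaceComputable l) :
    SpaceDecidable fun a => IsDFACode (f a) (off a) (k a) (l a) := by
  have hn : SpaceComputable fun a => f a (off a) := hf.comp (SpaceComputable.id.pair ho)
  refine .and (.lt (hf.comp (SpaceComputable.id.pair ho.succ)) hn) (.and (.forall_lt (.le (hf.comp
    (fst.pair (((ho.comp fst).add (SpaceComputable.const 2)).add snd)))
    (SpaceComputable.const 1)) hn) (.forall_lt (.forall_lt
    (.forall_lt (.le ?_ (hn.comp fst.fst'.fst')) (hl.comp fst.fst')) (hk.comp fst)) hn))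
  have hA : SpaceComputable fun x : ((α × ℕ) × ℕ) × ℕ => x.1.1.1 := fst.fst'.fst'
  exact hf.comp (hA.pair ((((ho.comp hA).add (SpaceComputable.const 2)).add (hn.comp hA)).add
    ((fst.fst'.snd'.mul ((hk.comp hA).mul (hl.comp hA))).add
      ((fst.snd'.mul (hl.comp hA)).add snd))))

theorem TablesComputable.instanceTables {off e : α → ℕ} (ho : SpaceComputable off)
    (he : SpaceComputable e) {compat : ℕ → ℕ → ℕ → Prop}
    (hc : SpaceDecidable fun x : ℕ × ℕ × ℕ => compat x.1 x.2.1 x.2.2)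
    -- Here `k` stands for the number of outer states, which is some entry of `f`, and `M` is then
    -- the `numTracks` of the tables.
    (hb : ∀ k : α → ℕ, (∃ i : α → ℕ, ∀ a, k a = f a (i a)) →
      let M := fun a => 2 ^ (f a (_root_.secondOffset (f a)) * (f a 3 + 1)) *
        f a (_root_.secondOffset (f a)) + k a
      PolyBounded fun a => (2 ^ M a + 2) ^ (4 * M a))
    (hb' : PolyBounded fun a => 2 ^ (f a (_root_.secondOffset (f a)) * (f a 3 + 1))) :
    TablesComputable fun a => instanceTables (f a) (off a) (e a) compat := by
  have h n : SpaceComputable fun a => f a n := hf.comp (SpaceComputable.id.pair (const n))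
  have at_ {g : α → ℕ} (hg : SpaceComputable g) : SpaceComputable fun a => f a (g a) :=
    hf.comp (SpaceComputable.id.pair hg)
  have h2 := SpaceComputable.secondOffset hf
  have hacc {g : α → ℕ} (hg : SpaceComputable g) :
      SpaceDecidable fun x : α × ℕ => f x.1 (g x.1 + 2 + x.2) = 1 :=
    .eq (hf.comp (fst.pair (((hg.comp fst).add (const 2)).add snd))) (const 1)
  have hnext {g k l : α → ℕ} (hg : SpaceComputable g) (hk : SpaceComputable k)
      (hl : SpaceComputable l) : SpaceComputable fun x : α × ℕ × ℕ × ℕ =>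
        f x.1 (g x.1 + 2 + f x.1 (g x.1) +
          (x.2.1 * (k x.1 * l x.1) + (x.2.2.1 * l x.1 + x.2.2.2))) :=
    hf.comp (fst.pair ((((hg.comp fst).add (const 2)).add ((at_ hg).comp fst)).add
      ((snd.fst'.mul ((hk.comp fst).mul (hl.comp fst))).add
        ((snd.snd'.fst'.mul (hl.comp fst)).add snd.snd'.snd'))))
  exact {
    sizeI := h 0
    sizeB := h 1
    sizeO := h 2
    sizeE := he
    num := h 3
    num₁ := at_ h2
    numOut := at_ ho
    start := h (3 + 1)
    start₁ := at_ h2.succ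
    startOut := at_ ho.succ
    next := hnext (const 3) (h 0) (h 2)
    next₁ := hnext h2 (h 0) (h 1)
    nextOut := hnext ho (h 0) he
    acc := hacc (const 3)
    acc₁ := hacc h2
    accOut := hacc ho
    compat := hc.comp snd
    pow_numPairs := hb'
    pow_numTracks := hb _ ⟨off, fun _ => rfl⟩ }

end

/-! ### Words as data -/

/-- A word, in the form of the number that presents it in bijective binary numeration. -/
structure WordNumber where
  val : ℕ

/-- The word that is presented by a number. -/
def WordNumber.word (a : WordNumber) : List Bool := numeral a.val

/-- The size is doubly exponential in the length of the word, so that computations with numbers that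
are bounded by a polynomial in the size take exponential space. -/
instance : RegData WordNumber where
  dim := 1
  get a _ := a.val
  size a := 2 ^ 2 ^ (3 * (a.word.length + 2) ^ 2)

theorem SpaceComputable.val : SpaceComputable fun a : WordNumber => a.val := by
  refine reindex (PolyBounded.size.mono fun a => ?_) (fun _ => 0) (fun _ _ => Nat.one_pos)
    fun _ _ _ => rfl
  have h := numeralValue_lt a.word
  rw [WordNumber.word, numeralValue_numeral] at h
  refine (show a.val ≤ a.val + 1 by omega).trans (h.le.trans (Nat.pow_le_pow_right (by omega) ?_))
  refine Nat.lt_two_pow_self.le.trans (Nat.pow_le_pow_right (by omega) ?_)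
  change a.word.length + 1 ≤ 3 * (a.word.length + 2) ^ 2
  nlinarith

theorem SpaceComputable.entry :
    SpaceComputable fun x : WordNumber × ℕ => _root_.unaryEntry x.1.word x.2 :=
  .unaryEntry (val.comp .fst) .snd

/-- Unary encoding bounds all state numbers by the word length `l`. The left side is then at most `2
^ (l * (l + 1)) * (2 * l)`, which is at most `2 ^ (l + 1) ^ 2`. -/
theorem numTracks_le {n m k l : ℕ} (hn : n ≤ l) (hm : m ≤ l) (hk : k ≤ l) :
    2 ^ (m * (n + 1)) * m + k ≤ 2 ^ (l + 2) ^ 2 := by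
  have h1 : 2 ^ (m * (n + 1)) ≤ 2 ^ (l * (l + 1)) :=
    Nat.pow_le_pow_right (by omega) (Nat.mul_le_mul hm (by omega))
  have h2 : 1 ≤ 2 ^ (l * (l + 1)) := Nat.one_le_two_pow
  have h3 : 2 * l ≤ 2 ^ (l + 1) := by
    rw [pow_succ]
    have := (Nat.lt_two_pow_self (n := l)).le
    omega
  calc 2 ^ (m * (n + 1)) * m + k ≤ 2 ^ (l * (l + 1)) * l + 2 ^ (l * (l + 1)) * l :=
        Nat.add_le_add (Nat.mul_le_mul h1 hm) (hk.trans (Nat.le_mul_of_pos_left _ h2))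
    _ = 2 ^ (l * (l + 1)) * (2 * l) := by ring
    _ ≤ 2 ^ (l * (l + 1)) * 2 ^ (l + 1) := Nat.mul_le_mul_left _ h3
    _ = 2 ^ (l * (l + 1) + (l + 1)) := (pow_add _ _ _).symm
    _ ≤ 2 ^ (l + 2) ^ 2 := Nat.pow_le_pow_right (by omega) (by nlinarith)

/-- This is the origin of the size of a `WordNumber`. With `X = 2 ^ (l + 2) ^ 2`, the exponent of
two on the left is at most `(X + 2) * (4 * X) ≤ X ^ 3`, as `X ≥ 16`. -/
theorem pow_numTracks_le {M l : ℕ} (h : M ≤ 2 ^ (l + 2) ^ 2) :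
    (2 ^ M + 2) ^ (4 * M) ≤ 2 ^ 2 ^ (3 * (l + 2) ^ 2) := by
  have h1 : 2 ^ M + 2 ≤ 2 ^ (M + 2) := by
    have : 1 ≤ 2 ^ M := Nat.one_le_two_pow
    rw [pow_add]; omega
  refine (Nat.pow_le_pow_left h1 _).trans ?_
  rw [← pow_mul]
  refine Nat.pow_le_pow_right (by omega) ?_
  rw [mul_comm 3, pow_mul]
  have h2 : 16 ≤ 2 ^ (l + 2) ^ 2 :=
    (show 16 = 2 ^ 4 by norm_num) ▸ Nat.pow_le_pow_right (by omega)
      (Nat.pow_le_pow_left (show 2 ≤ l + 2 by omega) 2)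
  generalize 2 ^ (l + 2) ^ 2 = X at h h2
  calc (M + 2) * (4 * M) ≤ (X + 2) * (4 * X) := Nat.mul_le_mul (by omega) (by omega)
    _ ≤ X * X * 16 := by nlinarith
    _ ≤ X ^ 3 := by rw [pow_succ, sq]; exact Nat.mul_le_mul_left _ h2

theorem TablesComputable.word {off e : WordNumber → ℕ} (ho : SpaceComputable off)
    (he : SpaceComputable e) {compat : ℕ → ℕ → ℕ → Prop}
    (hc : SpaceDecidable fun x : ℕ × ℕ × ℕ => compat x.1 x.2.1 x.2.2) : TablesComputable
      fun a : WordNumber => _root_.instanceTables (unaryEntry a.word) (off a) (e a) compat := by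
  refine .instanceTables (f := fun a => unaryEntry a.word) SpaceComputable.entry ho he hc ?_ ?_
  · rintro k ⟨i, hk⟩
    exact PolyBounded.size.mono fun a => pow_numTracks_le <|
      numTracks_le (unaryEntry_le_length _ _) (unaryEntry_le_length _ _)
        (hk a ▸ unaryEntry_le_length _ _)
  · refine PolyBounded.size.mono fun a => Nat.pow_le_pow_right (by omega) ?_
    set l := a.word.length with hl
    calc _ ≤ l * (l + 1) := Nat.mul_le_mul (unaryEntry_le_length _ _)
          (Nat.succ_le_succ (unaryEntry_le_length _ _))
      _ ≤ 3 * (l + 2) ^ 2 := by nlinarith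
      _ ≤ 2 ^ (3 * (l + 2) ^ 2) := Nat.lt_two_pow_self.le

theorem SpaceDecidable.isInstanceCode :
    SpaceDecidable fun a : WordNumber => IsInstanceCode a.word := by
  have hf := SpaceComputable.entry
  have h n : SpaceComputable fun a : WordNumber => unaryEntry a.word n :=
    hf.comp (SpaceComputable.id.pair (.const n))
  have hl := SpaceComputable.instanceLength (f := fun a : WordNumber => unaryEntry a.word) hf
  exact .and (.isDFACode (f := fun a => unaryEntry a.word) hf (.const 3) (h 0) (h 2))
    (.and (.isDFACode (f := fun a => unaryEntry a.word) hf
      (SpaceComputable.secondOffset (f := fun a : WordNumber => unaryEntry a.word) hf) (h 0) (h 1))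
    (.and (.eq (.countFalse SpaceComputable.val) hl)
      (.eq (hf.comp (SpaceComputable.id.pair hl)) (.const 0))))

theorem SpaceDecidable.reachBad_codTables :
    SpaceDecidable fun a : WordNumber => (codTables (unaryEntry a.word)).ReachBad :=
  (TablesComputable.word
    (SpaceComputable.secondOffset (f := fun a : WordNumber => unaryEntry a.word) .entry)
    (SpaceComputable.entry.comp (.pair .id (.const 1)))
    (.eq .fst SpaceComputable.snd.fst')).reachBad

theorem SpaceDecidable.reachBad_totalTables :
    SpaceDecidable fun a : WordNumber => (totalTables (unaryEntry a.word)).ReachBad :=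
  (TablesComputable.word (.const 3) (SpaceComputable.entry.comp (.pair .id (.const 2)))
    (.eq .fst SpaceComputable.snd.snd')).reachBad

theorem SpaceDecidable.reachBad_domTables :
    SpaceDecidable fun a : WordNumber => (domTables (unaryEntry a.word)).ReachBad :=
  (TablesComputable.word (.const 3) (SpaceComputable.entry.comp (.pair .id (.const 2)))
    (.const True)).reachBad

/-! ### Membership in EXPSPACE -/

/-- Numbers polynomial in `2 ^ E w` have logarithms linear in `E w`, and `E w` is two to a
polynomial in the length of `w`. -/
theorem SpaceDecidable.inEXPSPACE {L : Language Bool}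
    (hL : SpaceDecidable fun a : WordNumber => a.word ∈ L) : InEXPSPACE L := by
  obtain ⟨c, -, h⟩ := hL
  -- The input is in register `0` and the answer appears in register `1`.
  obtain ⟨P, hP⟩ := h 1 (fun _ => 0) fun _ _ => Nat.one_pos
  obtain ⟨n, hn⟩ := P.exists_regsLT
  let E (w : List Bool) : ℕ := 2 ^ (3 * (w.length + 2) ^ 2)
  -- The exponent is `c + 1` rather than `c` so that the bound also covers the input itself when `c
  -- = 0`.
  let B (w : List Bool) : ℕ := (2 ^ E w + 2) ^ (c + 1)
  have hB w : numeralValue w ≤ B w := by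
    have h1 := numeralValue_lt w
    have h2 : w.length + 1 ≤ E w :=
      le_trans (by nlinarith) (Nat.lt_two_pow_self (n := 3 * (w.length + 2) ^ 2)).le
    have h3 : 2 ^ (w.length + 1) ≤ 2 ^ E w := Nat.pow_le_pow_right (by omega) h2
    have h4 : 2 ^ E w + 2 ≤ B w := Nat.le_self_pow (by omega) _
    omega
  -- The constant term absorbs the number `n + 3` of stacks and the linear factor `3 * c + 4`,
  -- because `m ≤ 2 ^ m`.
  refine ⟨3 * (Polynomial.X + 2) ^ 2 + Polynomial.C ((n + 3) * (3 * c + 4)),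
    nonempty_spaceDecider_of_run P (n + 1) 1 (hn.mono (by omega)) (by omega) B hB (fun w => ?_)
      fun w => ?_⟩
  · have h1 : B w + 1 ≤ 2 ^ ((E w + 2) * (c + 1) + 1) := by
      have h1 : 2 ^ E w + 2 ≤ 2 ^ (E w + 2) := by
        have : 1 ≤ 2 ^ E w := Nat.one_le_two_pow
        rw [pow_add]; omega
      have h2 := Nat.pow_le_pow_left h1 (c + 1)
      rw [← pow_mul] at h2
      have : 1 ≤ 2 ^ ((E w + 2) * (c + 1)) := Nat.one_le_two_pow
      rw [pow_succ]
      change (2 ^ E w + 2) ^ (c + 1) + 1 ≤ _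
      omega
    have h2 := Nat.log_mono_right (b := 2) h1
    rw [Nat.log_pow (by omega)] at h2
    have h3 : 1 ≤ E w := Nat.one_le_two_pow
    simp only [Polynomial.eval_add, Polynomial.eval_mul, Polynomial.eval_pow, Polynomial.eval_X,
      Polynomial.eval_C, Polynomial.eval_ofNat, pow_add]
    change _ ≤ E w * _
    calc (n + 1 + 2) * Nat.log 2 (B w + 1) ≤ (n + 3) * ((E w + 2) * (c + 1) + 1) :=
          Nat.mul_le_mul_left _ h2
      _ ≤ (n + 3) * (E w * (3 * c + 4)) := Nat.mul_le_mul_left _ (by nlinarith)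
      _ = E w * ((n + 3) * (3 * c + 4)) := by ring
      _ ≤ E w * 2 ^ ((n + 3) * (3 * c + 4)) := Nat.mul_le_mul_left _ Nat.lt_two_pow_self.le
  · have hw : (WordNumber.mk (numeralValue w)).word = w := numeral_numeralValue w
    have hsize : size (WordNumber.mk (numeralValue w)) = 2 ^ E w := by
      show 2 ^ 2 ^ (3 * ((WordNumber.mk (numeralValue w)).word.length + 2) ^ 2) = _
      rw [hw]
    obtain ⟨t, ht, h1, -⟩ := hP ⟨numeralValue w⟩ (inputStore w) (B w) (fun _ _ => rfl)
      (inputStore_le (hB w))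
      (by rw [hsize]; exact Nat.pow_le_pow_right (by omega) (by omega))
    refine ⟨t, ht, ?_⟩
    have h2 : t 1 = truthValue ((WordNumber.mk (numeralValue w)).word ∈ L) := h1 0 Nat.one_pos
    rw [h2, hw]
    exact truthValue_ne_zero

theorem theorem6p4 : InEXPSPACE TDPHint ∧ InEXPSPACE PDPHint := by
  constructor
  · refine SpaceDecidable.inEXPSPACE (.of_iff ?_ fun a => (mem_tdpHint a.word).symm)
    exact .and .isInstanceCode (.and (.not .reachBad_codTables) (.not .reachBad_totalTables))
  · refine SpaceDecidable.inEXPSPACE (.of_iff ?_ fun a => (mem_pdpHint a.word).symm)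
    exact .and .isInstanceCode (.and (.not .reachBad_codTables) (.not .reachBad_domTables))
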